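/- Let $d_0,d_1\ge 6$ and let $T$ be the $(d_0,d_1)$-semiregular tree, with bipartition $V(T)=V_0(T)\sqcup V_1(T)$ such that each vertex of type $t\in\{0,1\}$ (i.e. in $V_t(T)$) has exactly $d_t$ neighbours, and adjacent vertices have different types. Let $\mathrm{Aut}(T)$ carry the topology of pointwise convergence on the discrete set $V(T)$, let $\mathrm{Aut}(T)^+$ be its subgroup of type-preserving automorphisms, and let $\partial T$ be the set of ends of $T$. Let $H\le\mathrm{Aut}(T)^+$ be a closed subgroup of $\mathrm{Aut}(T)$ acting $2$-transitively on $\partial T$. For a vertex $v$, let $\underline{H}(v)\le\mathrm{Sym}(E(v))$ be the permutation group induced by the stabilizer of $v$ in $H$ on the set $E(v)$ of edges incident to $v$. Suppose that there are permutation groups $F_0,F_1$ with $\mathrm{Alt}(d_t)\le F_t\le \mathrm{Sym}(d_t)$ for $t\in\{0,1\}$ such that, for each $t\in\{0,1\}$ and each $v\in V_t(T)$, the group $\underline{H}(v)$ is permutation isomorphic to $F_t$. Then there exists a legal coloring $i$ of $T$ such that $H\supseteq \mathrm{Alt}_{(i)}(T)^+$. Here, writing $S(v,1)$ for the set of neighbours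 of $v$, a legal coloring $i$ of $T$ is a map on $V(T)$ given by two maps $i|_{V_0(T)}\colon V_0(T)\to\{1,\dots,d_1\}$ and $i|_{V_1(T)}\colon V_1(T)\to\{1,\dots,d_0\}$ such that, for each $t\in\{0,1\}$ and each $v\in V_t(T)$, the restriction $i|_{S(v,1)}\colon S(v,1)\to\{1,\dots,d_t\}$ is a bijection. For $g\in\mathrm{Aut}(T)$ and $v\in V_t(T)$, the local action of $g$ at $v$ is $\sigma_{(i)}(g,v):=i|_{S(g(v),1)}\circ g\circ i|_{S(v,1)}^{-1}\in\mathrm{Sym}(d_t)$, and $$\mathrm{Alt}_{(i)}(T)^+:=\{g\in\mathrm{Aut}(T)^+ \mid \sigma_{(i)}(g,v)\text{ is an even permutation for each } v\in V(T)\}.$$ -/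

import Mathlib

namespace TreeAut

/-- `T` is the `(d 0, d 1)`-semiregular tree with type function `τ`: `T` is a tree, adjacent vertices
have different types, and each vertex of type `t` has exactly `d t` neighbours. -/
structure IsSemiregularTree {V : Type*} (T : SimpleGraph V) (τ : V → Fin 2) (d : Fin 2 → ℕ) :
    Prop where
  isTree : T.IsTree
  type_ne : ∀ ⦃v w : V⦄, T.Adj v w → τ v ≠ τ w
  degree : ∀ v : V, (T.neighborSet v).encard = (d (τ v) : ℕ∞)

/-! ### The topology of the automorphism group and the type-preserving automorphisms -/

/-- The topology of pointwise convergence on `Aut(T)`, the vertex set being discrete. The pointwise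
stabilizers of finite sets of vertices form a basis of neighbourhoods of the identity. -/
abbrev autTopology {V : Type*} (T : SimpleGraph V) : TopologicalSpace (T ≃g T) :=
  TopologicalSpace.induced (fun (g : T ≃g T) (v : V) => g v)
    (@Pi.topologicalSpace V (fun _ => V) (fun _ => ⊥))

/-- The group `Aut(T)⁺` of type-preserving automorphisms. -/
def autPlus {V : Type*} (T : SimpleGraph V) (τ : V → Fin 2) : Subgroup (T ≃g T) where
  carrier := {g | ∀ v, τ (g v) = τ v}
  mul_mem' := by
    intro g h hg hh v
    exact (hg (h v)).trans (hh v)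
  one_mem' := fun _ => rfl
  inv_mem' := by
    intro g hg v
    have h := hg (g⁻¹ v)
    rw [RelIso.apply_inv_self] at h
    exact h.symm

/-! ### Ends -/

/-- A ray: an infinite path `f 0, f 1, f 2, …` without repeated vertices. -/
structure Ray {V : Type*} (T : SimpleGraph V) where
  toFun : ℕ → V
  injective : Function.Injective toFun
  adj : ∀ n, T.Adj (toFun n) (toFun (n + 1))

/-- Two rays (of a tree) are cofinal if they have a common tail. -/
def Ray.Cofinal {V : Type*} {T : SimpleGraph V} (r s : Ray T) : Prop :=
  ∃ m n : ℕ, ∀ k : ℕ, r.toFun (m + k) = s.toFun (n + k)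

/-- Cofinality is an equivalence relation. -/
def raySetoid {V : Type*} (T : SimpleGraph V) : Setoid (Ray T) where
  r := Ray.Cofinal
  iseqv :=
    { refl := fun _ => ⟨0, 0, fun _ => rfl⟩
      symm := fun ⟨m, n, h⟩ => ⟨n, m, fun k => (h k).symm⟩
      trans := by
        rintro r s t ⟨m, n, h⟩ ⟨m', n', h'⟩
        refine ⟨m + m', n' + n, fun k => ?_⟩
        have h1 := h (m' + k)
        have h2 := h' (n + k)
        rw [add_assoc, h1, add_assoc, ← h2]
        congr 1
        omega }

/-- The set of ends `∂T` of a tree `T`: the rays up to cofinality. -/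
def Ends {V : Type*} (T : SimpleGraph V) : Type _ := Quotient (raySetoid T)

/-- The image of a ray under an automorphism. -/
def Ray.map {V : Type*} {T : SimpleGraph V} (g : T ≃g T) (r : Ray T) : Ray T where
  toFun n := g (r.toFun n)
  injective := g.injective.comp r.injective
  adj n := g.map_adj_iff.mpr (r.adj n)

/-- The action of `Aut(T)` on `∂T`. -/
instance endsMulAction {V : Type*} (T : SimpleGraph V) : MulAction (T ≃g T) (Ends T) where
  smul g := Quotient.map' (s₁ := raySetoid T) (s₂ := raySetoid T) (Ray.map g)
    (fun _ _ ⟨m, n, h⟩ => ⟨m, n, fun k => congrArg g (h k)⟩)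
  one_smul := by
    intro e
    induction e using Quotient.inductionOn'
    rfl
  mul_smul := by
    intro g h e
    induction e using Quotient.inductionOn'
    rfl

/-- The set `𝓗_T⁺` of closed subgroups of `Aut(T)` that consist of type-preserving automorphisms and
act `2`-transitively on `∂T`. -/
def HPlus {V : Type*} (T : SimpleGraph V) (τ : V → Fin 2) : Set (Subgroup (T ≃g T)) :=
  {H | @IsClosed _ (autTopology T) (H : Set (T ≃g T)) ∧
    MulAction.IsMultiplyPretransitive H (Ends T) 2 ∧ H ≤ autPlus T τ}

/-! ### The local action of a group of automorphisms -/

/-- The action of the stabilizer of `v` in `Aut(T)` on the set `E(v)` of edges incident to `v`. -/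
def edgeAction {V : Type*} (T : SimpleGraph V) (v : V) :
    MulAction.stabilizer (T ≃g T) v →* Equiv.Perm (T.incidenceSet v) :=
  have key : ∀ g ∈ MulAction.stabilizer (T ≃g T) v, ∀ e ∈ T.incidenceSet v,
      Sym2.map g e ∈ T.incidenceSet v := by
    intro g hg e he
    refine ⟨g.map_mem_edgeSet_iff.mpr he.1, Sym2.mem_map.mpr ⟨v, he.2, hg⟩⟩
  MonoidHom.toHomPerm
    { toFun := fun g e => ⟨Sym2.map g.1 e.1, key g.1 g.2 e.1 e.2⟩
      map_one' := by
        funext e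
        apply Subtype.ext
        change Sym2.map id e.1 = e.1
        rw [Sym2.map_id]
        rfl
      map_mul' := by
        intro g h
        funext e
        apply Subtype.ext
        change Sym2.map (g.1 ∘ h.1) e.1 = Sym2.map g.1 (Sym2.map h.1 e.1)
        rw [Sym2.map_map] }

/-- The local action `H̲(v)` of `H` at `v`: the image in `Sym(E(v))` of the stabilizer `H(v)` of `v`
in `H`. -/
def localAction {V : Type*} {T : SimpleGraph V} (H : Subgroup (T ≃g T)) (v : V) :
    Subgroup (Equiv.Perm (T.incidenceSet v)) :=
  (H.subgroupOf (MulAction.stabilizer (T ≃g T) v)).map (edgeAction T v)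

/-- Permutation isomorphism of permutation groups. -/
def PermIsomorphic {X Y : Type*} (A : Subgroup (Equiv.Perm X)) (B : Subgroup (Equiv.Perm Y)) :
    Prop :=
  ∃ e : X ≃ Y, A.map (e.permCongrHom : Equiv.Perm X →* Equiv.Perm Y) = B

/-! ### Legal colorings -/

/-- A legal coloring of the `(d 0, d 1)`-semiregular tree: the vertices of type `t` are coloured with
`{1, …, d (1 - t)}`, and for each vertex `v`, of type `t` say, the coloring restricts to a bijection
from the set `S(v, 1)` of neighbours of `v` to `{1, …, d t}`. -/
structure LegalColoring {V : Type*} (T : SimpleGraph V) (τ : V → Fin 2) (d : Fin 2 → ℕ) where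
  color : V → ℕ
  color_mem : ∀ v, color v ∈ Set.Icc 1 (d (1 - τ v))
  bijOn : ∀ v, Set.BijOn color (T.neighborSet v) (Set.Icc 1 (d (τ v)))

/-- The bijection `S(v, 1) ≃ {1, …, d t}` given by a legal coloring, for `v` of type `t`. -/
noncomputable def LegalColoring.sphereEquiv {V : Type*} {T : SimpleGraph V} {τ : V → Fin 2}
    {d : Fin 2 → ℕ} (i : LegalColoring T τ d) (v : V) :
    T.neighborSet v ≃ Set.Icc 1 (d (τ v)) :=
  (i.bijOn v).equiv i.color

/-- Automorphisms of a semiregular tree preserve the degrees. -/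
theorem IsSemiregularTree.degree_map {V : Type*} {T : SimpleGraph V} {τ : V → Fin 2}
    {d : Fin 2 → ℕ} (hT : IsSemiregularTree T τ d) (g : T ≃g T) (v : V) :
    d (τ (g v)) = d (τ v) := by
  have h : (T.neighborSet (g v)).encard = (T.neighborSet v).encard :=
    (Set.encard_congr (g.mapNeighborSet v)).symm
  rw [hT.degree, hT.degree] at h
  exact_mod_cast h

/-- The local action `σ_(i)(g, v) = i|_{S(g v, 1)} ∘ g ∘ i|_{S(v, 1)}⁻¹` of an automorphism `g` at the
vertex `v`, a permutation of `{1, …, d t}` for `v` of type `t`. -/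
noncomputable def LegalColoring.sigma {V : Type*} {T : SimpleGraph V} {τ : V → Fin 2}
    {d : Fin 2 → ℕ} (i : LegalColoring T τ d) (hT : IsSemiregularTree T τ d) (g : T ≃g T) (v : V) :
    Equiv.Perm (Set.Icc 1 (d (τ v))) :=
  (((i.sphereEquiv v).symm.trans (g.mapNeighborSet v)).trans (i.sphereEquiv (g v))).trans
    (Equiv.setCongr (by rw [hT.degree_map g v]))

theorem LegalColoring.sigma_one {V : Type*} {T : SimpleGraph V} {τ : V → Fin 2}
    {d : Fin 2 → ℕ} (i : LegalColoring T τ d) (hT : IsSemiregularTree T τ d) (v : V) :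
    i.sigma hT 1 v = 1 := by
  ext a
  change ((i.sphereEquiv v ((i.sphereEquiv v).symm a)) : ℕ) = a
  rw [Equiv.apply_symm_apply]

theorem LegalColoring.sign_sigma_mul {V : Type*} {T : SimpleGraph V} {τ : V → Fin 2}
    {d : Fin 2 → ℕ} (i : LegalColoring T τ d) (hT : IsSemiregularTree T τ d) (g h : T ≃g T)
    (v : V) :
    Equiv.Perm.sign (i.sigma hT (g * h) v) =
      Equiv.Perm.sign (i.sigma hT g (h v)) * Equiv.Perm.sign (i.sigma hT h v) := by
  have e : Set.Icc 1 (d (τ (h v))) = Set.Icc 1 (d (τ v)) := by rw [hT.degree_map h v]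
  have key : i.sigma hT (g * h) v =
      ((Equiv.setCongr e).permCongr (i.sigma hT g (h v))) * i.sigma hT h v := by
    ext a
    change i.color (g (h ((i.sphereEquiv v).symm a))) =
      i.color (g ((i.sphereEquiv (h v)).symm
        (i.sphereEquiv (h v) (h.mapNeighborSet v ((i.sphereEquiv v).symm a)))))
    rw [Equiv.symm_apply_apply]
    rfl
  rw [key, Equiv.Perm.sign_mul, Equiv.Perm.sign_permCongr]

/-- The group `Alt_(i)(T)⁺` of type-preserving automorphisms `g` such that `σ_(i)(g, v)` is even for
each vertex `v`. -/
noncomputable def LegalColoring.altPlus {V : Type*} {T : SimpleGraph V} {τ : V → Fin 2}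
    {d : Fin 2 → ℕ} (i : LegalColoring T τ d) (hT : IsSemiregularTree T τ d) :
    Subgroup (T ≃g T) where
  carrier := {g | g ∈ autPlus T τ ∧ ∀ v, Equiv.Perm.sign (i.sigma hT g v) = 1}
  mul_mem' := by
    rintro g h ⟨hg, hg'⟩ ⟨hh, hh'⟩
    refine ⟨mul_mem hg hh, fun v => ?_⟩
    rw [i.sign_sigma_mul, hg', hh', one_mul]
  one_mem' := ⟨one_mem _, fun v => by rw [i.sigma_one, map_one]⟩
  inv_mem' := by
    rintro g ⟨hg, hg'⟩
    refine ⟨inv_mem hg, fun v => ?_⟩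
    have h := i.sign_sigma_mul hT g g⁻¹ v
    rw [mul_inv_cancel, i.sigma_one, map_one, hg', one_mul] at h
    exact h.symm

end TreeAut

/-! Call a group of automorphisms full on a finite set of vertices if it induces all even
permutations of it. Removing an edge {p, y} leaves two half-trees.

The core is `IsLocallyAlternating.full_reg`: the elements of `H` that fix y and the ball of radius n
around p in the half-tree of p are still full on the other neighbours of y. As the degrees are at
least 6, there are at least five such neighbours, so their alternating group is simple, perfect and
has trivial centralizer. Hence a group normalized by a full group acts trivially or is full
(`Full.trivial_or_full`). If the fixator for radius n + 1 acted trivially, then, by perfectness, so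
would the elements of the fixator for radius n that fix the children of one suitable vertex of the
outer sphere. Transitivity on spheres, which comes from 2-transitivity on ends, passes this on to
the siblings of that vertex. The actions at these vertices and at y would then determine each other
too rigidly. Radius 1 uses that `H` is not discrete, and radius 2 needs its own argument.

Fullness of these fixators lets squares be corrected independently on far apart branches. So the
4^N-th power of an element fixing an edge splits, as far as radius N, into parts supported on the
two half-trees (`exists_split`). Since 4^N is 1 modulo 3, local 3-cycles survive this, and a limit
in the closed group `H` gives rigid 3-cycles: elements with cube 1 that permute three branches at a
vertex cyclically and fix all other branches pointwise (`exists_three_cycle`).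

At each end of a base edge, choose a coherent family of rigid 3-cycles, a frame. The elements of the
frames and their squares carry the opposite half-tree onto the other branches at that end.
Transporting colors along them, twisted by even permutations, defines a legal coloring for which all
elements of the frames have even local actions (`exists_coloring`, `exists_coloring_frame`). The
frames alone make the intersection of `H` with `altPlus` transitive on undirected edges, and realize
every even local action while fixing a whole half-tree. Successive approximation on balls then shows
that the intersection is dense in `altPlus`, and `H` is closed (`altPlus_le_of_frame`). -/

namespace TreeAut

open Equiv

/-- The cyclic permutation `a ↦ b ↦ c ↦ a`. -/
def cyc {X : Type*} [DecidableEq X] (a b c : X) : Perm X := swap a b * swap b c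

/-! ### 3-cycles that generate the alternating group. -/

section Cycles

variable {X : Type*} [DecidableEq X] {a b c : X}

theorem cyc_left (hab : a ≠ b) (hac : a ≠ c) : cyc a b c a = b := by
  simp [cyc, swap_apply_of_ne_of_ne hab hac]

theorem cyc_mid (hac : a ≠ c) (hbc : b ≠ c) : cyc a b c b = c := by
  simp [cyc, swap_apply_of_ne_of_ne hac.symm hbc.symm]

theorem cyc_right : cyc a b c c = a := by
  simp [cyc]

theorem cyc_other {x : X} (ha : x ≠ a) (hb : x ≠ b) (hc : x ≠ c) : cyc a b c x = x := by
  simp [cyc, swap_apply_of_ne_of_ne hb hc, swap_apply_of_ne_of_ne ha hb]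

theorem perm_eq_cyc {π : Perm X} (hab : a ≠ b) (hac : a ≠ c) (hbc : b ≠ c) (h1 : π a = b)
    (h2 : π b = c) (h3 : π c = a) (h4 : ∀ x, x ≠ a → x ≠ b → x ≠ c → π x = x) :
    π = cyc a b c := by
  ext x
  by_cases ha : x = a
  · rw [ha, h1, cyc_left hab hac]
  by_cases hb : x = b
  · rw [hb, h2, cyc_mid hac hbc]
  by_cases hc : x = c
  · rw [hc, h3, cyc_right]
  rw [h4 x ha hb hc, cyc_other ha hb hc]

theorem cyc_mem_alternatingGroup [Fintype X] (hab : a ≠ b) (hbc : b ≠ c) :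
    cyc a b c ∈ alternatingGroup X := by
  rw [Perm.mem_alternatingGroup, cyc, Perm.sign_mul, Perm.sign_swap hab, Perm.sign_swap hbc]
  rfl

theorem cyc_rotate (hab : a ≠ b) (hac : a ≠ c) (hbc : b ≠ c) : cyc a b c = cyc b c a :=
  perm_eq_cyc hbc hab.symm hac.symm (cyc_mid hac hbc) cyc_right (cyc_left hab hac)
    (fun _ h1 h2 h3 => cyc_other h3 h1 h2)

theorem cyc_inv (hab : a ≠ b) (hac : a ≠ c) (hbc : b ≠ c) : (cyc a b c)⁻¹ = cyc b a c := by
  refine perm_eq_cyc hab.symm hbc hac ?_ ?_ ?_ ?_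
  · rw [Perm.inv_eq_iff_eq, cyc_left hab hac]
  · rw [Perm.inv_eq_iff_eq, cyc_right]
  · rw [Perm.inv_eq_iff_eq, cyc_mid hac hbc]
  · intro x h1 h2 h3
    rw [Perm.inv_eq_iff_eq, cyc_other h2 h1 h3]

theorem cyc_eq_mul {x : X} (hab : a ≠ b) (hac : a ≠ c) (hbc : b ≠ c) (hxa : x ≠ a) (hxb : x ≠ b)
    (hxc : x ≠ c) : cyc a b c = cyc x a b * cyc x b c := by
  refine (perm_eq_cyc hab hac hbc ?_ ?_ ?_ ?_).symm
  · rw [Perm.mul_apply, cyc_other hxa.symm hab hac, cyc_mid hxb hab]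
  · rw [Perm.mul_apply, cyc_mid hxc hbc, cyc_other hxc.symm hac.symm hbc.symm]
  · rw [Perm.mul_apply, cyc_right, cyc_left hxa hxb]
  · intro y h1 h2 h3
    rw [Perm.mul_apply]
    by_cases hy : y = x
    · rw [hy, cyc_left hxb hxc, cyc_right]
    · rw [cyc_other hy h2 h3, cyc_other hy h1 h2]

theorem alternatingGroup_le_of_cyc [Fintype X] {G : Subgroup (Perm X)} (x : X)
    (h : ∀ a b, a ≠ x → b ≠ x → a ≠ b → cyc x a b ∈ G) : alternatingGroup X ≤ G := by
  rw [← Perm.closure_three_cycles_eq_alternating, Subgroup.closure_le]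
  intro g hg
  obtain ⟨a, ha⟩ := hg.isCycle.nonempty_support
  have h_nodup := hg.nodup_iff_mem_support.mpr ha
  have e : g = cyc a (g a) (g (g a)) := hg.eq_swap_mul_swap_iff_mem_support.mpr ha
  generalize g a = b at *
  generalize g b = c at *
  simp only [List.nodup_cons, List.mem_cons, List.not_mem_nil, or_false, not_or,
    List.nodup_nil, and_true, not_false_eq_true] at h_nodup
  obtain ⟨⟨hab, hac⟩, hbc⟩ := h_nodup
  rw [e]
  by_cases hxa : x = a
  · subst hxa
    exact h b c (Ne.symm hab) (Ne.symm hac) hbc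
  by_cases hxb : x = b
  · subst hxb
    rw [cyc_rotate hab hac hbc]
    exact h c a (Ne.symm hbc) hab (Ne.symm hac)
  by_cases hxc : x = c
  · subst hxc
    rw [← cyc_rotate (Ne.symm hac) (Ne.symm hbc) hab]
    exact h a b hac hbc hab
  · rw [cyc_eq_mul hab hac hbc hxa hxb hxc]
    exact mul_mem (h a b (Ne.symm hxa) (Ne.symm hxb) hab) (h b c (Ne.symm hxb) (Ne.symm hxc) hbc)

/-- (x y b)⁻¹ (x y a) is the 3-cycle (y a b), so the 3-cycles through a fixed ordered pair yield all
3-cycles through y. This is the shape in which frames supply their 3-cycles. -/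
theorem alternatingGroup_le_of_cyc_two [Fintype X] {G : Subgroup (Perm X)} {x y : X} (hxy : x ≠ y)
    (h : ∀ a, a ≠ x → a ≠ y → cyc x y a ∈ G) : alternatingGroup X ≤ G := by
  refine alternatingGroup_le_of_cyc y fun a b ha hb hab => ?_
  by_cases hax : a = x
  · subst hax
    rw [← cyc_inv hxy hab hb.symm]
    exact inv_mem (h b hab.symm hb)
  by_cases hbx : b = x
  · subst hbx
    rw [← cyc_rotate hb hab.symm ha.symm]
    exact h a hab ha
  have e : cyc y a b = (cyc x y b)⁻¹ * cyc x y a := by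
    rw [eq_inv_mul_iff_mul_eq]
    refine perm_eq_cyc hxy (Ne.symm hax) ha.symm ?_ ?_ ?_ ?_
    · rw [Perm.mul_apply, cyc_other hxy (Ne.symm hax) (Ne.symm hbx),
        cyc_left hxy (Ne.symm hbx)]
    · rw [Perm.mul_apply, cyc_left ha.symm hb.symm, cyc_other hax ha hab]
    · rw [Perm.mul_apply, cyc_mid hb.symm hab, cyc_right]
    · intro z h1 h2 h3
      rw [Perm.mul_apply]
      by_cases h4 : z = b
      · rw [h4, cyc_right, cyc_mid (Ne.symm hbx) hb.symm]
      · rw [cyc_other h2 h3 h4, cyc_other h1 h2 h4]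
  rw [e]
  exact mul_mem (inv_mem (h b hbx hb)) (h a hax ha)

end Cycles

/-! ### Simplicity and trivial centralizer of the alternating group. -/

section Dichotomy

variable {X : Type*} [DecidableEq X] [Fintype X]

theorem exists_two_ne (h : 4 ≤ Fintype.card X) (x y : X) :
    ∃ a b, a ≠ x ∧ a ≠ y ∧ b ≠ x ∧ b ≠ y ∧ a ≠ b := by
  have : 1 < (({x, y} : Finset X)ᶜ).card := by
    rw [Finset.card_compl]
    have := Finset.card_le_two (a := x) (b := y)
    omega
  obtain ⟨a, ha, b, hb, hab⟩ := Finset.one_lt_card.mp this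
  simp at ha hb
  exact ⟨a, b, ha.1, ha.2, hb.1, hb.2, hab⟩

/-- If π moves x, a 3-cycle that moves π x but fixes x does not commute with π. Four points leave
room for its other two entries. -/
theorem eq_one_of_commute_alternatingGroup (h : 4 ≤ Fintype.card X) {π : Perm X}
    (hπ : ∀ a ∈ alternatingGroup X, π * a = a * π) : π = 1 := by
  by_contra hne
  obtain ⟨x, hx⟩ : ∃ x, π x ≠ x := by
    by_contra! hc
    exact hne (Equiv.ext hc)
  obtain ⟨a, b, ha1, ha2, hb1, hb2, hab⟩ := exists_two_ne h x (π x)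
  have := congrArg (fun σ : Perm X => σ x) (hπ (cyc (π x) a b) (cyc_mem_alternatingGroup ha2.symm hab))
  simp only [Perm.mul_apply] at this
  rw [cyc_other hx.symm ha1.symm hb1.symm, cyc_left ha2.symm hb2.symm] at this
  exact ha2 this.symm

/-- A subgroup normalized by the alternating group is trivial or contains it. -/
theorem eq_bot_or_alternatingGroup_le (h : 5 ≤ Fintype.card X) (N : Subgroup (Perm X))
    (hN : ∀ a ∈ alternatingGroup X, ∀ n ∈ N, a * n * a⁻¹ ∈ N) :
    N = ⊥ ∨ alternatingGroup X ≤ N := by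
  have hnorm : (N.subgroupOf (alternatingGroup X)).Normal :=
    ⟨fun n hn g => hN g g.2 n hn⟩
  rcases alternatingGroup.normal_subgroup_eq_bot_or_eq_top (α := X) (by simpa using h)
    (N := N.subgroupOf (alternatingGroup X)) with h1 | h1
  · left
    rw [Subgroup.subgroupOf_eq_bot, disjoint_iff_inf_le] at h1
    rw [eq_bot_iff]
    intro n hn
    refine eq_one_of_commute_alternatingGroup (by omega) fun a ha => ?_
    -- The commutator is even and lies in N, hence is trivial: n centralizes the alternating group.
    have h2 : a * n * a⁻¹ * n⁻¹ ∈ N ⊓ alternatingGroup X := by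
      refine Subgroup.mem_inf.mpr ⟨mul_mem (hN a ha n hn) (inv_mem hn), ?_⟩
      rw [Perm.mem_alternatingGroup] at ha ⊢
      simp [ha]
    have h3 := h1 h2
    rw [Subgroup.mem_bot] at h3
    rw [mul_inv_eq_one, mul_inv_eq_iff_eq_mul] at h3
    exact h3.symm
  · right
    rwa [Subgroup.subgroupOf_eq_top] at h1

end Dichotomy

end TreeAut

/-! ### Groups of automorphisms that induce all even permutations of a finite set. -/

namespace TreeAut

open Equiv

set_option linter.unusedSectionVars false

theorem perm_apply_inv_self {X : Type*} (π : Perm X) (x : X) : π (π⁻¹ x) = x := π.apply_symm_apply x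

theorem perm_inv_apply_self {X : Type*} (π : Perm X) (x : X) : π⁻¹ (π x) = x := π.symm_apply_apply x

variable {V : Type*} {T : SimpleGraph V} [DecidableEq V]

/-- The permutations of `X` that are induced by elements of `G`. -/
def imageOn (G : Subgroup (T ≃g T)) (X : Finset V) : Subgroup (Perm X) where
  carrier := {π | ∃ g ∈ G, ∀ x : X, g x = π x}
  mul_mem' := by
    rintro π ρ ⟨g, hg, hπ⟩ ⟨h, hh, hρ⟩
    refine ⟨g * h, mul_mem hg hh, fun x => ?_⟩
    rw [RelIso.mul_apply, hρ, hπ, Perm.mul_apply]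
  one_mem' := ⟨1, one_mem _, fun _ => rfl⟩
  inv_mem' := by
    rintro π ⟨g, hg, hπ⟩
    refine ⟨g⁻¹, inv_mem hg, fun x => ?_⟩
    have := hπ (π⁻¹ x)
    rw [perm_apply_inv_self] at this
    rw [← this, RelIso.inv_apply_self]

/-- `G` induces every even permutation of `X`. -/
def Full (G : Subgroup (T ≃g T)) (X : Finset V) : Prop := alternatingGroup X ≤ imageOn G X

variable {G N A B C : Subgroup (T ≃g T)} {X : Finset V}

theorem Full.mono (h : Full G X) (hGN : G ≤ N) : Full N X := by
  intro π hπ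
  obtain ⟨g, hg, e⟩ := h hπ
  exact ⟨g, hGN hg, e⟩

theorem exists_perm_eq {g : T ≃g T} (h : ∀ x ∈ X, g x ∈ X) : ∃ π : Perm X, ∀ x : X, g x = π x := by
  have hb : Function.Bijective (fun x : X => (⟨g x, h x x.2⟩ : X)) := by
    rw [← Finite.injective_iff_bijective]
    intro x y hxy
    exact Subtype.ext (g.injective (congrArg Subtype.val hxy))
  exact ⟨Equiv.ofBijective _ hb, fun _ => rfl⟩

/-- A subgroup normalized by a group that induces all even permutations of `X` either acts trivially
on `X` or induces all even permutations too. -/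
theorem Full.trivial_or_full (hG : Full G X) (hX : 5 ≤ X.card)
    (hnorm : ∀ g ∈ G, ∀ n ∈ N, g * n * g⁻¹ ∈ N) (hN : ∀ n ∈ N, ∀ x ∈ X, n x ∈ X) :
    (∀ n ∈ N, ∀ x ∈ X, n x = x) ∨ Full N X := by
  rcases eq_bot_or_alternatingGroup_le (by simpa using hX) (imageOn N X) (by
    intro a ha ν hν
    obtain ⟨g, hg, e⟩ := hG ha
    obtain ⟨n, hn, e'⟩ := hν
    refine ⟨g * n * g⁻¹, hnorm g hg n hn, fun x => ?_⟩
    rw [RelIso.mul_apply, RelIso.mul_apply, Perm.mul_apply, Perm.mul_apply, ← e, ← e']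
    obtain ⟨y, rfl⟩ := a.surjective x
    rw [perm_inv_apply_self, ← e, RelIso.inv_apply_self]) with h | h
  · left
    intro n hn x hx
    obtain ⟨π, hπ⟩ := exists_perm_eq (hN n hn)
    have : π ∈ imageOn N X := ⟨n, hn, hπ⟩
    rw [h, Subgroup.mem_bot] at this
    rw [hπ ⟨x, hx⟩, this]
    rfl
  · exact Or.inr h

/-- Squares are even. The permutation induced by g may be odd, so corrections by full groups are
made for g² instead of g throughout. -/
theorem Full.exists_sq (hG : Full G X) {g : T ≃g T} (hg : ∀ x ∈ X, g x ∈ X) :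
    ∃ k ∈ G, ∀ x ∈ X, k x = g (g x) := by
  obtain ⟨π, hπ⟩ := exists_perm_eq hg
  obtain ⟨k, hk, e⟩ := hG (x := π * π) (by
    rw [Perm.mem_alternatingGroup, Perm.sign_mul, Int.units_mul_self])
  refine ⟨k, hk, fun x hx => ?_⟩
  rw [e ⟨x, hx⟩, Perm.mul_apply, ← hπ, ← hπ]

theorem Full.exists_cyc (hG : Full G X) {a b c : V} (ha : a ∈ X) (hb : b ∈ X) (hc : c ∈ X)
    (hab : a ≠ b) (hac : a ≠ c) (hbc : b ≠ c) :
    ∃ g ∈ G, g a = b ∧ g b = c ∧ g c = a ∧ ∀ x ∈ X, x ≠ a → x ≠ b → x ≠ c → g x = x := by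
  have hab' : (⟨a, ha⟩ : X) ≠ ⟨b, hb⟩ := fun h => hab (congrArg Subtype.val h)
  have hac' : (⟨a, ha⟩ : X) ≠ ⟨c, hc⟩ := fun h => hac (congrArg Subtype.val h)
  have hbc' : (⟨b, hb⟩ : X) ≠ ⟨c, hc⟩ := fun h => hbc (congrArg Subtype.val h)
  obtain ⟨g, hg, e⟩ := hG (cyc_mem_alternatingGroup hab' hbc')
  refine ⟨g, hg, ?_, ?_, ?_, fun x hx h1 h2 h3 => ?_⟩
  · rw [e ⟨a, ha⟩, cyc_left hab' hac']
  · rw [e ⟨b, hb⟩, cyc_mid hac' hbc']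
  · rw [e ⟨c, hc⟩, cyc_right]
  · rw [e ⟨x, hx⟩, cyc_other (fun h => h1 (congrArg Subtype.val h))
      (fun h => h2 (congrArg Subtype.val h)) (fun h => h3 (congrArg Subtype.val h))]

theorem cyc_mem_imageOn {a b c : X} (hab : a ≠ b) (hac : a ≠ c) (hbc : b ≠ c) {g : T ≃g T}
    (hg : g ∈ G) (h1 : g a = b) (h2 : g b = c) (h3 : g c = a)
    (h4 : ∀ x ∈ X, x ≠ a → x ≠ b → x ≠ c → g x = x) : cyc a b c ∈ imageOn G X := by
  refine ⟨g, hg, fun x => ?_⟩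
  by_cases ha : x = a
  · rw [ha, cyc_left hab hac, h1]
  by_cases hb : x = b
  · rw [hb, cyc_mid hac hbc, h2]
  by_cases hc : x = c
  · rw [hc, cyc_right, h3]
  rw [cyc_other ha hb hc]
  exact h4 x x.2 (fun h => ha (Subtype.ext h)) (fun h => hb (Subtype.ext h))
    (fun h => hc (Subtype.ext h))

theorem full_of_cyc {x : V} (hx : x ∈ X)
    (h : ∀ a ∈ X, ∀ b ∈ X, a ≠ x → b ≠ x → a ≠ b → ∃ g ∈ G, g x = a ∧ g a = b ∧ g b = x ∧
      ∀ y ∈ X, y ≠ x → y ≠ a → y ≠ b → g y = y) : Full G X := by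
  refine alternatingGroup_le_of_cyc ⟨x, hx⟩ fun a b ha hb hab => ?_
  obtain ⟨g, hg, h1, h2, h3, h4⟩ := h a a.2 b b.2 (fun h => ha (Subtype.ext h))
    (fun h => hb (Subtype.ext h)) (fun h => hab (Subtype.ext h))
  exact cyc_mem_imageOn ha.symm hb.symm hab hg h1 h2 h3 h4

theorem full_of_cyc_two {x z : V} (hx : x ∈ X) (hz : z ∈ X) (hxz : x ≠ z)
    (h : ∀ a ∈ X, a ≠ x → a ≠ z → ∃ g ∈ G, g x = z ∧ g z = a ∧ g a = x ∧
      ∀ y ∈ X, y ≠ x → y ≠ z → y ≠ a → g y = y) : Full G X := by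
  refine alternatingGroup_le_of_cyc_two (x := ⟨x, hx⟩) (y := ⟨z, hz⟩)
    (fun h => hxz (congrArg Subtype.val h)) fun a ha hb => ?_
  obtain ⟨g, hg, h1, h2, h3, h4⟩ := h a a.2 (fun h => ha (Subtype.ext h))
    (fun h => hb (Subtype.ext h))
  exact cyc_mem_imageOn (fun h => hxz (congrArg Subtype.val h)) ha.symm hb.symm hg h1 h2 h3 h4

theorem full_of_forall_eq (h : ∀ a ∈ X, ∀ b ∈ X, a = b) : Full G X := by
  intro π _
  refine ⟨1, one_mem _, fun x => h _ (Subtype.property _) _ (Subtype.property _)⟩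

/-- Every 3-cycle of the remaining points extends by fixing p, so it is induced by an element of the
stabilizer of p. -/
theorem Full.erase (hG : Full G X) {p : V} (hp : p ∈ X) (h : ∀ g ∈ G, g p = p → g ∈ N) :
    Full N (X.erase p) := by
  rcases (X.erase p).eq_empty_or_nonempty with h0 | ⟨x, hx⟩
  · rw [h0]
    exact full_of_forall_eq (by simp)
  refine full_of_cyc hx fun a ha b hb hax hbx hab => ?_
  rw [Finset.mem_erase] at hx ha hb
  obtain ⟨g, hg, h1, h2, h3, h4⟩ := hG.exists_cyc hx.2 ha.2 hb.2 hax.symm hbx.symm hab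
  exact ⟨g, h g hg (h4 p hp hx.1.symm ha.1.symm hb.1.symm), h1, h2, h3,
    fun y hy => h4 y (Finset.mem_of_mem_erase hy)⟩

theorem Full.conj (hG : Full G X) {m : T ≃g T} {Y : Finset V} (hY : ∀ y ∈ Y, m⁻¹ y ∈ X)
    (hN : ∀ g ∈ G, m * g * m⁻¹ ∈ N) : Full N Y := by
  rcases Y.eq_empty_or_nonempty with h0 | ⟨x, hx⟩
  · rw [h0]
    exact full_of_forall_eq (by simp)
  refine full_of_cyc hx fun a ha b hb hax hbx hab => ?_
  obtain ⟨g, hg, h1, h2, h3, h4⟩ := hG.exists_cyc (hY x hx) (hY a ha) (hY b hb)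
    (m⁻¹.injective.ne hax.symm) (m⁻¹.injective.ne hbx.symm) (m⁻¹.injective.ne hab)
  refine ⟨m * g * m⁻¹, hN g hg, ?_, ?_, ?_, fun y hy n1 n2 n3 => ?_⟩
  · rw [RelIso.mul_apply, RelIso.mul_apply, h1, RelIso.apply_inv_self]
  · rw [RelIso.mul_apply, RelIso.mul_apply, h2, RelIso.apply_inv_self]
  · rw [RelIso.mul_apply, RelIso.mul_apply, h3, RelIso.apply_inv_self]
  · rw [RelIso.mul_apply, RelIso.mul_apply, h4 _ (hY y hy) (m⁻¹.injective.ne n1)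
      (m⁻¹.injective.ne n2) (m⁻¹.injective.ne n3), RelIso.apply_inv_self]

/-- The alternating group on at least five points is perfect, hence generated by commutators of even
permutations. This combines two fixing conditions: commutators can satisfy both when each factor
satisfies only one. -/
theorem Full.commutator (hA : Full A X) (hB : Full B X) (hX : 5 ≤ X.card)
    (hC : ∀ a ∈ A, ∀ b ∈ B, a * b * a⁻¹ * b⁻¹ ∈ C) : Full C X := by
  rw [Full, ← commutator_alternatingGroup_eq_self (by simpa using hX), Subgroup.commutator_le]
  intro α hα β hβ
  obtain ⟨a, ha, ea⟩ := hA hα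
  obtain ⟨b, hb, eb⟩ := hB hβ
  refine ⟨a * b * a⁻¹ * b⁻¹, hC a ha b hb, fun x => ?_⟩
  obtain ⟨y, rfl⟩ := β.surjective x
  obtain ⟨z, rfl⟩ := α.surjective y
  simp only [commutatorElement_def, Perm.mul_apply, RelIso.mul_apply, perm_inv_apply_self]
  rw [← eb, RelIso.inv_apply_self, ← ea, RelIso.inv_apply_self, eb, ea]

theorem Full.trivial_of_commute (hB : Full B X) (hX : 4 ≤ X.card) {a : T ≃g T}
    (ha : ∀ x ∈ X, a x ∈ X) (hab : ∀ b ∈ B, ∀ x ∈ X, a (b x) = b (a x)) :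
    ∀ x ∈ X, a x = x := by
  obtain ⟨π, hπ⟩ := exists_perm_eq ha
  have h1 : π = 1 := by
    refine eq_one_of_commute_alternatingGroup (by simpa using hX) fun β hβ => ?_
    obtain ⟨b, hb, e⟩ := hB hβ
    ext x
    rw [Perm.mul_apply, Perm.mul_apply, ← hπ, ← e, ← e, hab b hb x x.2, hπ]
  intro x hx
  rw [hπ ⟨x, hx⟩, h1]
  rfl

theorem exists_not_mem_of_card_lt {X : Finset V} (s : Finset V) (h : s.card < X.card) :
    ∃ x ∈ X, x ∉ s := by
  by_contra! hc
  exact absurd (Finset.card_le_card hc) (by omega)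

/-- A group that induces all even permutations of `X` moves some points of `X` by squares. -/
theorem Full.exists_sq_ne (hG : Full G X) (hX : 5 ≤ X.card) :
    ∃ g ∈ G, ∃ x ∈ X, g (g x) ≠ x := by
  obtain ⟨a, ha, -⟩ := exists_not_mem_of_card_lt (X := X) ∅ (by rw [Finset.card_empty]; omega)
  obtain ⟨b, hb, hb'⟩ := exists_not_mem_of_card_lt (X := X) {a} (by simp; omega)
  obtain ⟨c, hc, hc'⟩ := exists_not_mem_of_card_lt (X := X) {a, b}
    (lt_of_le_of_lt Finset.card_le_two (by omega))
  simp only [Finset.mem_insert, Finset.mem_singleton, not_or] at hb' hc'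
  obtain ⟨g, hg, h1, h2, -⟩ := hG.exists_cyc ha hb hc (Ne.symm hb') (Ne.symm hc'.1) (Ne.symm hc'.2)
  exact ⟨g, hg, a, ha, by rw [h1, h2]; exact hc'.1⟩

theorem Full.exists_apply_eq (hG : Full G X) (hX : 3 ≤ X.card) {a b : V} (ha : a ∈ X) (hb : b ∈ X) :
    ∃ g ∈ G, g a = b := by
  by_cases hab : a = b
  · exact ⟨1, one_mem _, hab⟩
  obtain ⟨c, hc, hc'⟩ := exists_not_mem_of_card_lt (X := X) {a, b}
    (lt_of_le_of_lt Finset.card_le_two (by omega))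
  simp only [Finset.mem_insert, Finset.mem_singleton, not_or] at hc'
  obtain ⟨g, hg, h1, -⟩ := hG.exists_cyc ha hb hc hab (Ne.symm hc'.1) (Ne.symm hc'.2)
  exact ⟨g, hg, h1⟩

end TreeAut

/-! ### Distances, half-trees and branches in a tree. -/

namespace TreeAut

variable {V : Type*} {T : SimpleGraph V}

theorem dist_map_le (hT : T.Connected) (g : T ≃g T) (x y : V) : T.dist (g x) (g y) ≤ T.dist x y := by
  obtain ⟨p, hp⟩ := hT.exists_walk_length_eq_dist x y
  rw [← hp, ← SimpleGraph.Walk.length_map g.toHom p]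
  exact SimpleGraph.dist_le _

theorem dist_map (hT : T.IsTree) (g : T ≃g T) (x y : V) : T.dist (g x) (g y) = T.dist x y := by
  refine le_antisymm (dist_map_le hT.connected g x y) ?_
  have := dist_map_le hT.connected g⁻¹ (g x) (g y)
  rwa [RelIso.inv_apply_self, RelIso.inv_apply_self] at this

theorem dist_of_adj {x y : V} (h : T.Adj x y) : T.dist x y = 1 :=
  SimpleGraph.dist_eq_one_iff_adj.mpr h

theorem exists_closer (hT : T.IsTree) {x y : V} (h : x ≠ y) :
    ∃ u, T.Adj u y ∧ T.dist x y = T.dist x u + 1 := by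
  obtain ⟨p, hp⟩ := hT.connected.exists_walk_length_eq_dist x y
  have hn : ¬ p.Nil := SimpleGraph.Walk.not_nil_of_ne h
  refine ⟨p.penultimate, p.adj_penultimate hn, ?_⟩
  rcases hT.dist_eq_dist_add_one_of_adj x (p.adj_penultimate hn) with h1 | h1
  · exfalso
    have h2 : T.dist x p.penultimate ≤ p.dropLast.length := SimpleGraph.dist_le _
    have h3 : p.dropLast.length + 1 = p.length := SimpleGraph.Walk.length_dropLast_add_one hn
    omega
  · exact h1

theorem closer_unique (hT : T.IsTree) {x y u u' : V} (hu : T.Adj u y) (hu' : T.Adj u' y)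
    (h : T.dist x y = T.dist x u + 1) (h' : T.dist x y = T.dist x u' + 1) : u = u' := by
  obtain ⟨p, hp⟩ := hT.connected.exists_walk_length_eq_dist x u
  obtain ⟨q, hq⟩ := hT.connected.exists_walk_length_eq_dist x u'
  have hp' : (p.concat hu).IsPath := SimpleGraph.Walk.isPath_of_length_eq_dist _ (by
    rw [SimpleGraph.Walk.length_concat, hp, h])
  have hq' : (q.concat hu').IsPath := SimpleGraph.Walk.isPath_of_length_eq_dist _ (by
    rw [SimpleGraph.Walk.length_concat, hq, h'])
  have e := (hT.existsUnique_path x y).unique hp' hq'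
  have := congrArg SimpleGraph.Walk.penultimate e
  simpa using this

/-- If `y` separates `x` from `w`, then it lies on the geodesic between them. -/
theorem dist_eq_add (hT : T.IsTree) {p y w x : V} (hpy : T.Adj p y)
    (hw : T.dist w p < T.dist w y) (hx : T.dist x y < T.dist x p) :
    T.dist w x = T.dist w y + T.dist y x := by
  induction hn : T.dist y x using Nat.strong_induction_on generalizing x with
  | _ n ih =>
    have hwpy := hT.dist_eq_dist_add_one_of_adj w hpy
    by_cases hyx : y = x
    · subst hyx
      rw [SimpleGraph.dist_self] at hn
      omega
    obtain ⟨u, hux, hu⟩ := exists_closer hT hyx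
    have behind : ∀ {a b : V}, T.Adj a b → T.dist y b = T.dist y a + 1 →
        T.dist b y < T.dist b p → T.dist a y < T.dist a p := by
      intro a b hab h1 h2
      have h3 := hT.connected.dist_triangle (u := b) (v := a) (w := p)
      rw [SimpleGraph.dist_comm (u := b) (v := a), dist_of_adj hab,
        SimpleGraph.dist_comm (u := b) (v := p)] at h3
      rw [SimpleGraph.dist_comm (u := b) (v := p)] at h2
      rw [SimpleGraph.dist_comm (u := b) (v := y)] at h2
      rw [SimpleGraph.dist_comm (u := a) (v := y)]
      omega
    have hub := behind hux hu hx
    have hwu := ih _ (by omega) hub rfl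
    -- If x were nearer to w than u, it would be the unique neighbor of u nearer to w. By induction
    -- that neighbor is p or the predecessor of u on the way from y.
    rcases hT.dist_eq_dist_add_one_of_adj w hux with h | h
    · exfalso
      by_cases hyu : y = u
      · subst hyu
        have : p = x := closer_unique hT hpy hux.symm (by omega) h
        rw [this, SimpleGraph.dist_self] at hx
        omega
      obtain ⟨u', hu'u, hu'⟩ := exists_closer hT hyu
      have hu'b := behind hu'u hu' hub
      have := ih _ (by omega) hu'b rfl
      have : u' = x := closer_unique hT hu'u hux.symm (by omega) h
      subst this
      omega
    · omega

theorem dist_lt_or_lt (hT : T.IsTree) {p y : V} (h : T.Adj p y) (x : V) :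
    T.dist x p < T.dist x y ∨ T.dist x y < T.dist x p := by
  rcases hT.dist_eq_dist_add_one_of_adj x h with h | h <;> omega

theorem dist_eq_of_lt (hT : T.IsTree) {p y x : V} (h : T.Adj p y) (hx : T.dist x p < T.dist x y) :
    T.dist x y = T.dist x p + 1 := by
  rcases hT.dist_eq_dist_add_one_of_adj x h with h | h <;> omega

/-- Adjacent vertices on different sides of an edge are the ends of this edge. -/
theorem eq_of_adj_of_lt (hT : T.IsTree) {p y a b : V} (hpy : T.Adj p y) (hab : T.Adj a b)
    (ha : T.dist a p < T.dist a y) (hb : T.dist b y < T.dist b p) : a = p ∧ b = y := by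
  have h1 := dist_eq_add hT hpy ha hb
  have h2 := dist_eq_of_lt hT hpy ha
  rw [dist_of_adj hab] at h1
  constructor
  · exact hT.connected.dist_eq_zero_iff.mp (by omega)
  · exact (hT.connected.dist_eq_zero_iff.mp (by omega)).symm

/-- Different branches at a vertex are disjoint. -/
theorem lt_of_branch_ne (hT : T.IsTree) {w z z' x : V} (hz : T.Adj z w) (hz' : T.Adj z' w)
    (hne : z ≠ z') (hx : T.dist x z < T.dist x w) : T.dist x w < T.dist x z' := by
  rcases dist_lt_or_lt hT hz' x with h | h
  · exact absurd (closer_unique hT hz hz' (dist_eq_of_lt hT hz hx) (dist_eq_of_lt hT hz' h)) hne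
  · exact h

theorem dist_pos_iff (hT : T.IsTree) {x y : V} : 0 < T.dist x y ↔ x ≠ y := by
  rw [Nat.pos_iff_ne_zero, Ne, hT.connected.dist_eq_zero_iff]

section Local

variable [T.LocallyFinite]

theorem finite_ball (hT : T.IsTree) (v : V) (n : ℕ) : {x | T.dist v x ≤ n}.Finite := by
  induction n with
  | zero =>
    refine (Set.finite_singleton v).subset fun x hx => ?_
    have : T.dist v x = 0 := Nat.le_zero.mp hx
    exact (hT.connected.dist_eq_zero_iff.mp this).symm
  | succ n ih =>
    refine (ih.union (ih.biUnion fun y _ => (T.neighborFinset y).finite_toSet)).subset fun x hx => ?_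
    by_cases h : T.dist v x ≤ n
    · exact Or.inl h
    · right
      obtain ⟨u, hu, hu'⟩ := exists_closer hT (x := v) (y := x) (by
        rintro rfl; rw [SimpleGraph.dist_self] at h; omega)
      have hx' : T.dist v x ≤ n + 1 := hx
      exact Set.mem_biUnion (x := u) (by change T.dist v u ≤ n; omega) (by simpa using hu)

variable [DecidableEq V]

/-- The neighbours of `y` other than `p`. -/
def ch (T : SimpleGraph V) [T.LocallyFinite] (p y : V) : Finset V := (T.neighborFinset y).erase p

theorem mem_ch {p y u : V} : u ∈ ch T p y ↔ u ≠ p ∧ T.Adj y u := by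
  rw [ch, Finset.mem_erase, SimpleGraph.mem_neighborFinset]

theorem dist_of_mem_ch (hT : T.IsTree) {p y u x : V} (hpy : T.Adj p y)
    (hx : T.dist x p < T.dist x y) (hu : u ∈ ch T p y) : T.dist x u = T.dist x y + 1 := by
  rw [mem_ch] at hu
  have := lt_of_branch_ne hT hpy hu.2.symm hu.1.symm hx
  exact dist_eq_of_lt hT hu.2 this

theorem mem_ch_of_dist {p y u x : V} (hyu : T.Adj y u)
    (hx : T.dist x p < T.dist x y) (h : T.dist x u = T.dist x y + 1) : u ∈ ch T p y := by
  rw [mem_ch]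
  refine ⟨?_, hyu⟩
  rintro rfl
  omega

theorem map_mem_ch {p y u : V} (g : T ≃g T) (h : u ∈ ch T p y) : g u ∈ ch T (g p) (g y) := by
  rw [mem_ch] at h ⊢
  exact ⟨g.injective.ne h.1, g.map_adj_iff.mpr h.2⟩

theorem map_mem_ch_of_fix {p y u : V} {g : T ≃g T} (hp : g p = p) (hy : g y = y)
    (h : u ∈ ch T p y) : g u ∈ ch T p y := by
  have := map_mem_ch g h
  rwa [hp, hy] at this

end Local

/-- An automorphism that fixes two vertices fixes the geodesic between them. -/
theorem fix_of_fix_of_dist (hT : T.IsTree) {g : T ≃g T} {x y p : V} (hx : g x = x) (hy : g y = y)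
    (hpy : T.Adj p y) (h : T.dist x p < T.dist x y) : g p = p := by
  refine closer_unique hT (x := x) (y := y) ?_ hpy ?_ (dist_eq_of_lt hT hpy h)
  · have := g.map_adj_iff.mpr hpy
    rwa [hy] at this
  · have := dist_map hT g x p
    rw [hx] at this
    rw [this]
    exact dist_eq_of_lt hT hpy h

end TreeAut

/-! ### Pointwise fixators, and lines and their ends. -/

namespace TreeAut

variable {V : Type*} {T : SimpleGraph V}

/-- The elements of `H` that fix `S` pointwise. -/
def fixing (H : Subgroup (T ≃g T)) (S : Set V) : Subgroup (T ≃g T) where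
  carrier := {h | h ∈ H ∧ ∀ x ∈ S, h x = x}
  mul_mem' := by
    rintro g h ⟨hg, hg'⟩ ⟨hh, hh'⟩
    refine ⟨mul_mem hg hh, fun x hx => ?_⟩
    rw [RelIso.mul_apply, hh' x hx, hg' x hx]
  one_mem' := ⟨one_mem _, fun _ _ => rfl⟩
  inv_mem' := by
    rintro g ⟨hg, hg'⟩
    refine ⟨inv_mem hg, fun x hx => ?_⟩
    nth_rewrite 1 [← hg' x hx]
    exact RelIso.inv_apply_self g x

theorem fixing_mono {H K : Subgroup (T ≃g T)} {S R : Set V} (h : H ≤ K) (hSR : R ⊆ S) :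
    fixing H S ≤ fixing K R := fun _ hg => ⟨h hg.1, fun x hx => hg.2 x (hSR hx)⟩

theorem inv_fix {g : T ≃g T} {x : V} (h : g x = x) : g⁻¹ x = x := by
  nth_rewrite 1 [← h]
  exact RelIso.inv_apply_self g x

section Rays

/-- A sequence of vertices that forms a path without backtracking. -/
def IsNB (f : ℕ → V) (T : SimpleGraph V) : Prop :=
  (∀ n, T.Adj (f n) (f (n + 1))) ∧ ∀ n, f n ≠ f (n + 2)

theorem IsNB.dist_zero (hT : T.IsTree) {f : ℕ → V} (h : IsNB f T) (n : ℕ) :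
    T.dist (f 0) (f n) = n ∧ T.dist (f 0) (f (n + 1)) = n + 1 := by
  induction n with
  | zero => exact ⟨SimpleGraph.dist_self, dist_of_adj (h.1 0)⟩
  | succ n ih =>
    refine ⟨ih.2, ?_⟩
    rcases hT.dist_eq_dist_add_one_of_adj (f 0) (h.1 (n + 1)) with h1 | h1
    · exact absurd (closer_unique hT (x := f 0) (h.1 n) (h.1 (n + 1)).symm (by omega) (by omega)) (h.2 n)
    · rw [h1, ih.2]

/-- A bi-infinite path without backtracking. -/
def IsLine (T : SimpleGraph V) (L : ℤ → V) : Prop :=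
  (∀ k, T.Adj (L k) (L (k + 1))) ∧ ∀ k, L k ≠ L (k + 2)

variable {L L' : ℤ → V}

theorem IsLine.dist (hT : T.IsTree) (h : IsLine T L) {a b : ℤ} {n : ℕ} (hab : b = a + n) :
    T.dist (L a) (L b) = n := by
  have : IsNB (fun n : ℕ => L (a + n)) T := by
    refine ⟨fun n => ?_, fun n => ?_⟩
    · have := h.1 (a + n)
      rwa [add_assoc] at this
    · have := h.2 (a + n)
      rwa [add_assoc] at this
  have h2 := (this.dist_zero hT n).1
  simp only [Nat.cast_zero, add_zero] at h2
  rw [hab, h2]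

theorem IsLine.injective (hT : T.IsTree) (h : IsLine T L) : Function.Injective L := by
  have key : ∀ a b : ℤ, a ≤ b → L a = L b → a = b := by
    intro a b hab e
    have h1 := h.dist hT (a := a) (b := b) (n := (b - a).toNat) (by omega)
    rw [e, SimpleGraph.dist_self] at h1
    omega
  intro a b e
  rcases le_total a b with hab | hab
  · exact key a b hab e
  · exact (key b a hab e.symm).symm

theorem IsLine.map (h : IsLine T L) (g : T ≃g T) : IsLine T (fun k => g (L k)) :=
  ⟨fun k => g.map_adj_iff.mpr (h.1 k), fun k => g.injective.ne (h.2 k)⟩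

/-- The positive end of a line. -/
def IsLine.posRay (hT : T.IsTree) (h : IsLine T L) : Ray T where
  toFun n := L n
  injective := (h.injective hT).comp Nat.cast_injective
  adj n := by exact_mod_cast h.1 n

/-- The negative end of a line. -/
def IsLine.negRay (hT : T.IsTree) (h : IsLine T L) : Ray T where
  toFun n := L (-n)
  injective := (h.injective hT).comp (neg_injective.comp Nat.cast_injective)
  adj n := by
    have := (h.1 (-(n + 1))).symm
    push_cast
    rwa [show -(n + 1 : ℤ) + 1 = -n by ring] at this

/-- The end of a ray. -/
def Ray.toEnd (r : Ray T) : Ends T := Quotient.mk (raySetoid T) r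

theorem toEnd_eq_iff {r s : Ray T} : r.toEnd = s.toEnd ↔ Ray.Cofinal r s :=
  ⟨fun h => Quotient.exact h, fun h => Quotient.sound h⟩

theorem IsLine.posRay_ne_negRay (hT : T.IsTree) (h : IsLine T L) :
    (h.posRay hT).toEnd ≠ (h.negRay hT).toEnd := by
  rw [Ne, toEnd_eq_iff]
  rintro ⟨m, n, hmn⟩
  have h1 := h.injective hT (hmn 0)
  have h2 := h.injective hT (hmn 1)
  push_cast at h1 h2
  omega

/-- Lines with the same ends agree up to a translation. -/
theorem IsLine.exists_shift (hT : T.IsTree) (h : IsLine T L) (h' : IsLine T L')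
    (hp : (h.posRay hT).toEnd = (h'.posRay hT).toEnd)
    (hn : (h.negRay hT).toEnd = (h'.negRay hT).toEnd) : ∃ c : ℤ, ∀ k, L k = L' (k + c) := by
  rw [toEnd_eq_iff] at hp hn
  obtain ⟨m, m', hm⟩ := hp
  obtain ⟨n, n', hn⟩ := hn
  have hm : ∀ k : ℕ, L (m + k) = L' (m' + k) := by exact_mod_cast hm
  have hn : ∀ k : ℕ, L (-(n + k)) = L' (-(n' + k)) := by exact_mod_cast hn
  have e1 := h.dist hT (a := -n) (b := m) (n := m + n) (by push_cast; ring)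
  have e2 := h'.dist hT (a := -n') (b := m') (n := m' + n') (by push_cast; ring)
  have hm0 := hm 0
  have hn0 := hn 0
  simp only [Nat.cast_zero, add_zero] at hm0 hn0
  rw [hm0, hn0, e2] at e1
  have mid : ∀ i : ℕ, i ≤ m + n → L (m - i) = L' (m' - i) := by
    intro i
    induction i with
    | zero => intro _; simpa using hm0
    | succ i ih =>
      intro hi
      have ih := ih (by omega)
      have a1 := h.1 (m - (i + 1))
      have a2 := h'.1 (m' - (i + 1))
      rw [show (m : ℤ) - (i + 1) + 1 = m - i by ring] at a1
      rw [show (m' : ℤ) - (i + 1) + 1 = m' - i by ring, ← ih] at a2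
      have b1 := h.dist hT (a := -n) (b := m - i) (n := m + n - i) (by omega)
      have b2 := h.dist hT (a := -n) (b := m - (i + 1)) (n := m + n - (i + 1)) (by omega)
      have b3 := h'.dist hT (a := -n') (b := m' - (i + 1)) (n := m + n - (i + 1)) (by omega)
      rw [← hn0] at b3
      push_cast
      exact closer_unique hT (x := L (-n)) a1 a2 (by omega) (by omega)
  refine ⟨m' - m, fun k => ?_⟩
  rcases le_total (m : ℤ) k with hk | hk
  · have := hm (k - m).toNat
    rw [show (m : ℤ) + (k - m).toNat = k by omega,
      show (m' : ℤ) + (k - m).toNat = k + (m' - m) by omega] at this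
    exact this
  rcases le_total k (-n : ℤ) with hk' | hk'
  · have := hn (-n - k).toNat
    rw [show -((n : ℤ) + (-n - k).toNat) = k by omega,
      show -((n' : ℤ) + (-n - k).toNat) = k + (m' - m) by omega] at this
    exact this
  · have := mid (m - k).toNat (by omega)
    rw [show (m : ℤ) - (m - k).toNat = k by omega,
      show (m' : ℤ) - (m - k).toNat = k + (m' - m) by omega] at this
    exact this

theorem exists_nb_of_adj (hdeg : ∀ a b, T.Adj a b → ∃ c, T.Adj b c ∧ a ≠ c) {a b : V}
    (hab : T.Adj a b) : ∃ f : ℕ → V, IsNB f T ∧ f 0 = a ∧ f 1 = b := by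
  choose! c hc hc' using hdeg
  let s : ℕ → V × V := fun n => n.rec (a, b) fun _ p => (p.2, c p.1 p.2)
  have hs : ∀ n, T.Adj (s n).1 (s n).2 := by
    intro n
    induction n with
    | zero => exact hab
    | succ n ih => exact hc _ _ ih
  exact ⟨fun n => (s n).1, ⟨fun n => hs n, fun n => hc' _ _ (hs n)⟩, rfl, rfl⟩

theorem exists_nb_through (hT : T.IsTree) (hdeg : ∀ a b, T.Adj a b → ∃ c, T.Adj b c ∧ a ≠ c)
    (n : ℕ) : ∀ {y y' x : V}, T.Adj y y' → T.dist y' x = n → T.dist y x = n + 1 →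
      ∃ f : ℕ → V, IsNB f T ∧ f 0 = y ∧ f 1 = y' ∧ f (n + 1) = x := by
  induction n with
  | zero =>
    intro y y' x hyy' h1 h2
    obtain ⟨f, hf, h0, h1'⟩ := exists_nb_of_adj hdeg hyy'
    exact ⟨f, hf, h0, h1', by rw [zero_add, h1', hT.connected.dist_eq_zero_iff.mp h1]⟩
  | succ n ih =>
    intro y y' x hyy' h1 h2
    obtain ⟨u, hu, hu'⟩ := exists_closer hT (x := x) (y := y') (by
      rintro rfl; rw [SimpleGraph.dist_self] at h1; omega)
    rw [SimpleGraph.dist_comm, h1, SimpleGraph.dist_comm] at hu'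
    obtain ⟨f, hf, h0, h1', h2'⟩ := ih (y := y') (y' := u) (x := x) hu.symm (by omega) h1
    refine ⟨fun k => if k = 0 then y else f (k - 1), ⟨fun k => ?_, fun k => ?_⟩, rfl, ?_, ?_⟩
    · cases k with
      | zero => simpa [h0] using hyy'
      | succ k => simpa using hf.1 k
    · cases k with
      | zero =>
        simp only [if_true, zero_add, OfNat.ofNat_ne_zero, if_false, Nat.add_one_sub_one]
        rw [h1']
        rintro rfl
        omega
      | succ k => simpa using hf.2 k
    · simp [h0]
    · simpa using h2'

/-- Two rays from a vertex with different first steps form a line. -/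
theorem isLine_glue {A B : ℕ → V} (hA : IsNB A T) (hB : IsNB B T) (h0 : A 0 = B 0)
    (h1 : A 1 ≠ B 1) : IsLine T (fun k => if 0 ≤ k then B k.toNat else A (-k).toNat) := by
  refine ⟨fun k => ?_, fun k => ?_⟩ <;> dsimp only
  · rcases lt_trichotomy k (-1) with hk | rfl | hk
    · rw [if_neg (by omega), if_neg (by omega), show (-k).toNat = (-(k + 1)).toNat + 1 by omega]
      exact (hA.1 _).symm
    · have := (hA.1 0).symm
      simpa [← h0] using this
    · rw [if_pos (by omega), if_pos (by omega), show (k + 1).toNat = k.toNat + 1 by omega]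
      exact hB.1 _
  · rcases lt_trichotomy k (-1) with hk | rfl | hk
    · by_cases h2 : k = -2
      · subst h2
        have := (hA.2 0).symm
        simpa [← h0] using this
      · rw [if_neg (by omega), if_neg (by omega), show (-k).toNat = (-(k + 2)).toNat + 2 by omega]
        exact (hA.2 _).symm
    · simpa using h1
    · rw [if_pos (by omega), if_pos (by omega), show (k + 2).toNat = k.toNat + 2 by omega]
      exact hB.2 _

end Rays

/-! ### From 2-transitivity on ends to transitivity on spheres. -/

section Transitivity

variable {H : Subgroup (T ≃g T)}

theorem exists_shift_of_ends (hT : T.IsTree)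
    (h2 : MulAction.IsMultiplyPretransitive H (Ends T) 2) {L L' : ℤ → V} (hL : IsLine T L)
    (hL' : IsLine T L') : ∃ h ∈ H, ∃ c : ℤ, ∀ k, h (L k) = L' (k + c) := by
  rw [MulAction.is_two_pretransitive_iff] at h2
  obtain ⟨⟨h, hh⟩, e1, e2⟩ := h2 (hL.posRay_ne_negRay hT) (hL'.posRay_ne_negRay hT)
  exact ⟨h, hh, (hL.map h).exists_shift hT hL' e1 e2⟩

/-- The powers of g string the copies of the edge {v₀, v₁} together. Floor division of the index by
2 gives the exponent, the remainder gives the endpoint, and the two inequalities exclude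
backtracking where copies meet. -/
theorem exists_translation_line {v₀ v₁ v₂ v₃ : V} (h01 : T.Adj v₀ v₁) (h12 : T.Adj v₁ v₂)
    (h02 : v₀ ≠ v₂) (h13 : v₁ ≠ v₃) {g : T ≃g T} (hg0 : g v₀ = v₂) (hg1 : g v₁ = v₃) :
    ∃ L : ℤ → V, IsLine T L ∧ ∀ k, g (L k) = L (k + 2) := by
  have key : ∀ (k : ℤ) (x : V), g ((g ^ k) x) = (g ^ (k + 1)) x := fun k x => by
    rw [add_comm, zpow_one_add, RelIso.mul_apply]
  have key2 : ∀ (k : ℤ) (x : V), (g ^ (k + 1)) x = (g ^ k) (g x) := fun k x => by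
    rw [zpow_add_one, RelIso.mul_apply]
  have dv : ∀ k : ℤ, (k + 2) / 2 = k / 2 + 1 := fun k => by omega
  have md : ∀ k : ℤ, (k + 2) % 2 = k % 2 := fun k => by omega
  refine ⟨fun k => (g ^ (k / 2)) (if k % 2 = 0 then v₀ else v₁), ⟨fun k => ?_, fun k => ?_⟩,
    fun k => ?_⟩ <;> dsimp only
  · rcases Int.emod_two_eq_zero_or_one k with hk | hk
    · rw [if_pos hk, if_neg (by omega), show (k + 1) / 2 = k / 2 by omega]
      exact (g ^ (k / 2)).map_adj_iff.mpr h01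
    · rw [if_neg (by omega), if_pos (by omega), show (k + 1) / 2 = k / 2 + 1 by omega, key2, hg0]
      exact (g ^ (k / 2)).map_adj_iff.mpr h12
  · simp only [dv, md, key2]
    refine (g ^ (k / 2)).injective.ne ?_
    split_ifs
    · rwa [hg0]
    · rwa [hg1]
  · simp only [dv, md, key]

/-- If `H` is `2`-transitive on the ends and locally transitive, and preserves the types, then the
stabilizer of a vertex is transitive on the spheres around it. -/
theorem exists_fix_fix_map_eq (hT : T.IsTree) {τ : V → Fin 2}
    (hτ : ∀ ⦃v w : V⦄, T.Adj v w → τ v ≠ τ w) (hH : ∀ h ∈ H, ∀ v, τ (h v) = τ v)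
    (hdeg : ∀ a b, T.Adj a b → ∃ c, T.Adj b c ∧ a ≠ c)
    (h2 : MulAction.IsMultiplyPretransitive H (Ends T) 2)
    (hloc : ∀ v a b, T.Adj v a → T.Adj v b → ∃ h ∈ H, h v = v ∧ h a = b) {x y u u' : V}
    (hu : T.Adj y u) (hu' : T.Adj y u') (hd : T.dist x u = T.dist x y + 1)
    (hd' : T.dist x u' = T.dist x y + 1) : ∃ h ∈ H, h x = x ∧ h y = y ∧ h u = u' := by
  by_cases hxy : x = y
  · subst hxy
    obtain ⟨h, hh, e1, e2⟩ := hloc x u u' hu hu'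
    exact ⟨h, hh, e1, e1, e2⟩
  obtain ⟨y', hy', hyy'⟩ := exists_closer hT hxy
  rw [SimpleGraph.dist_comm, SimpleGraph.dist_comm (u := x)] at hyy'
  obtain ⟨A, hA, hA0, hA1, hAx⟩ := exists_nb_through hT hdeg (T.dist y' x) hy'.symm rfl hyy'
  obtain ⟨B, hB, hB0, hB1⟩ := exists_nb_of_adj hdeg hu
  obtain ⟨B', hB', hB0', hB1'⟩ := exists_nb_of_adj hdeg hu'
  have c1 : A 1 ≠ B 1 := by
    rw [hA1, hB1]; rintro rfl
    rw [SimpleGraph.dist_comm, SimpleGraph.dist_comm (u := x)] at hd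
    omega
  have c2 : A 1 ≠ B' 1 := by
    rw [hA1, hB1']; rintro rfl
    rw [SimpleGraph.dist_comm, SimpleGraph.dist_comm (u := x)] at hd'
    omega
  have hL := isLine_glue hA hB (hA0.trans hB0.symm) c1
  have hL' := isLine_glue hA hB' (hA0.trans hB0'.symm) c2
  set L : ℤ → V := fun k => if 0 ≤ k then B k.toNat else A (-k).toNat with hLdef
  set L' : ℤ → V := fun k => if 0 ≤ k then B' k.toNat else A (-k).toNat with hLdef'
  have hneg : ∀ k : ℕ, L (-k) = A k ∧ L' (-k) = A k := by
    intro k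
    by_cases hk : k = 0
    · subst hk
      simp [hLdef, hLdef', hA0, hB0, hB0']
    · simp only [hLdef, hLdef']
      rw [if_neg (by omega), if_neg (by omega)]
      simp
  -- The two lines share the negative half, which runs from y through x, and branch off into u and
  -- u'. An element matching them without shift does what is wanted.
  have one : L 1 = u ∧ L' 1 = u' := by
    simp [hLdef, hLdef', hB1, hB1']
  obtain ⟨h, hh, c, hc⟩ := exists_shift_of_ends hT h2 hL hL'
  -- the shift is even
  have htype : ∀ k : ℤ, τ (L' (k + 1)) ≠ τ (L' k) := fun k => (hτ (hL'.1 k)).symm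
  have htype2 : ∀ k : ℤ, τ (L' (k + 2)) = τ (L' k) := by
    intro k
    have e1 := htype k
    have e2 := htype (k + 1)
    rw [show k + 1 + 1 = k + 2 by ring] at e2
    omega
  have htypen : ∀ (n : ℕ) (k : ℤ), τ (L' (k + 2 * n)) = τ (L' k) := by
    intro n
    induction n with
    | zero => intro k; simp
    | succ n ih =>
      intro k
      rw [← ih k, ← htype2 (k + 2 * n)]
      congr 2
      push_cast
      ring
  have htypez : ∀ (j k : ℤ), τ (L' (k + 2 * j)) = τ (L' k) := by
    intro j k
    rcases le_total 0 j with hj | hj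
    · rw [← htypen j.toNat k]
      congr 2
      omega
    · rw [← htypen (-j).toNat (k + 2 * j)]
      congr 2
      omega
  have hceven : c % 2 = 0 := by
    by_contra hodd
    have e1 := hH h hh (L 0)
    rw [hc, show L 0 = L' 0 by rw [← Int.neg_zero]; exact (hneg 0).1.trans (hneg 0).2.symm] at e1
    have e2 := htypez (c / 2) (0 + 1)
    rw [show (0 + 1 + 2 * (c / 2) : ℤ) = 0 + c by omega, e1] at e2
    exact htype 0 e2.symm
  -- a translation along `L'`
  obtain ⟨w, hw, hyw⟩ := hdeg u y hu.symm
  obtain ⟨z, hz, hyz⟩ := hdeg y w hw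
  obtain ⟨a, ha, ha1, ha2⟩ := hloc y u w hu hw
  obtain ⟨b, hb, hb1, hb2⟩ := hloc w y z hw.symm hz
  -- Along the path u, y, w, z, `b * a` sends u to w and y to z, so it translates an axis by 2.
  -- Conjugation by `r` below moves this axis onto `L'`.
  obtain ⟨L₀, hL₀, hg⟩ := exists_translation_line (g := b * a) hu.symm hw hyw hyz
    (by rw [RelIso.mul_apply, ha2, hb1]) (by rw [RelIso.mul_apply, ha1, hb2])
  obtain ⟨r, hr, c', hc'⟩ := exists_shift_of_ends hT h2 hL₀ hL'
  have hr' : ∀ k, r⁻¹ (L' k) = L₀ (k - c') := by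
    intro k
    rw [show L' k = r (L₀ (k - c')) by rw [hc', sub_add_cancel], RelIso.inv_apply_self]
  set t := r * (b * a) * r⁻¹ with ht
  have htH : t ∈ H := mul_mem (mul_mem hr (mul_mem hb ha)) (inv_mem hr)
  have htL : ∀ k, t (L' k) = L' (k + 2) := by
    intro k
    rw [ht, RelIso.mul_apply, RelIso.mul_apply, hr', hg, hc']
    congr 1
    ring
  have htL' : ∀ k, t⁻¹ (L' k) = L' (k - 2) := by
    intro k
    rw [show L' k = t (L' (k - 2)) by rw [htL, sub_add_cancel], RelIso.inv_apply_self]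
  have htn : ∀ (j : ℤ) k, (t ^ j) (L' k) = L' (k + 2 * j) := by
    intro j
    induction j with
    | zero => intro k; simp
    | succ n ih =>
      intro k
      rw [zpow_add_one, RelIso.mul_apply, htL, ih]
      congr 1
      ring
    | pred n ih =>
      intro k
      rw [zpow_sub_one, RelIso.mul_apply, htL', ih]
      congr 1
      ring
  have fin : ∀ k, (t ^ (-(c / 2)) * h) (L k) = L' k := by
    intro k
    rw [RelIso.mul_apply, hc, htn]
    congr 1
    omega
  refine ⟨t ^ (-(c / 2)) * h, mul_mem (zpow_mem htH _) hh, ?_, ?_, ?_⟩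
  · have := fin (-(T.dist y' x + 1 : ℕ))
    rwa [(hneg _).1, (hneg _).2, hAx] at this
  · have := fin (-(0 : ℕ))
    rwa [(hneg _).1, (hneg _).2, hA0] at this
  · have := fin 1
    rwa [one.1, one.2] at this

end Transitivity

end TreeAut

/-! ### Fixators of half-tree balls: radius at most 1. -/

namespace TreeAut

set_option linter.unusedSectionVars false

variable {V : Type*} {T : SimpleGraph V} [T.LocallyFinite] [DecidableEq V]
variable {H : Subgroup (T ≃g T)}

/-- The local and global transitivity properties of `H` from which everything is derived. -/
structure IsLocallyAlternating (T : SimpleGraph V) [T.LocallyFinite] (H : Subgroup (T ≃g T)) :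
    Prop where
  isTree : T.IsTree
  card : ∀ v, 6 ≤ (T.neighborFinset v).card
  full : ∀ v, Full (fixing H {v}) (T.neighborFinset v)
  trans : ∀ {x y u u' : V}, T.Adj y u → T.Adj y u' → T.dist x u = T.dist x y + 1 →
    T.dist x u' = T.dist x y + 1 → ∃ h ∈ H, h x = x ∧ h y = y ∧ h u = u'

/-- The vertices on the side of `p` of the edge `{p, y}` at distance at most `n` from `p`. -/
def reg (T : SimpleGraph V) (p y : V) (n : ℕ) : Set V :=
  {x | T.dist x p < T.dist x y ∧ T.dist x p ≤ n}

theorem mem_reg {p y x : V} {n : ℕ} :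
    x ∈ reg T p y n ↔ T.dist x p < T.dist x y ∧ T.dist x p ≤ n := Iff.rfl

theorem self_mem_reg {p y : V} (h : T.Adj p y) (n : ℕ) : p ∈ reg T p y n := by
  rw [mem_reg, SimpleGraph.dist_self, dist_of_adj h]
  omega

theorem map_mem_reg (hT : T.IsTree) {p y x : V} {n : ℕ} (g : T ≃g T) (h : x ∈ reg T p y n) :
    g x ∈ reg T (g p) (g y) n := by
  rwa [mem_reg, dist_map hT, dist_map hT]

theorem map_mem_reg_of_fix (hT : T.IsTree) {p y x : V} {n : ℕ} {g : T ≃g T} (hp : g p = p)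
    (hy : g y = y) (h : x ∈ reg T p y n) : g x ∈ reg T p y n := by
  have := map_mem_reg hT g h
  rwa [hp, hy] at this

theorem reg_zero (hT : T.IsTree) {p y : V} (h : T.Adj p y) : reg T p y 0 = {p} := by
  ext x
  rw [mem_reg, Set.mem_singleton_iff, Nat.le_zero, hT.connected.dist_eq_zero_iff]
  constructor
  · exact fun h => h.2
  · rintro rfl
    rw [SimpleGraph.dist_self, dist_of_adj h]
    exact ⟨Nat.zero_lt_one, rfl⟩

/-- For radius 1 the set is the unit ball around p, whichever neighbor y is used. This lets the
fixators for different edges at p be identified. -/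
theorem insert_reg_one (hT : T.IsTree) {p y : V} (h : T.Adj p y) :
    insert y (reg T p y 1) = insert p (T.neighborSet p) := by
  ext x
  rw [Set.mem_insert_iff, Set.mem_insert_iff, mem_reg, SimpleGraph.mem_neighborSet]
  constructor
  · rintro (rfl | ⟨h1, h2⟩)
    · exact Or.inr h
    · rcases Nat.le_one_iff_eq_zero_or_eq_one.mp h2 with h3 | h3
      · exact Or.inl (hT.connected.dist_eq_zero_iff.mp h3)
      · exact Or.inr (SimpleGraph.dist_eq_one_iff_adj.mp h3).symm
  · rintro (rfl | hx)
    · right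
      rw [SimpleGraph.dist_self, dist_of_adj h]
      omega
    · by_cases hxy : x = y
      · exact Or.inl hxy
      · right
        have h1 := dist_of_adj hx.symm
        have h2 := hT.dist_eq_dist_add_one_of_adj x h
        have h3 := (dist_pos_iff hT).mpr hxy
        omega

theorem conj_mem_fixing {S : Set V} {g n : T ≃g T} (hg : g ∈ H) (hn : n ∈ fixing H S)
    (hS : ∀ x ∈ S, g⁻¹ x ∈ S) : g * n * g⁻¹ ∈ fixing H S := by
  refine ⟨mul_mem (mul_mem hg hn.1) (inv_mem hg), fun x hx => ?_⟩
  rw [RelIso.mul_apply, RelIso.mul_apply, hn.2 _ (hS x hx), RelIso.apply_inv_self]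

theorem conj_mem_fixing_reg (hT : T.IsTree) {p y : V} {m : ℕ} {g n : T ≃g T} (hg : g ∈ H)
    (hp : g p = p) (hy : g y = y) (hn : n ∈ fixing H (insert y (reg T p y m))) :
    g * n * g⁻¹ ∈ fixing H (insert y (reg T p y m)) := by
  refine conj_mem_fixing hg hn ?_
  rintro x (rfl | hx)
  · exact Or.inl (inv_fix hy)
  · exact Or.inr (map_mem_reg_of_fix hT (inv_fix hp) (inv_fix hy) hx)

/-- A group that is transitive around the two ends of an edge is transitive on the edges. -/
theorem exists_map_edge (hT : T.IsTree) {M : Subgroup (T ≃g T)} {v w : V}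
    (hv : ∀ u, T.Adj v u → ∃ m ∈ M, m v = v ∧ m w = u)
    (hw : ∀ u, T.Adj w u → ∃ m ∈ M, m w = w ∧ m v = u) {a b : V} (hab : T.Adj a b) :
    ∃ m ∈ M, (m v = a ∧ m w = b) ∨ (m v = b ∧ m w = a) := by
  have step : ∀ {a b : V}, T.Adj a b → (∃ m ∈ M, m v = a ∨ m w = a) →
      ∃ m ∈ M, (m v = a ∧ m w = b) ∨ (m v = b ∧ m w = a) := by
    rintro a b hab ⟨m, hm, h | h⟩
    · have h1 : T.Adj v (m⁻¹ b) := by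
        have := m⁻¹.map_adj_iff.mpr hab
        rwa [← h, RelIso.inv_apply_self] at this
      obtain ⟨k, hk, e1, e2⟩ := hv _ h1
      refine ⟨m * k, mul_mem hm hk, Or.inl ⟨?_, ?_⟩⟩
      · rw [RelIso.mul_apply, e1, h]
      · rw [RelIso.mul_apply, e2, RelIso.apply_inv_self]
    · have h1 : T.Adj w (m⁻¹ b) := by
        have := m⁻¹.map_adj_iff.mpr hab
        rwa [← h, RelIso.inv_apply_self] at this
      obtain ⟨k, hk, e1, e2⟩ := hw _ h1
      refine ⟨m * k, mul_mem hm hk, Or.inr ⟨?_, ?_⟩⟩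
      · rw [RelIso.mul_apply, e2, RelIso.apply_inv_self]
      · rw [RelIso.mul_apply, e1, h]
  refine step hab ?_
  have : Relation.ReflTransGen T.Adj v a := by
    rw [← SimpleGraph.reachable_iff_reflTransGen]
    exact hT.connected v a
  clear hab
  induction this with
  | refl => exact ⟨1, one_mem _, Or.inl rfl⟩
  | tail _ h ih =>
    obtain ⟨m, hm, h | h⟩ := step h ih
    · exact ⟨m, hm, Or.inr h.2⟩
    · exact ⟨m, hm, Or.inl h.1⟩

namespace IsLocallyAlternating

variable (hH : IsLocallyAlternating T H)
include hH

theorem card_ch {p y : V} (h : T.Adj p y) : 5 ≤ (ch T p y).card := by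
  rw [ch, Finset.card_erase_of_mem ((T.mem_neighborFinset y p).mpr h.symm)]
  have := hH.card y
  omega

theorem exists_fix_map_eq {v a b : V} (ha : T.Adj v a) (hb : T.Adj v b) :
    ∃ h ∈ H, h v = v ∧ h a = b :=
  have ⟨h, hh, h1, _, h2⟩ := hH.trans (x := v) ha hb
    (by rw [SimpleGraph.dist_self, dist_of_adj ha]) (by rw [SimpleGraph.dist_self, dist_of_adj hb])
  ⟨h, hh, h1, h2⟩

theorem exists_edge_map {p y a b : V} (h : T.Adj p y) (hab : T.Adj a b) :
    ∃ m ∈ H, (m p = a ∧ m y = b) ∨ (m p = b ∧ m y = a) :=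
  exists_map_edge hH.isTree (fun _ hu => hH.exists_fix_map_eq h hu)
    (fun _ hu => hH.exists_fix_map_eq h.symm hu) hab

theorem exists_two_farther (w x : V) : ∃ u u', u ≠ u' ∧ T.Adj x u ∧ T.Adj x u' ∧
    T.dist w u = T.dist w x + 1 ∧ T.dist w u' = T.dist w x + 1 := by
  have hT := hH.isTree
  have key : ∃ q, ∀ u, T.Adj x u → u ≠ q → T.dist w u = T.dist w x + 1 := by
    by_cases h : w = x
    · exact ⟨w, fun u hu _ => by rw [h, SimpleGraph.dist_self, dist_of_adj hu]⟩
    · obtain ⟨q, hq, hq'⟩ := exists_closer hT h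
      refine ⟨q, fun u hu hne => ?_⟩
      rcases hT.dist_eq_dist_add_one_of_adj w hu with h1 | h1
      · exact absurd (closer_unique hT hu.symm hq h1 hq') hne
      · exact h1
  obtain ⟨q, hq⟩ := key
  have hc := hH.card x
  obtain ⟨u, hu, hu'⟩ := exists_not_mem_of_card_lt (X := T.neighborFinset x) {q}
    (by rw [Finset.card_singleton]; omega)
  obtain ⟨u', hv, hv'⟩ := exists_not_mem_of_card_lt (X := T.neighborFinset x) {q, u}
    (lt_of_le_of_lt Finset.card_le_two (by omega))
  simp only [Finset.mem_insert, Finset.mem_singleton, not_or,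
    SimpleGraph.mem_neighborFinset] at hu hu' hv hv'
  exact ⟨u, u', Ne.symm hv'.2, hu, hv, hq u hu hu', hq u' hv hv'.1⟩

/-- `H` is not discrete. -/
theorem exists_ne_one (w : V) : ∃ h ∈ fixing H (insert w (T.neighborSet w)), h ≠ 1 := by
  have hT := hH.isTree
  by_contra! hc
  have hfin : (fixing H {w} : Set (T ≃g T)).Finite := by
    let f : fixing H {w} → (T.neighborFinset w → T.neighborFinset w) := fun h u =>
      ⟨h.1 u, by
        have h1 := h.1.map_adj_iff.mpr ((T.mem_neighborFinset w u).mp u.2)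
        rw [h.2.2 w rfl] at h1
        exact (T.mem_neighborFinset w _).mpr h1⟩
    have hf : Function.Injective f := by
      intro g h hgh
      have : (h.1)⁻¹ * g.1 = 1 := by
        refine hc _ ⟨mul_mem (inv_mem h.2.1) g.2.1, ?_⟩
        rintro x (rfl | hx)
        · rw [RelIso.mul_apply, g.2.2 x rfl, inv_fix (h.2.2 x rfl)]
        · have := congrArg Subtype.val (congrFun hgh ⟨x, (T.mem_neighborFinset w x).mpr hx⟩)
          change g.1 x = h.1 x at this
          rw [RelIso.mul_apply, this, RelIso.inv_apply_self]
      exact Subtype.ext (inv_mul_eq_one.mp this).symm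
    have := Finite.of_injective f hf
    exact Set.toFinite _
  -- Infinite descent on the order of the stabilizer of w and x: passing to a farther neighbor u of
  -- x makes it strictly smaller, because some element fixing w and x moves u to u'.
  have desc : ∀ n : ℕ, ∀ x, (fixing H {w, x} : Set (T ≃g T)).ncard = n → False := by
    intro n
    induction n using Nat.strong_induction_on with
    | _ n ih =>
      intro x hx
      obtain ⟨u, u', hne, hu, hu', hd, hd'⟩ := hH.exists_two_farther w x
      obtain ⟨h, hh, h1, h2, h3⟩ := hH.trans hu hu' hd hd'
      refine ih _ ?_ u rfl
      rw [← hx]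
      refine Set.ncard_lt_ncard ?_ (hfin.subset (fixing_mono le_rfl (by simp)))
      rw [Set.ssubset_iff_of_subset]
      · refine ⟨h, ⟨hh, ?_⟩, fun hu => ?_⟩
        · rintro y (rfl | rfl)
          · exact h1
          · exact h2
        · have := hu.2 u (by simp)
          exact hne (this.symm.trans h3)
      · intro g hg
        refine ⟨hg.1, ?_⟩
        have e1 := hg.2 w (by simp)
        have e2 := hg.2 u (by simp)
        rintro y (rfl | rfl)
        · exact e1
        · exact fix_of_fix_of_dist hT e1 e2 hu (by omega)
  exact desc _ w rfl

theorem fix_of_mem {p y : V} {n : ℕ} (h : T.Adj p y) {g : T ≃g T}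
    (hg : g ∈ fixing H (insert y (reg T p y n))) : g p = p ∧ g y = y :=
  ⟨hg.2 p (Or.inr (self_mem_reg h n)), hg.2 y (Or.inl rfl)⟩

theorem full_reg_zero {p y : V} (h : T.Adj p y) :
    Full (fixing H (insert y (reg T p y 0))) (ch T p y) := by
  refine (hH.full y).erase ((T.mem_neighborFinset y p).mpr h.symm) fun g hg hgp => ⟨hg.1, ?_⟩
  rw [reg_zero hH.isTree h]
  rintro x (rfl | rfl)
  · exact hg.2 x rfl
  · exact hgp

/-- This fixator is normalized by the one for radius 0, which is full. -/
theorem trivial_or_full_reg {p y : V} (h : T.Adj p y) (n : ℕ) :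
    (∀ g ∈ fixing H (insert y (reg T p y n)), ∀ x ∈ ch T p y, g x = x) ∨
      Full (fixing H (insert y (reg T p y n))) (ch T p y) := by
  refine (hH.full_reg_zero h).trivial_or_full (hH.card_ch h) (fun g hg n hn => ?_)
    (fun g hg x hx => ?_)
  · have := hH.fix_of_mem h hg
    exact conj_mem_fixing_reg hH.isTree hg.1 this.1 this.2 hn
  · have := hH.fix_of_mem h hg
    exact map_mem_ch_of_fix this.1 this.2 hx

/-- Suppose the action around y is trivial. If it is also trivial around p in the reversed
situation, the fixators of the unit balls coincide along all edges, against nondiscreteness.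
Otherwise a square that acts nontrivially around y can be made trivial around p without changing its
action around y, a contradiction. -/
theorem full_reg_one {p y : V} (h : T.Adj p y) :
    Full (fixing H (insert y (reg T p y 1))) (ch T p y) := by
  have hT := hH.isTree
  rcases hH.trivial_or_full_reg h 1 with h1 | h1
  swap
  · exact h1
  exfalso
  rcases hH.trivial_or_full_reg h.symm 1 with h2 | h2
  · rw [insert_reg_one hT h] at h1
    rw [insert_reg_one hT h.symm] at h2
    have k1 : fixing H (insert p (T.neighborSet p)) ≤ fixing H (insert y (T.neighborSet y)) := by
      intro g hg
      refine ⟨hg.1, ?_⟩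
      rintro x (rfl | hx)
      · exact hg.2 x (Or.inr h)
      · by_cases hxp : x = p
        · exact hxp ▸ hg.2 p (Or.inl rfl)
        · exact h1 g hg x (mem_ch.mpr ⟨hxp, hx⟩)
    have k2 : fixing H (insert y (T.neighborSet y)) ≤ fixing H (insert p (T.neighborSet p)) := by
      intro g hg
      refine ⟨hg.1, ?_⟩
      rintro x (rfl | hx)
      · exact hg.2 x (Or.inr h.symm)
      · by_cases hxp : x = y
        · exact hxp ▸ hg.2 y (Or.inl rfl)
        · exact h2 g hg x (mem_ch.mpr ⟨hxp, hx⟩)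
    have hconj : ∀ (m : T ≃g T) (a : V) (g : T ≃g T), m ∈ H →
        g ∈ fixing H (insert a (T.neighborSet a)) →
        m * g * m⁻¹ ∈ fixing H (insert (m a) (T.neighborSet (m a))) := by
      intro m a g hm hg
      refine ⟨mul_mem (mul_mem hm hg.1) (inv_mem hm), fun x hx => ?_⟩
      rw [RelIso.mul_apply, RelIso.mul_apply, hg.2, RelIso.apply_inv_self]
      rcases hx with rfl | hx
      · left; exact RelIso.inv_apply_self m a
      · right
        have := m⁻¹.map_adj_iff.mpr hx
        rwa [RelIso.inv_apply_self] at this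
    have hadj : ∀ a b, T.Adj a b → fixing H (insert a (T.neighborSet a)) ≤
        fixing H (insert b (T.neighborSet b)) := by
      intro a b hab g hg
      obtain ⟨m, hm, ⟨rfl, rfl⟩ | ⟨rfl, rfl⟩⟩ := hH.exists_edge_map h hab
      · have := hconj m⁻¹ _ g (inv_mem hm) hg
        rw [RelIso.inv_apply_self] at this
        have := hconj m _ _ hm (k1 this)
        rwa [show m * (m⁻¹ * g * m⁻¹⁻¹) * m⁻¹ = g by group] at this
      · have := hconj m⁻¹ _ g (inv_mem hm) hg
        rw [RelIso.inv_apply_self] at this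
        have := hconj m _ _ hm (k2 this)
        rwa [show m * (m⁻¹ * g * m⁻¹⁻¹) * m⁻¹ = g by group] at this
    obtain ⟨g, hg, hg1⟩ := hH.exists_ne_one p
    refine hg1 (RelIso.ext fun x => ?_)
    have hr : Relation.ReflTransGen T.Adj p x := by
      rw [← SimpleGraph.reachable_iff_reflTransGen]
      exact hT.connected p x
    have : g ∈ fixing H (insert x (T.neighborSet x)) := by
      induction hr with
      | refl => exact hg
      | tail _ h ih => exact hadj _ _ h ih
    exact this.2 x (Or.inl rfl)
  · obtain ⟨g, hg, x, hx, hne⟩ := (hH.full_reg_zero h).exists_sq_ne (hH.card_ch h)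
    have hf := hH.fix_of_mem h hg
    -- `k` fixes the unit ball around y and agrees with g² on the other neighbors of p. So k⁻¹g²
    -- fixes the unit ball around p, yet acts around y as g².
    obtain ⟨k, hk, hkg⟩ := h2.exists_sq (g := g) (fun x hx => map_mem_ch_of_fix hf.2 hf.1 hx)
    rw [insert_reg_one hT h.symm] at hk
    have hmem : k⁻¹ * (g * g) ∈ fixing H (insert y (reg T p y 1)) := by
      rw [insert_reg_one hT h]
      refine ⟨mul_mem (inv_mem hk.1) (mul_mem hg.1 hg.1), ?_⟩
      rintro u (rfl | hu)
      · rw [RelIso.mul_apply, RelIso.mul_apply, hf.1, hf.1]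
        exact inv_fix (hk.2 u (Or.inr h.symm))
      · by_cases huy : u = y
        · subst huy
          rw [RelIso.mul_apply, RelIso.mul_apply, hf.2, hf.2]
          exact inv_fix (hk.2 u (Or.inl rfl))
        · rw [RelIso.mul_apply, RelIso.mul_apply, ← hkg u (mem_ch.mpr ⟨huy, hu⟩),
            RelIso.inv_apply_self]
    have e := h1 _ hmem x hx
    rw [RelIso.mul_apply, RelIso.mul_apply] at e
    apply hne
    have e' : g (g x) = k x := by
      rw [← RelIso.apply_inv_self k (g (g x)), e]
    rw [e']
    exact hk.2 x (Or.inr (mem_ch.mp hx).2)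

end IsLocallyAlternating

end TreeAut

/-! ### Fixators of half-tree balls: all radii. -/

namespace TreeAut

set_option linter.unusedSectionVars false

variable {V : Type*} {T : SimpleGraph V} [T.LocallyFinite] [DecidableEq V]
variable {H : Subgroup (T ≃g T)}

/-- `reg T w z n`, the vertex `z`, and the children of the vertices in `S` of the outer sphere. -/
def regCh (T : SimpleGraph V) (w z : V) (n : ℕ) (S : Set V) : Set V :=
  insert z (reg T w z n) ∪ {u | ∃ y ∈ S, T.Adj y u ∧ T.dist w u = n + 1}

/-- The outer sphere of `reg T w z n`. -/
def outer (T : SimpleGraph V) (w z : V) (n : ℕ) : Set V :=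
  {y | T.dist w y = n ∧ T.dist z y = n + 1}

theorem outer_finite (hT : T.IsTree) (w z : V) (n : ℕ) : (outer T w z n).Finite :=
  (finite_ball hT w n).subset fun _ hy => hy.1.le

theorem outer_subset_reg {w z : V} {n : ℕ} : outer T w z n ⊆ reg T w z n := by
  rintro y ⟨h1, h2⟩
  rw [mem_reg, SimpleGraph.dist_comm, SimpleGraph.dist_comm (u := y) (v := z)]
  omega

theorem mem_regCh_child {w z y u : V} {n : ℕ} {S : Set V} (hy : y ∈ S) (hu : T.Adj y u)
    (hd : T.dist w u = n + 1) : u ∈ regCh T w z n S := Or.inr ⟨y, hy, hu, hd⟩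

theorem fixing_regCh_le {w z : V} {n : ℕ} {S : Set V} :
    fixing H (regCh T w z n S) ≤ fixing H (insert z (reg T w z n)) :=
  fixing_mono le_rfl Set.subset_union_left

theorem reg_succ_subset (hT : T.IsTree) {w z : V} (h : T.Adj w z) {n : ℕ} (hn : 1 ≤ n) :
    insert z (reg T w z (n + 1)) ⊆ regCh T w z n (outer T w z n) := by
  rintro x (rfl | hx)
  · exact Or.inl (Or.inl rfl)
  · by_cases hxn : T.dist x w ≤ n
    · exact Or.inl (Or.inr ⟨hx.1, hxn⟩)
    · right
      obtain ⟨hx1, hx2⟩ := hx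
      obtain ⟨y, hy, hy'⟩ := exists_closer hT (x := w) (y := x) (by
        rintro rfl; rw [SimpleGraph.dist_self] at hxn; omega)
      rw [SimpleGraph.dist_comm] at hx1 hx2 hxn
      rw [SimpleGraph.dist_comm (u := x) (v := z)] at hx1
      refine ⟨y, ⟨by omega, ?_⟩, hy, by omega⟩
      have h1 := hT.dist_eq_dist_add_one_of_adj z hy
      have h2 := hT.connected.dist_triangle (u := z) (v := w) (w := y)
      rw [dist_of_adj h.symm] at h2
      omega

namespace IsLocallyAlternating

variable (hH : IsLocallyAlternating T H)
include hH

/-- The elements that fix the outer sphere act on the children of its vertices. -/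
theorem child_map {w z y u : V} {n : ℕ} {g : T ≃g T} (h : T.Adj w z)
    (hg : g ∈ fixing H (insert z (reg T w z n))) (hy : y ∈ outer T w z n) (hu : T.Adj y u)
    (hd : T.dist w u = n + 1) : T.Adj y (g u) ∧ T.dist w (g u) = n + 1 := by
  have h1 := hg.2 y (Or.inr (outer_subset_reg hy))
  constructor
  · have := g.map_adj_iff.mpr hu
    rwa [h1] at this
  · have := dist_map hH.isTree g w u
    rwa [(hH.fix_of_mem h hg).1, hd] at this

theorem conj_mem_regCh {w z : V} {n : ℕ} (h : T.Adj w z) {S : Set V} (hS : S ⊆ outer T w z n)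
    {g k : T ≃g T} (hg : g ∈ fixing H (insert z (reg T w z n)))
    (hk : k ∈ fixing H (regCh T w z n S)) : g * k * g⁻¹ ∈ fixing H (regCh T w z n S) := by
  refine conj_mem_fixing hg.1 hk ?_
  rintro x (hx | ⟨y, hy, hyx, hd⟩)
  · rw [inv_fix (hg.2 x hx)]
    exact Or.inl hx
  · have := hH.child_map h (inv_mem hg) (hS hy) hyx hd
    exact mem_regCh_child hy this.1 this.2

theorem trivial_or_full_regCh {w z : V} {n : ℕ} (h : T.Adj w z)
    (hfull : Full (fixing H (insert z (reg T w z n))) (ch T w z)) {S : Set V}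
    (hS : S ⊆ outer T w z n) :
    (∀ g ∈ fixing H (regCh T w z n S), ∀ x ∈ ch T w z, g x = x) ∨
      Full (fixing H (regCh T w z n S)) (ch T w z) := by
  refine hfull.trivial_or_full (hH.card_ch h) (fun g hg k hk => hH.conj_mem_regCh h hS hg hk)
    fun g hg x hx => ?_
  have := hH.fix_of_mem h (fixing_regCh_le hg)
  exact map_mem_ch_of_fix this.1 this.2 hx

/-- If the fixator of `reg T w z (n + 1)` is trivial around `z`, then this is already the case for
the fixator of `reg T w z n` and the children of a single vertex. -/
theorem exists_single_trivial {w z : V} {n : ℕ} (h : T.Adj w z) (hn : 1 ≤ n)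
    (hfull : Full (fixing H (insert z (reg T w z n))) (ch T w z))
    (htriv : ∀ g ∈ fixing H (insert z (reg T w z (n + 1))), ∀ x ∈ ch T w z, g x = x) :
    ∃ y ∈ outer T w z n, ∀ g ∈ fixing H (regCh T w z n {y}), ∀ x ∈ ch T w z, g x = x := by
  have hT := hH.isTree
  by_contra! hc
  have hsingle : ∀ y ∈ outer T w z n, Full (fixing H (regCh T w z n {y})) (ch T w z) := by
    intro y hy
    rcases hH.trivial_or_full_regCh h hfull (Set.singleton_subset_iff.mpr hy) with h1 | h1
    · obtain ⟨g, hg, x, hx, hne⟩ := hc y hy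
      exact absurd (h1 g hg x hx) hne
    · exact h1
  -- The conditions at the vertices of S are imposed one at a time: a commutator of an element
  -- trivial on the children of S with one trivial on those of y is trivial on both.
  have hall : ∀ S : Finset V, (S : Set V) ⊆ outer T w z n →
      Full (fixing H (regCh T w z n S)) (ch T w z) := by
    intro S
    induction S using Finset.induction_on with
    | empty =>
      intro _
      refine hfull.mono fun g hg => ⟨hg.1, ?_⟩
      rintro x (hx | ⟨y, hy, -⟩)
      · exact hg.2 x hx
      · simp at hy
    | insert y S _ ih =>
      intro hS
      rw [Finset.coe_insert, Set.insert_subset_iff] at hS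
      refine (ih hS.2).commutator (hsingle y hS.1) (hH.card_ch h) fun a ha b hb => ?_
      have ha0 := fixing_regCh_le ha
      have hb0 := fixing_regCh_le hb
      have hab : a * b * a⁻¹ * b⁻¹ ∈ fixing H (insert z (reg T w z n)) :=
        mul_mem (mul_mem (mul_mem ha0 hb0) (inv_mem ha0)) (inv_mem hb0)
      refine ⟨hab.1, ?_⟩
      rintro u (hu | ⟨y', hy', hyu, hd⟩)
      · exact hab.2 u hu
      · simp only [RelIso.mul_apply]
        rw [Finset.coe_insert, Set.mem_insert_iff] at hy'
        rcases hy' with rfl | hy'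
        · have h1 := hH.child_map h (inv_mem ha0) hS.1 hyu hd
          rw [inv_fix (hb.2 u (mem_regCh_child rfl hyu hd)),
            hb.2 _ (mem_regCh_child rfl h1.1 h1.2), RelIso.apply_inv_self]
        · have h1 := hH.child_map h (inv_mem hb0) (hS.2 hy') hyu hd
          rw [inv_fix (ha.2 _ (mem_regCh_child hy' h1.1 h1.2)), RelIso.apply_inv_self]
          exact ha.2 u (mem_regCh_child hy' hyu hd)
  have hfin := outer_finite hT w z n
  obtain ⟨g, hg, x, hx, hne⟩ := (hall hfin.toFinset (by simp)).exists_sq_ne (hH.card_ch h)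
  rw [hfin.coe_toFinset] at hg
  have := htriv g (fixing_mono le_rfl (reg_succ_subset hT h hn) hg)
  exact hne (by rw [this x hx, this x hx])

theorem parent_dist {w z y q : V} {n : ℕ} (h : T.Adj w z) (hy : y ∈ outer T w z n)
    (hqy : T.Adj q y) (hq : T.dist w y = T.dist w q + 1) :
    T.dist w q + 1 = n ∧ T.dist z q = n := by
  obtain ⟨h1, h2⟩ := hy
  have h3 := hH.isTree.dist_eq_dist_add_one_of_adj z hqy
  have h4 := hH.isTree.connected.dist_triangle (u := z) (v := w) (w := q)
  rw [dist_of_adj h.symm] at h4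
  omega

/-- Conjugate by an element fixing z and q that sends y' to y. It also fixes w, which lies between z
and q. -/
theorem sibling_trivial {w z y y' q : V} {n : ℕ} (h : T.Adj w z)
    (hy : y ∈ outer T w z n) (hy' : y' ∈ outer T w z n) (hqy : T.Adj q y) (hqy' : T.Adj q y')
    (hq : T.dist w y = T.dist w q + 1)
    (hy0 : ∀ g ∈ fixing H (regCh T w z n {y}), ∀ x ∈ ch T w z, g x = x) :
    ∀ g ∈ fixing H (regCh T w z n {y'}), ∀ x ∈ ch T w z, g x = x := by
  have hT := hH.isTree
  obtain ⟨d1, d2⟩ := hH.parent_dist h hy hqy hq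
  obtain ⟨k, hk, kz, kq, ky⟩ := hH.trans (x := z) hqy' hqy (by rw [hy'.2, d2]) (by rw [hy.2, d2])
  have kw : k w = w := by
    refine fix_of_fix_of_dist hT kq kz h ?_
    rw [SimpleGraph.dist_comm, SimpleGraph.dist_comm (u := q) (v := z)]
    omega
  intro g hg x hx
  have h1 : k * g * k⁻¹ ∈ fixing H (regCh T w z n {y}) := by
    refine ⟨mul_mem (mul_mem hk hg.1) (inv_mem hk), fun u hu => ?_⟩
    rw [RelIso.mul_apply, RelIso.mul_apply, hg.2, RelIso.apply_inv_self]
    rcases hu with (rfl | hu) | ⟨v, rfl, hyu, hd⟩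
    · exact Or.inl (Or.inl (inv_fix kz))
    · exact Or.inl (Or.inr (map_mem_reg_of_fix hT (inv_fix kw) (inv_fix kz) hu))
    · refine Or.inr ⟨y', rfl, ?_, ?_⟩
      · have := k⁻¹.map_adj_iff.mpr hyu
        rwa [← ky, RelIso.inv_apply_self] at this
      · have := dist_map hT k⁻¹ w u
        rwa [inv_fix kw, hd] at this
  have h2 := hy0 _ h1 (k x) (map_mem_ch_of_fix kw kz hx)
  rw [RelIso.mul_apply, RelIso.mul_apply, RelIso.inv_apply_self] at h2
  exact k.injective h2

/-- The converse of `hy0`. The elements that also fix the children of z form a group normalized by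
the fixator of the n-ball at q, which fixes z and w, so they are trivial or full on the children of
y. If full, one of them could cancel a square there that is nontrivial around z, contradicting
`hy0`. -/
theorem children_trivial {w z y q : V} {n : ℕ} (h : T.Adj w z)
    (hfull : ∀ p y, T.Adj p y → Full (fixing H (insert y (reg T p y n))) (ch T p y))
    (hy : y ∈ outer T w z n) (hqy : T.Adj q y) (hq : T.dist w y = T.dist w q + 1)
    (hy0 : ∀ g ∈ fixing H (regCh T w z n {y}), ∀ x ∈ ch T w z, g x = x) {g : T ≃g T}
    (hg : g ∈ fixing H (insert z (reg T w z n))) (hgz : ∀ x ∈ ch T w z, g x = x) :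
    ∀ u ∈ ch T q y, g u = u := by
  have hT := hH.isTree
  obtain ⟨d1, d2⟩ := hH.parent_dist h hy hqy hq
  obtain ⟨y1, y2⟩ := hy
  have hfixq : ∀ {g : T ≃g T}, g ∈ fixing H (insert z (reg T w z n)) → g q = q := by
    intro g hg
    refine hg.2 q (Or.inr ?_)
    rw [mem_reg, SimpleGraph.dist_comm, SimpleGraph.dist_comm (u := q) (v := z)]
    omega
  have hfixy : ∀ {g : T ≃g T}, g ∈ fixing H (insert z (reg T w z n)) → g y = y :=
    fun hg => hg.2 y (Or.inr (outer_subset_reg ⟨y1, y2⟩))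
  have hchild : ∀ {u}, u ∈ ch T q y → T.Adj y u ∧ T.dist w u = n + 1 := by
    intro u hu
    have := dist_of_mem_ch hT hqy (x := w) (by omega) hu
    exact ⟨(mem_ch.mp hu).2, by omega⟩
  have hle : fixing H (insert z (reg T w z n) ∪ ch T w z) ≤ fixing H (insert z (reg T w z n)) :=
    fixing_mono le_rfl Set.subset_union_left
  rcases (hfull q y hqy).trivial_or_full (hH.card_ch hqy)
    (N := fixing H (insert z (reg T w z n) ∪ ch T w z)) (fun k hk m hm => by
      have kz : k z = z := hk.2 z (Or.inr (by
        rw [mem_reg]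
        omega))
      have kw : k w = w := hk.2 w (Or.inr (by
        rw [mem_reg]
        omega))
      refine conj_mem_fixing hk.1 hm ?_
      rintro x ((rfl | hx) | hx)
      · exact Or.inl (Or.inl (inv_fix kz))
      · exact Or.inl (Or.inr (map_mem_reg_of_fix hT (inv_fix kw) (inv_fix kz) hx))
      · exact Or.inr (map_mem_ch_of_fix (inv_fix kw) (inv_fix kz) hx)) (fun m hm x hx => by
      exact map_mem_ch_of_fix (hfixq (hle hm)) (hfixy (hle hm)) hx) with h1 | h1
  · refine h1 g ⟨hg.1, ?_⟩
    rintro x (hx | hx)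
    · exact hg.2 x hx
    · exact hgz x hx
  · exfalso
    obtain ⟨a, ha, x, hx, hne⟩ := (hfull w z h).exists_sq_ne (hH.card_ch h)
    obtain ⟨k, hk, hka⟩ := h1.exists_sq (g := a)
      (fun u hu => map_mem_ch_of_fix (hfixq ha) (hfixy ha) hu)
    have hk' := hle hk
    have hka' := mul_mem (inv_mem hk') (mul_mem ha ha)
    have e := hy0 (k⁻¹ * (a * a)) ⟨hka'.1, by
      rintro u (hu | ⟨v, rfl, hvu, hd⟩)
      · exact hka'.2 u hu
      · have hu : u ∈ ch T q v := by
          refine mem_ch_of_dist (x := w) hvu (by omega) (by omega)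
        rw [RelIso.mul_apply, RelIso.mul_apply, ← hka u hu, RelIso.inv_apply_self]⟩ x hx
    rw [RelIso.mul_apply, RelIso.mul_apply] at e
    apply hne
    rw [← RelIso.apply_inv_self k (a (a x)), e]
    exact hk.2 x (Or.inr hx)

/-- If this failed, the actions of the fixator of the unit ball around w on the children of two
siblings y₁, y₂ would be conjugate under one element b. Then fixing one child of y₁ would force
fixing all of them, impossible for a full group. -/
theorem full_reg_two {w z : V} (h : T.Adj w z) :
    Full (fixing H (insert z (reg T w z 2))) (ch T w z) := by
  have hT := hH.isTree
  have hfull : ∀ p y, T.Adj p y → Full (fixing H (insert y (reg T p y 1))) (ch T p y) :=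
    fun p y h => hH.full_reg_one h
  rcases hH.trivial_or_full_reg h 2 with htriv | h1
  swap
  · exact h1
  exfalso
  obtain ⟨y₁, hy₁, hy₁0⟩ := hH.exists_single_trivial h le_rfl (hfull w z h) htriv
  have hwy₁ : T.Adj w y₁ := SimpleGraph.dist_eq_one_iff_adj.mp hy₁.1
  have hzw := SimpleGraph.dist_comm (G := T) (u := w) (v := z)
  have hwz := dist_of_adj h
  have hww : T.dist w w = 0 := SimpleGraph.dist_self
  have hy₁z : y₁ ≠ z := by
    rintro rfl
    have := hy₁.2
    rw [SimpleGraph.dist_self] at this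
    omega
  obtain ⟨y₂, hy₂, hy₂'⟩ := exists_not_mem_of_card_lt (X := T.neighborFinset w) {z, y₁}
    (lt_of_le_of_lt Finset.card_le_two (by have := hH.card w; omega))
  simp only [Finset.mem_insert, Finset.mem_singleton, not_or,
    SimpleGraph.mem_neighborFinset] at hy₂ hy₂'
  have hout : y₂ ∈ outer T w z 1 := by
    refine ⟨dist_of_adj hy₂, ?_⟩
    have := dist_of_mem_ch hT h.symm (x := z) (by rw [SimpleGraph.dist_self]; omega)
      (mem_ch.mpr ⟨hy₂'.1, hy₂⟩)
    omega
  have hd₁ : T.dist w y₁ = T.dist w w + 1 := by rw [hww, hy₁.1]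
  have hd₂ : T.dist w y₂ = T.dist w w + 1 := by rw [hww, hout.1]
  have hy₂0 := hH.sibling_trivial h hy₁ hout hwy₁ hy₂ hd₁ hy₁0
  obtain ⟨b, hb, hby⟩ := (hfull z w h.symm).exists_apply_eq
    (by have := hH.card_ch h.symm; omega) (mem_ch.mpr ⟨hy₁z, hwy₁⟩) (mem_ch.mpr ⟨hy₂'.1, hy₂⟩)
  obtain ⟨bz, bw⟩ := hH.fix_of_mem h.symm hb
  have hbz : ∀ x, T.Adj z x → b x = x := by
    rw [insert_reg_one hT h.symm] at hb
    exact fun x hx => hb.2 x (Or.inr hx)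
  -- The commutator of a and b acts trivially around z, because b does, so `children_trivial` makes
  -- it trivial on the children of y₂.
  have hcomm : ∀ a ∈ fixing H (insert z (reg T w z 1)), ∀ u ∈ ch T w y₁, a (b u) = b (a u) := by
    intro a ha u hu
    have hc : a * b * a⁻¹ * b⁻¹ ∈ fixing H (insert z (reg T w z 1)) := by
      have := conj_mem_fixing_reg hT hb.1 bw bz (inv_mem ha)
      have := mul_mem ha this
      rwa [show a * (b * a⁻¹ * b⁻¹) = a * b * a⁻¹ * b⁻¹ by group] at this
    have hcz : ∀ x ∈ ch T w z, (a * b * a⁻¹ * b⁻¹) x = x := by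
      intro x hx
      have ha' := hH.fix_of_mem h (inv_mem ha)
      simp only [RelIso.mul_apply]
      rw [inv_fix (hbz x (mem_ch.mp hx).2), hbz _ (mem_ch.mp
        (map_mem_ch_of_fix ha'.1 ha'.2 hx)).2, RelIso.apply_inv_self]
    have hmem : b (a u) ∈ ch T w y₂ := by
      have ha' := hH.fix_of_mem h ha
      have hay : a y₁ = y₁ := ha.2 y₁ (Or.inr (outer_subset_reg hy₁))
      have := map_mem_ch b (map_mem_ch_of_fix ha'.1 hay hu)
      rwa [bw, hby] at this
    have := hH.children_trivial h hfull hout hy₂ hd₂ hy₂0 hc hcz _ hmem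
    simp only [RelIso.mul_apply, RelIso.inv_apply_self] at this
    exact this
  have hstab : ∀ a ∈ fixing H (insert z (reg T w z 1)), ∀ u ∈ ch T w y₁, a u = u →
      ∀ x ∈ ch T w y₁, a x = x := by
    intro a ha u hu hau
    have huw : T.dist u w < T.dist u y₂ := by
      refine lt_of_branch_ne hT hwy₁.symm hy₂.symm (Ne.symm hy₂'.2) ?_
      have := dist_of_mem_ch hT hwy₁ (x := w) (by omega) hu
      rw [SimpleGraph.dist_comm (v := w), SimpleGraph.dist_comm (v := y₁),
        dist_of_adj (mem_ch.mp hu).2]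
      omega
    have hyd : ∀ v ∈ ch T w y₂, T.dist u v = T.dist u y₂ + 1 :=
      fun v hv => dist_of_mem_ch hT hy₂ huw hv
    have hbu : b u ∈ ch T w y₂ := by
      have := map_mem_ch b hu
      rwa [bw, hby] at this
    have hy₂fix : ∀ v ∈ ch T w y₂, a v = v := by
      intro v hv
      -- `hcomm` for k⁻¹ak at the fixed child u shows that a fixes k (b u) = v, and v is an
      -- arbitrary child of y₂.
      obtain ⟨k, hk, ku, ky, kb⟩ := hH.trans (x := u) (mem_ch.mp hbu).2 (mem_ch.mp hv).2
        (hyd _ hbu) (hyd v hv)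
      have kw : k w = w := fix_of_fix_of_dist hT ku ky hy₂ huw
      have hka : k⁻¹ * a * k⁻¹⁻¹ ∈ fixing H (insert z (reg T w z 1)) := by
        rw [insert_reg_one hT h] at ha ⊢
        refine conj_mem_fixing (inv_mem hk) ha ?_
        rw [inv_inv]
        rintro x (rfl | hx)
        · exact Or.inl kw
        · right
          have := k.map_adj_iff.mpr hx
          rwa [kw] at this
      have e := hcomm _ hka u hu
      simp only [RelIso.mul_apply, inv_inv] at e
      rw [ku, hau, inv_fix ku, kb] at e
      rw [← RelIso.apply_inv_self k (a v), e, kb]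
    have hatriv := hy₂0 a ⟨ha.1, by
      rintro v (hv | ⟨y, rfl, hyv, hd⟩)
      · exact ha.2 v hv
      · refine hy₂fix v (mem_ch_of_dist (x := w) hyv (by omega) (by omega))⟩
    exact hH.children_trivial h hfull hy₁ hwy₁ hd₁ hy₁0 ha hatriv
  have hfy := hfull w y₁ hwy₁
  rw [insert_reg_one hT hwy₁, ← insert_reg_one hT h] at hfy
  have hcard := hH.card_ch hwy₁
  obtain ⟨u, hu, -⟩ := exists_not_mem_of_card_lt (X := ch T w y₁) ∅
    (by rw [Finset.card_empty]; omega)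
  have hfe : Full (fixing (fixing H (insert z (reg T w z 1))) {u}) ((ch T w y₁).erase u) :=
    hfy.erase hu fun g hg hgu => ⟨hg, fun x hx => by rw [hx]; exact hgu⟩
  have hcard' : 4 ≤ ((ch T w y₁).erase u).card := by
    rw [Finset.card_erase_of_mem hu]
    omega
  obtain ⟨c, hc⟩ := Finset.card_pos.mp (by omega : 0 < ((ch T w y₁).erase u).card)
  obtain ⟨c', hc', hcc⟩ := exists_not_mem_of_card_lt (X := (ch T w y₁).erase u) {c}
    (by rw [Finset.card_singleton]; omega)
  obtain ⟨g, hg, hgc⟩ := hfe.exists_apply_eq (by omega) hc hc'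
  have := hstab g hg.1 u hu (hg.2 u rfl) c (Finset.mem_of_mem_erase hc)
  rw [this] at hgc
  exact hcc (by rw [hgc]; simp)

/-- Take a with a² nontrivial around z, and any b fixing the n-ball at q on the far side of y₁.
Since n ≥ 2, b fixes the children of the sibling y₂, hence so does the commutator of a and b. That
commutator is then trivial around z and on the children of y₁. So a centralizes a full action there,
is trivial there, and hence trivial around z. -/
theorem full_reg_succ {w z : V} {n : ℕ} (h : T.Adj w z) (hn : 2 ≤ n)
    (hfull : ∀ p y, T.Adj p y → Full (fixing H (insert y (reg T p y n))) (ch T p y)) :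
    Full (fixing H (insert z (reg T w z (n + 1)))) (ch T w z) := by
  have hT := hH.isTree
  have hn1 : 1 ≤ n := by omega
  rcases hH.trivial_or_full_reg h (n + 1) with htriv | h1
  swap
  · exact h1
  exfalso
  obtain ⟨y₁, hy₁, hy₁0⟩ := hH.exists_single_trivial h hn1 (hfull w z h) htriv
  obtain ⟨q, hqy₁, hq⟩ := exists_closer hT (x := w) (y := y₁) (by
    rintro rfl
    have := hy₁.1
    rw [SimpleGraph.dist_self] at this
    omega)
  obtain ⟨d1, d2⟩ := hH.parent_dist h hy₁ hqy₁ hq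
  obtain ⟨q', hq'q, hq'⟩ := exists_closer hT (x := w) (y := q) (by
    rintro rfl
    rw [SimpleGraph.dist_self] at d1
    omega)
  obtain ⟨y₂, hy₂, hy₂'⟩ := exists_not_mem_of_card_lt (X := T.neighborFinset q) {q', y₁}
    (lt_of_le_of_lt Finset.card_le_two (by have := hH.card q; omega))
  simp only [Finset.mem_insert, Finset.mem_singleton, not_or,
    SimpleGraph.mem_neighborFinset] at hy₂ hy₂'
  have hdy₂ : T.dist w y₂ = T.dist w q + 1 :=
    dist_of_mem_ch hT hq'q (by omega) (mem_ch.mpr ⟨hy₂'.1, hy₂⟩)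
  have hout : y₂ ∈ outer T w z n := by
    refine ⟨by omega, ?_⟩
    have h2 := hT.connected.dist_triangle (u := z) (v := w) (w := q')
    rw [dist_of_adj h.symm] at h2
    rw [dist_of_mem_ch hT hq'q (x := z) (by omega) (mem_ch.mpr ⟨hy₂'.1, hy₂⟩), d2]
  have hy₂0 := hH.sibling_trivial h hy₁ hout hqy₁ hy₂ hq hy₁0
  obtain ⟨a, ha, x, hx, hne⟩ := (hfull w z h).exists_sq_ne (hH.card_ch h)
  have haq : a q = q := ha.2 q (Or.inr (by
    rw [mem_reg, SimpleGraph.dist_comm, SimpleGraph.dist_comm (u := q) (v := z)]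
    omega))
  have hay : a y₁ = y₁ := ha.2 y₁ (Or.inr (outer_subset_reg hy₁))
  have hatriv : ∀ u ∈ ch T q y₁, a u = u := by
    refine (hfull q y₁ hqy₁).trivial_of_commute (by have := hH.card_ch hqy₁; omega)
      (fun u hu => map_mem_ch_of_fix haq hay hu) fun b hb u hu => ?_
    have hbz : b z = z := hb.2 z (Or.inr (by
      rw [mem_reg, hy₁.2]
      omega))
    have hbw : b w = w := hb.2 w (Or.inr (by
      rw [mem_reg, hy₁.1]
      omega))
    -- These children are at distance 2 from q, and this is where n ≥ 2 enters.
    have hby₂ : ∀ v, T.Adj y₂ v → T.dist w v = n + 1 → b v = v := by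
      intro v hv hd
      refine hb.2 v (Or.inr ?_)
      rw [mem_reg]
      have e1 := hT.dist_eq_dist_add_one_of_adj v hqy₁
      have e2 : T.dist v q ≤ 2 := by
        have := hT.connected.dist_triangle (u := v) (v := y₂) (w := q)
        rwa [dist_of_adj hv.symm, dist_of_adj hy₂.symm] at this
      have e3 := hT.dist_eq_dist_add_one_of_adj v hy₂
      rw [dist_of_adj hv.symm] at e3
      have e4 : T.dist v q ≠ 0 := by
        intro h0
        rw [hT.connected.dist_eq_zero_iff.mp h0] at hd
        omega
      have e5 : T.dist v y₁ ≠ 1 := by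
        intro h1
        have hadj := SimpleGraph.dist_eq_one_iff_adj.mp h1
        exact hy₂'.2 (closer_unique hT (x := w) hv hadj.symm (by have := hout.1; omega)
          (by have := hy₁.1; omega))
      omega
    have hc : a * b * a⁻¹ * b⁻¹ ∈ fixing H (insert z (reg T w z n)) := by
      have := conj_mem_fixing_reg hT hb.1 hbw hbz (inv_mem ha)
      have := mul_mem ha this
      rwa [show a * (b * a⁻¹ * b⁻¹) = a * b * a⁻¹ * b⁻¹ by group] at this
    have hcz := hy₂0 _ ⟨hc.1, by
      rintro v (hv | ⟨y, rfl, hyv, hd⟩)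
      · exact hc.2 v hv
      · have h1 := hH.child_map h (inv_mem ha) hout hyv hd
        simp only [RelIso.mul_apply]
        rw [inv_fix (hby₂ v hyv hd), hby₂ _ h1.1 h1.2, RelIso.apply_inv_self]⟩
    have hbf := hH.fix_of_mem hqy₁ hb
    have := hH.children_trivial h hfull hy₁ hqy₁ hq hy₁0 hc hcz (b (a u))
      (map_mem_ch_of_fix hbf.1 hbf.2 (map_mem_ch_of_fix haq hay hu))
    simp only [RelIso.mul_apply, RelIso.inv_apply_self] at this
    exact this
  have := hy₁0 a ⟨ha.1, by
    rintro v (hv | ⟨y, rfl, hyv, hd⟩)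
    · exact ha.2 v hv
    · exact hatriv v (mem_ch_of_dist (x := w) hyv (by omega) (by omega))⟩
  exact hne (by rw [this x hx, this x hx])

/-- The fixator of a ball in a half-tree induces all even permutations on the edges at the root of
the opposite half-tree. -/
theorem full_reg (n : ℕ) : ∀ p y, T.Adj p y →
    Full (fixing H (insert y (reg T p y n))) (ch T p y) := by
  induction n with
  | zero => exact fun p y h => hH.full_reg_zero h
  | succ n ih =>
    intro p y h
    match n, ih with
    | 0, _ => exact hH.full_reg_one h
    | 1, _ => exact hH.full_reg_two h
    | n + 2, ih => exact hH.full_reg_succ h (by omega) ih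

end IsLocallyAlternating

end TreeAut

/-! ### Limits in closed groups, splitting of powers, and rigid 3-cycles. -/

namespace TreeAut

set_option linter.unusedSectionVars false

variable {V : Type*} {T : SimpleGraph V}

/-- Elements with small supports can be combined. -/
theorem exists_patch {ι : Type*} {M : Subgroup (T ≃g T)} {D : Set V} (Y : Finset ι) (X : ι → Set V)
    (e : ι → V → V) (he : ∀ i ∈ Y, ∀ x ∈ X i, e i x ∈ X i)
    (hm : ∀ i ∈ Y, ∃ m ∈ M, (∀ x ∈ X i, m x = e i x) ∧ (∀ x ∈ D, m x = x) ∧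
      ∀ j ∈ Y, j ≠ i → ∀ x ∈ X j, m x = x) :
    ∃ m ∈ M, (∀ x ∈ D, m x = x) ∧ ∀ i ∈ Y, ∀ x ∈ X i, m x = e i x := by
  classical
  have key : ∀ S : Finset ι, S ⊆ Y → ∃ m ∈ M, (∀ x ∈ D, m x = x) ∧
      (∀ i ∈ S, ∀ x ∈ X i, m x = e i x) ∧ ∀ i ∈ Y, i ∉ S → ∀ x ∈ X i, m x = x := by
    intro S
    induction S using Finset.induction_on with
    | empty =>
      exact fun _ => ⟨1, one_mem _, fun _ _ => rfl, fun i hi => absurd hi (Finset.notMem_empty i),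
        fun _ _ _ _ _ => rfl⟩
    | insert i S hi ih =>
      intro hS
      rw [Finset.insert_subset_iff] at hS
      obtain ⟨m, hmM, h1, h2, h3⟩ := ih hS.2
      obtain ⟨k, hk, k1, k2, k3⟩ := hm i hS.1
      refine ⟨k * m, mul_mem hk hmM, fun x hx => ?_, fun j hj x hx => ?_, fun j hj hjS x hx => ?_⟩
      · rw [RelIso.mul_apply, h1 x hx, k2 x hx]
      · rw [RelIso.mul_apply]
        rcases Finset.mem_insert.mp hj with rfl | hjS
        · rw [h3 j hS.1 hi x hx, k1 x hx]
        · rw [h2 j hjS x hx]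
          exact k3 j (hS.2 hjS) (fun h => hi (h ▸ hjS)) _ (he j (hS.2 hjS) x hx)
      · rw [Finset.mem_insert, not_or] at hjS
        rw [RelIso.mul_apply, h3 j hj hjS.2 x hx, k3 j hj hjS.1 x hx]
  obtain ⟨m, hmM, h1, h2, -⟩ := key Y subset_rfl
  exact ⟨m, hmM, h1, h2⟩

theorem mem_of_forall_eventually {H : Subgroup (T ≃g T)}
    (hcl : @IsClosed _ (autTopology T) (H : Set (T ≃g T))) {ι : Type*} {l : Filter ι} [l.NeBot]
    {h : ι → T ≃g T} (hh : ∀ i, h i ∈ H) {g : T ≃g T} (hg : ∀ x, ∀ᶠ i in l, h i x = g x) :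
    g ∈ H := by
  let _ : TopologicalSpace V := ⊥
  have _ : DiscreteTopology V := ⟨rfl⟩
  let _ : TopologicalSpace (T ≃g T) := autTopology T
  have ht : Filter.Tendsto h l (nhds g) := by
    rw [nhds_induced, Filter.tendsto_comap_iff, tendsto_pi_nhds]
    intro x
    rw [nhds_discrete, Filter.tendsto_pure]
    exact hg x
  exact hcl.mem_of_tendsto ht (Filter.Eventually.of_forall hh)

variable [T.LocallyFinite]

/-- Sequential compactness of the vertex stabilizers of a closed group. -/
theorem exists_limit (hT : T.IsTree) {H : Subgroup (T ≃g T)}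
    (hcl : @IsClosed _ (autTopology T) (H : Set (T ≃g T))) {h : ℕ → T ≃g T} (hh : ∀ n, h n ∈ H)
    {w : V} (hw : ∀ n, h n w = w) :
    ∃ g ∈ H, ∀ x, ∀ᶠ n in (Filter.hyperfilter ℕ : Filter ℕ), h n x = g x := by
  -- The images of x stay in a finite ball around w, so the ultrafilter selects one value.
  have lim : ∀ k : ℕ → T ≃g T, (∀ n, k n w = w) → ∀ x, ∃ y,
      ∀ᶠ n in (Filter.hyperfilter ℕ : Filter ℕ), k n x = y := by
    intro k hk x
    have hmem : ∀ n, k n x ∈ {y | T.dist w y ≤ T.dist w x} := by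
      intro n
      have := dist_map hT (k n) w x
      rw [hk] at this
      exact this.le
    have h1 : ∀ᶠ n in (Filter.hyperfilter ℕ : Filter ℕ),
        ∃ y ∈ {y | T.dist w y ≤ T.dist w x}, k n x = y :=
      Filter.Eventually.of_forall fun n => ⟨_, hmem n, rfl⟩
    rw [Ultrafilter.eventually_exists_mem_iff (finite_ball hT w _)] at h1
    obtain ⟨y, -, hy⟩ := h1
    exact ⟨y, hy⟩
  choose f hf using lim h hw
  -- The limit of the inverses makes the pointwise limit a bijection.
  choose f' hf' using lim (fun n => (h n)⁻¹) (fun n => inv_fix (hw n))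
  have e1 : ∀ x, f' (f x) = x := by
    intro x
    obtain ⟨n, h1, h2⟩ := ((hf x).and (hf' (f x))).exists
    rw [← h2, ← h1, RelIso.inv_apply_self]
  have e2 : ∀ x, f (f' x) = x := by
    intro x
    obtain ⟨n, h1, h2⟩ := ((hf' x).and (hf (f' x))).exists
    rw [← h2, ← h1, RelIso.apply_inv_self]
  let g : T ≃g T :=
    { toFun := f
      invFun := f'
      left_inv := e1
      right_inv := e2
      map_rel_iff' := by
        intro a b
        obtain ⟨n, h1, h2⟩ := ((hf a).and (hf b)).exists
        change T.Adj (f a) (f b) ↔ _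
        rw [← h1, ← h2]
        exact (h n).map_adj_iff }
  exact ⟨g, mem_of_forall_eventually hcl hh (g := g) hf, hf⟩

variable [DecidableEq V] {H : Subgroup (T ≃g T)}

namespace IsLocallyAlternating

variable (hH : IsLocallyAlternating T H)
include hH

/-- The square of an element that fixes `reg T w z N` can be modified to fix the other side. -/
theorem exists_sq_one_side {w z : V} (h : T.Adj w z) {N : ℕ} (M : ℕ) {e : T ≃g T}
    (he : e ∈ fixing H (insert z (reg T w z N))) :
    ∃ k ∈ H, (∀ x ∈ reg T w z (N + 1), k x = e (e x)) ∧ ∀ x ∈ reg T z w M, k x = x := by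
  have hT := hH.isTree
  have hez : e z = z := he.2 z (Or.inl rfl)
  have hfin := outer_finite hT w z N
  have hq : ∀ y ∈ outer T w z N, ∃ q, T.Adj q y ∧ T.dist z y = T.dist z q + 1 := fun y hy =>
    exists_closer hT (by rintro rfl; have := hy.2; rw [SimpleGraph.dist_self] at this; omega)
  choose! q hqy hqd using hq
  have hchild : ∀ y ∈ outer T w z N, ∀ u ∈ ch T (q y) y, T.dist z u = N + 2 := by
    intro y hy u hu
    rw [dist_of_mem_ch hT (hqy y hy) (x := z) (by have := hqd y hy; omega) hu, hy.2]
  have heq : ∀ y ∈ outer T w z N, e (q y) = q y := fun y hy =>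
    fix_of_fix_of_dist hT hez (he.2 y (Or.inr (outer_subset_reg hy))) (hqy y hy)
      (by have := hqd y hy; omega)
  obtain ⟨m, hm, hm1, hm2⟩ := exists_patch (M := H) (D := insert z (reg T w z N) ∪ reg T z w M)
    hfin.toFinset (fun y => (ch T (q y) y : Set V)) (fun _ x => e (e x)) (by
      intro y hy x hx
      rw [hfin.mem_toFinset] at hy
      have h1 := heq y hy
      have h2 := he.2 y (Or.inr (outer_subset_reg hy))
      exact map_mem_ch_of_fix h1 h2 (map_mem_ch_of_fix h1 h2 hx)) (by
      intro y hy
      rw [hfin.mem_toFinset] at hy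
      have h1 := heq y hy
      have h2 := he.2 y (Or.inr (outer_subset_reg hy))
      have hyq := hqd y hy
      obtain ⟨hy1, hy2⟩ := hy
      -- The distance from z to the parent of y is N, so this radius covers all x with `T.dist z x ≤
      -- N + M + 4` that are not behind y. The correction at y disturbs neither the other children
      -- nor the far side.
      obtain ⟨k, hk, hke⟩ := (hH.full_reg (2 * N + M + 5) (q y) y (hqy y ⟨hy1, hy2⟩)).exists_sq
        (g := e) (fun x hx => map_mem_ch_of_fix h1 h2 hx)
      have aux : ∀ x, T.dist z x ≤ N + M + 4 → (T.dist x y < T.dist x (q y) →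
          T.dist z x = N + 1 + T.dist y x → k x = x) → k x = x := by
        intro x hx hx'
        rcases dist_lt_or_lt hT (hqy y ⟨hy1, hy2⟩) x with hs | hs
        · refine hk.2 x (Or.inr ⟨hs, ?_⟩)
          have := hT.connected.dist_triangle (u := x) (v := z) (w := q y)
          rw [SimpleGraph.dist_comm (u := x) (v := z)] at this
          omega
        · refine hx' hs ?_
          rw [dist_eq_add hT (hqy y ⟨hy1, hy2⟩) (w := z) (by omega) hs, hy2]
      refine ⟨k, hk.1, hke, ?_, ?_⟩
      · rintro x ((rfl | hx) | hx)
        · refine aux _ (by rw [SimpleGraph.dist_self]; omega) fun _ h => ?_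
          rw [SimpleGraph.dist_self] at h
          omega
        · have h3 := dist_eq_of_lt hT h hx.1
          have h4 := hx.2
          rw [SimpleGraph.dist_comm (v := z)] at h3
          refine aux x (by omega) fun _ h5 => ?_
          have h6 : T.dist y x = 0 := by omega
          rw [← hT.connected.dist_eq_zero_iff.mp h6]
          exact hk.2 y (Or.inl rfl)
        · have h3 := hx.2
          rw [SimpleGraph.dist_comm] at h3
          refine aux x (by omega) fun _ h5 => ?_
          have h6 := dist_eq_add hT h (w := y) (x := x) (by
            rw [SimpleGraph.dist_comm, SimpleGraph.dist_comm (u := y) (v := z)]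
            omega) hx.1
          rw [SimpleGraph.dist_comm (u := y) (v := z)] at h6
          omega
      · intro y' hy' hne x hx
        rw [hfin.mem_toFinset] at hy'
        have h3 := hchild y' hy' x hx
        refine aux x (by omega) fun _ h5 => ?_
        have h6 : T.dist y x = 1 := by omega
        exfalso
        refine hne (closer_unique hT (x := z) (mem_ch.mp hx).2
          (SimpleGraph.dist_eq_one_iff_adj.mp h6) ?_ ?_)
        · rw [h3, hy'.2]
        · rw [h3, hy2])
  refine ⟨m, hm, fun x hx => ?_, fun x hx => hm1 x (Or.inr hx)⟩
  by_cases hxN : T.dist x w ≤ N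
  · have h1 : x ∈ insert z (reg T w z N) := Or.inr ⟨hx.1, hxN⟩
    rw [hm1 x (Or.inl h1), he.2 x h1, he.2 x h1]
  · obtain ⟨hx1, hx2⟩ := hx
    have hx3 := dist_eq_of_lt hT h hx1
    obtain ⟨y, hyx, hy⟩ := exists_closer hT (x := z) (y := x) (by
      rintro rfl; rw [SimpleGraph.dist_self] at hx1; omega)
    rw [SimpleGraph.dist_comm (v := z)] at hx3
    have hyw : T.dist y w < T.dist y z := by
      rcases dist_lt_or_lt hT h y with h1 | h1
      · exact h1
      · have := (eq_of_adj_of_lt hT h hyx.symm hx1 h1).1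
        rw [this, SimpleGraph.dist_self] at hxN
        omega
    have hyw' := dist_eq_of_lt hT h hyw
    rw [SimpleGraph.dist_comm, SimpleGraph.dist_comm (u := y) (v := w)] at hyw'
    have hyo : y ∈ outer T w z N := ⟨by omega, by omega⟩
    refine hm2 y (by rwa [hfin.mem_toFinset]) x ?_
    exact mem_ch_of_dist (x := z) hyx (by have := hqd y hyo; omega) hy

/-- Up to a power of `4`, every element of an edge stabilizer splits into elements supported on the
two sides of the edge, as far as a ball can see. -/
theorem exists_split {w z : V} (h : T.Adj w z) {g : T ≃g T} (hg : g ∈ H) (hw : g w = w)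
    (hz : g z = z) (N : ℕ) :
    ∃ a ∈ H, (∀ x ∈ reg T w z N, a x = x) ∧ ∀ x ∈ reg T z w N, a x = (g ^ 4 ^ N) x := by
  have hT := hH.isTree
  induction N with
  | zero =>
    rw [reg_zero hT h, reg_zero hT h.symm]
    refine ⟨1, one_mem _, fun _ _ => rfl, ?_⟩
    rintro x rfl
    rw [pow_zero, pow_one, hz]
    rfl
  | succ N ih =>
    obtain ⟨a, ha, ha1, ha2⟩ := ih
    rw [pow_succ, pow_mul]
    have hgw : (g ^ 4 ^ N) w = w := by
      have : ∀ n : ℕ, (g ^ n) w = w := by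
        intro n
        induction n with
        | zero => rfl
        | succ n ih => rw [pow_succ, RelIso.mul_apply, hw, ih]
      exact this _
    have hgz : (g ^ 4 ^ N) z = z := by
      have : ∀ n : ℕ, (g ^ n) z = z := by
        intro n
        induction n with
        | zero => rfl
        | succ n ih => rw [pow_succ, RelIso.mul_apply, hz, ih]
      exact this _
    have hgH : g ^ 4 ^ N ∈ H := pow_mem hg _
    generalize g ^ 4 ^ N = g at *
    have haw : a w = w := ha1 w (self_mem_reg h N)
    have haz : a z = z := by rw [ha2 z (self_mem_reg h.symm N), hgz]
    obtain ⟨k, hk, hk1, hk2⟩ := hH.exists_sq_one_side h (N + 1) (e := a) ⟨ha, by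
      rintro x (rfl | hx)
      · exact haz
      · exact ha1 x hx⟩
    have hkw : k w = w := by rw [hk1 w (self_mem_reg h _), haw, haw]
    have hkz : k z = z := hk2 z (self_mem_reg h.symm _)
    -- Squaring and correcting by `k` makes the new element trivial one layer deeper on the side of
    -- w. The price is that it agrees with g² only up to radius N on the side of z.
    set a' := k⁻¹ * (a * a) with ha'
    have ha'H : a' ∈ H := mul_mem (inv_mem hk) (mul_mem ha ha)
    have ha'1 : ∀ x ∈ reg T w z (N + 1), a' x = x := by
      intro x hx
      rw [ha', RelIso.mul_apply, RelIso.mul_apply, ← hk1 x hx, RelIso.inv_apply_self]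
    have ha'2 : ∀ x ∈ reg T z w N, a' x = g (g x) := by
      intro x hx
      have h1 : g x ∈ reg T z w N := map_mem_reg_of_fix hT hgz hgw hx
      have h2 : g (g x) ∈ reg T z w N := map_mem_reg_of_fix hT hgz hgw h1
      rw [ha', RelIso.mul_apply, RelIso.mul_apply, ha2 x hx, ha2 _ h1]
      exact inv_fix (hk2 _ ⟨h2.1, h2.2.trans (Nat.le_succ N)⟩)
    have ha'w : a' w = w := ha'1 w (self_mem_reg h _)
    have ha'z : a' z = z := by rw [ha'2 z (self_mem_reg h.symm _), hgz, hgz]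
    set c := a'⁻¹ * (g * g) with hc
    have hcH : c ∈ H := mul_mem (inv_mem ha'H) (mul_mem hgH hgH)
    have hcw : c w = w := by
      rw [hc, RelIso.mul_apply, RelIso.mul_apply, hgw, hgw, inv_fix ha'w]
    have hc1 : ∀ x ∈ reg T z w N, c x = x := by
      intro x hx
      rw [hc, RelIso.mul_apply, RelIso.mul_apply, ← ha'2 x hx, RelIso.inv_apply_self]
    have hcz : c z = z := hc1 z (self_mem_reg h.symm _)
    obtain ⟨k', hk', hk'1, hk'2⟩ := hH.exists_sq_one_side h.symm (N + 1) (e := c) ⟨hcH, by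
      rintro x (rfl | hx)
      · exact hcw
      · exact hc1 x hx⟩
    have hg2 : g * g = a' * c := by rw [hc, mul_inv_cancel_left]
    -- The first two factors are trivial on the side of w; replacing c² by `k'` makes the product
    -- trivial there and keeps it equal to g⁴ on the side of z. Two squarings per layer account for
    -- 4^N.
    have hg4 : g ^ 4 = a' * (c * a' * c⁻¹) * (c * c) := by
      rw [show g ^ 4 = (g * g) * (g * g) by simp only [pow_succ, pow_zero, one_mul, mul_assoc], hg2]
      group
    refine ⟨a' * (c * a' * c⁻¹) * k', mul_mem (mul_mem ha'H (mul_mem (mul_mem hcH ha'H)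
      (inv_mem hcH))) hk', fun x hx => ?_, fun x hx => ?_⟩
    · simp only [RelIso.mul_apply]
      rw [hk'2 x hx, ha'1 _ (map_mem_reg_of_fix hT (inv_fix hcw) (inv_fix hcz) hx),
        RelIso.apply_inv_self, ha'1 x hx]
    · rw [hg4]
      simp only [RelIso.mul_apply]
      rw [hk'1 x hx]

/-- Start from any element g inducing the local 3-cycle. Splitting yields m equal to g on every
branch fixed at w, to g³ on the branch z₁, and to the identity on the branches z₂ and z₃. In g m⁻¹
this cancels the action on the fixed branches and the return map of the 3-cycle, as far as radius N.
-/
theorem exists_three_cycle_ball {w z₁ z₂ z₃ : V} (h₁ : T.Adj w z₁) (h₂ : T.Adj w z₂)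
    (h₃ : T.Adj w z₃) (h₁₂ : z₁ ≠ z₂) (h₁₃ : z₁ ≠ z₃) (h₂₃ : z₂ ≠ z₃) (N : ℕ) :
    ∃ r ∈ H, r w = w ∧ r z₁ = z₂ ∧ r z₂ = z₃ ∧ r z₃ = z₁ ∧
      (∀ x, T.dist x w ≤ N → T.dist x w < T.dist x z₁ → T.dist x w < T.dist x z₂ →
        T.dist x w < T.dist x z₃ → r x = x) ∧ ∀ x, T.dist x w ≤ N → r (r (r x)) = x := by
  have hT := hH.isTree
  have mem : ∀ {u}, u ∈ T.neighborFinset w ↔ T.Adj w u := fun {u} => T.mem_neighborFinset w u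
  obtain ⟨g₀, hg₀, e1, e2, e3, e4⟩ :=
    (hH.full w).exists_cyc (mem.mpr h₁) (mem.mpr h₂) (mem.mpr h₃) h₁₂ h₁₃ h₂₃
  have hg₀w : g₀ w = w := hg₀.2 w rfl
  have hother : ∀ z, T.Adj w z → z ≠ z₁ → z ≠ z₂ → z ≠ z₃ → g₀ z = z :=
    fun z hz => e4 z (mem.mpr hz)
  have hcube : ∀ z, T.Adj w z → (g₀ ^ 3) z = z := by
    intro z hz
    rw [show g₀ ^ 3 = g₀ * (g₀ * g₀) by simp only [pow_succ, pow_zero, one_mul, mul_assoc]]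
    simp only [RelIso.mul_apply]
    by_cases hz1 : z = z₁
    · rw [hz1, e1, e2, e3]
    by_cases hz2 : z = z₂
    · rw [hz2, e2, e3, e1]
    by_cases hz3 : z = z₃
    · rw [hz3, e3, e1, e2]
    have := hother z hz hz1 hz2 hz3
    rw [this, this, this]
  have fixpow : ∀ (f : T ≃g T) (x : V), f x = x → ∀ n : ℕ, (f ^ n) x = x := by
    intro f x hx n
    induction n with
    | zero => rfl
    | succ n ih => rw [pow_succ, RelIso.mul_apply, hx, ih]
  -- 4 is 1 modulo 3, so this power of `g₀` has the same local action at w as `g₀`.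
  obtain ⟨m₀, hm₀⟩ : ∃ m, 4 ^ (N + 1) = 3 * m + 1 := by
    have : 4 ^ (N + 1) % 3 = 1 := by
      rw [Nat.pow_mod]
      norm_num
    exact ⟨4 ^ (N + 1) / 3, by omega⟩
  have hloc : ∀ z, T.Adj w z → (g₀ ^ 4 ^ (N + 1)) z = g₀ z := by
    intro z hz
    rw [hm₀, pow_succ', RelIso.mul_apply, pow_mul, fixpow _ _ (hcube z hz)]
  have split : ∀ z, T.Adj w z → g₀ z = z → ∃ a ∈ H, (∀ x ∈ reg T w z (N + 1), a x = x) ∧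
      ∀ x ∈ reg T z w (N + 1), a x = (g₀ ^ 4 ^ (N + 1)) x :=
    fun z hz hgz => hH.exists_split hz hg₀.1 hg₀w hgz (N + 1)
  -- `g₀` moves z₁ but its cube fixes it, so the split is applied to the cube.
  obtain ⟨a₁, ha₁, ha₁1, ha₁2⟩ := hH.exists_split h₁ (pow_mem hg₀.1 3) (fixpow _ _ hg₀w 3)
    (hcube z₁ h₁) (N + 1)
  rw [← pow_mul, mul_comm, pow_mul] at ha₁2
  have hgw : (g₀ ^ 4 ^ (N + 1)) w = w := fixpow _ _ hg₀w _
  have hgH : g₀ ^ 4 ^ (N + 1) ∈ H := pow_mem hg₀.1 _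
  generalize g₀ ^ 4 ^ (N + 1) = g at *
  have g1 : g z₁ = z₂ := by rw [hloc _ h₁, e1]
  have g2 : g z₂ = z₃ := by rw [hloc _ h₂, e2]
  have g3 : g z₃ = z₁ := by rw [hloc _ h₃, e3]
  have hcube' : ∀ x, (g ^ 3) x = g (g (g x)) := fun x => by
    rw [show g ^ 3 = g * (g * g) by simp only [pow_succ, pow_zero, one_mul, mul_assoc]]
    rfl
  have hgg : ∀ z, T.Adj w z → z ≠ z₂ → z ≠ z₃ →
      (if z = z₁ then g ^ 3 else g) z = z ∧ (if z = z₁ then g ^ 3 else g) w = w := by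
    intro z hz hz2 hz3
    split_ifs with hz1
    · rw [hcube', hcube', hgw, hgw, hgw, hz1, g1, g2, g3]
      exact ⟨rfl, rfl⟩
    · rw [hloc z hz]
      exact ⟨hother z hz hz1 hz2 hz3, hgw⟩
  -- Other branches lie one step farther from w than from their own root, hence the radius N + 1 in
  -- the splits.
  have hsep : ∀ z z', T.Adj w z → T.Adj w z' → z' ≠ z → reg T z' w N ⊆ reg T w z (N + 1) := by
    intro z z' hz hz' hne x hx
    have h4 := dist_eq_of_lt hT hz'.symm hx.1
    exact ⟨lt_of_branch_ne hT hz'.symm hz.symm hne hx.1, by have := hx.2; omega⟩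
  have hmemY : ∀ {z}, z ∈ ((T.neighborFinset w).erase z₂).erase z₃ ↔
      z ≠ z₃ ∧ z ≠ z₂ ∧ T.Adj w z := by
    intro z
    rw [Finset.mem_erase, Finset.mem_erase, mem]
  obtain ⟨m, hm, hm1, hm2⟩ := exists_patch (M := H)
    (D := insert w (reg T z₂ w N ∪ reg T z₃ w N))
    (((T.neighborFinset w).erase z₂).erase z₃) (fun z => reg T z w N)
    (fun z x => (if z = z₁ then g ^ 3 else g) x) (by
      intro z hz x hx
      rw [hmemY] at hz
      have := hgg z hz.2.2 hz.2.1 hz.1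
      exact map_mem_reg_of_fix hT this.1 this.2 hx) (by
      intro z hz
      rw [hmemY] at hz
      obtain ⟨hz3, hz2, hwz⟩ := hz
      have : ∃ a ∈ H, (∀ x ∈ reg T w z (N + 1), a x = x) ∧
          ∀ x ∈ reg T z w (N + 1), a x = (if z = z₁ then g ^ 3 else g) x := by
        split_ifs with hz1
        · subst hz1
          exact ⟨a₁, ha₁, ha₁1, ha₁2⟩
        · exact split z hwz (hother z hwz hz1 hz2 hz3)
      obtain ⟨a, ha, ha1, ha2⟩ := this
      refine ⟨a, ha, fun x hx => ha2 x ⟨hx.1, hx.2.trans (Nat.le_succ N)⟩, ?_, ?_⟩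
      · rintro x (rfl | hx | hx)
        · exact ha1 x (self_mem_reg hwz _)
        · exact ha1 x (hsep z z₂ hwz h₂ hz2.symm hx)
        · exact ha1 x (hsep z z₃ hwz h₃ hz3.symm hx)
      · intro z' hz' hne x hx
        rw [hmemY] at hz'
        exact ha1 x (hsep z z' hwz hz'.2.2 hne hx))
  have hmw : m w = w := hm1 w (Or.inl rfl)
  have hmz₁ : ∀ x ∈ reg T z₁ w N, m x = g (g (g x)) := by
    intro x hx
    have := hm2 z₁ (hmemY.mpr ⟨h₁₃, h₁₂, h₁⟩) x hx
    rw [if_pos rfl, hcube'] at this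
    exact this
  have selfN : ∀ {z}, T.Adj w z → z ∈ reg T z w N := fun hz => self_mem_reg hz.symm N
  set r := g * m⁻¹ with hr
  have rw_ : r w = w := by rw [hr, RelIso.mul_apply, inv_fix hmw, hgw]
  have hr2 : ∀ x ∈ reg T z₂ w N, r x = g x := by
    intro x hx
    rw [hr, RelIso.mul_apply, inv_fix (hm1 x (Or.inr (Or.inl hx)))]
  have hr3 : ∀ x ∈ reg T z₃ w N, r x = g x := by
    intro x hx
    rw [hr, RelIso.mul_apply, inv_fix (hm1 x (Or.inr (Or.inr hx)))]
  have hr1 : ∀ x ∈ reg T z₁ w N, ∃ y ∈ reg T z₁ w N, g (g (g y)) = x ∧ r x = g y := by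
    intro x hx
    have h4 := hgg z₁ h₁ h₁₂ h₁₃
    rw [if_pos rfl] at h4
    have hy : (g ^ 3)⁻¹ x ∈ reg T z₁ w N :=
      map_mem_reg_of_fix hT (inv_fix h4.1) (inv_fix h4.2) hx
    have hy' : g (g (g ((g ^ 3)⁻¹ x))) = x := by
      rw [← hcube', RelIso.apply_inv_self]
    refine ⟨_, hy, hy', ?_⟩
    have := hmz₁ _ hy
    rw [hy'] at this
    rw [hr, RelIso.mul_apply]
    nth_rewrite 1 [← this]
    rw [RelIso.inv_apply_self]
  have mapg : ∀ {z z' x}, g z = z' → x ∈ reg T z w N → g x ∈ reg T z' w N := by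
    rintro z z' x rfl hx
    have := map_mem_reg hT g hx
    rwa [hgw] at this
  have cube1 : ∀ x ∈ reg T z₁ w N, r (r (r x)) = x := by
    intro x hx
    obtain ⟨y, hy, hyx, hry⟩ := hr1 x hx
    rw [hry, hr2 _ (mapg g1 hy), hr3 _ (mapg g2 (mapg g1 hy)), hyx]
  have r2 : r z₂ = z₃ := by rw [hr2 _ (selfN h₂), g2]
  have r3 : r z₃ = z₁ := by rw [hr3 _ (selfN h₃), g3]
  have r1 : r z₁ = z₂ := by
    have := cube1 z₁ (selfN h₁)
    obtain ⟨y, hy, hyx, hry⟩ := hr1 z₁ (selfN h₁)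
    rw [hry]
    rw [← g3, ← g2] at hyx
    exact g.injective (g.injective hyx)
  refine ⟨r, mul_mem hgH (inv_mem hm), rw_, r1, r2, r3, fun x hx n1 n2 n3 => ?_, fun x hx => ?_⟩
  · by_cases hxw : x = w
    · rw [hxw, rw_]
    obtain ⟨z, hz, hxz⟩ := exists_closer hT hxw
    have hzne : ∀ {z'}, T.dist x w < T.dist x z' → z ≠ z' := by
      rintro z' h4 rfl
      omega
    have hxr : x ∈ reg T z w N := ⟨by omega, by omega⟩
    have h5 := hloc z hz.symm
    rw [hother z hz.symm (hzne n1) (hzne n2) (hzne n3)] at h5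
    have hy : g⁻¹ x ∈ reg T z w N := map_mem_reg_of_fix hT (inv_fix h5) (inv_fix hgw) hxr
    have h6 := hm2 z (hmemY.mpr ⟨hzne n3, hzne n2, hz.symm⟩) _ hy
    rw [if_neg (hzne n1), RelIso.apply_inv_self] at h6
    rw [hr, RelIso.mul_apply]
    nth_rewrite 1 [← h6]
    rw [RelIso.inv_apply_self, RelIso.apply_inv_self]
  · by_cases hxw : x = w
    · rw [hxw, rw_, rw_, rw_]
    obtain ⟨z, hz, hxz⟩ := exists_closer hT hxw
    have hxr : x ∈ reg T z w N := ⟨by omega, by omega⟩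
    by_cases hz1 : z = z₁
    · exact cube1 x (hz1 ▸ hxr)
    by_cases hz2 : z = z₂
    · subst hz2
      rw [hr2 x hxr]
      have h4 := mapg g2 hxr
      rw [hr3 _ h4]
      obtain ⟨y, hy, hyx, hry⟩ := hr1 _ (mapg g3 h4)
      rw [hry]
      exact g.injective (g.injective hyx)
    by_cases hz3 : z = z₃
    · subst hz3
      rw [hr3 x hxr]
      obtain ⟨y, hy, hyx, hry⟩ := hr1 _ (mapg g3 hxr)
      rw [hry, hr2 _ (mapg g1 hy)]
      exact g.injective hyx
    have h5 := hloc z hz.symm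
    rw [hother z hz.symm hz1 hz2 hz3] at h5
    have hy : g⁻¹ x ∈ reg T z w N := map_mem_reg_of_fix hT (inv_fix h5) (inv_fix hgw) hxr
    have h6 := hm2 z (hmemY.mpr ⟨hz3, hz2, hz.symm⟩) _ hy
    rw [if_neg hz1, RelIso.apply_inv_self] at h6
    have h7 : r x = x := by
      rw [hr, RelIso.mul_apply]
      nth_rewrite 1 [← h6]
      rw [RelIso.inv_apply_self, RelIso.apply_inv_self]
    rw [h7, h7, h7]

/-- `H` contains rigid `3`-cycles of branches at any vertex. -/
theorem exists_three_cycle (hcl : @IsClosed _ (autTopology T) (H : Set (T ≃g T)))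
    {w z₁ z₂ z₃ : V} (h₁ : T.Adj w z₁) (h₂ : T.Adj w z₂)
    (h₃ : T.Adj w z₃) (h₁₂ : z₁ ≠ z₂) (h₁₃ : z₁ ≠ z₃) (h₂₃ : z₂ ≠ z₃) :
    ∃ r ∈ H, r w = w ∧ r z₁ = z₂ ∧ r z₂ = z₃ ∧ r z₃ = z₁ ∧
      (∀ x, T.dist x w < T.dist x z₁ → T.dist x w < T.dist x z₂ →
        T.dist x w < T.dist x z₃ → r x = x) ∧ ∀ x, r (r (r x)) = x := by
  have hT := hH.isTree
  choose r hrH hw e1 e2 e3 hfix hcube using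
    hH.exists_three_cycle_ball h₁ h₂ h₃ h₁₂ h₁₃ h₂₃
  -- The conditions at a given vertex hold for all N beyond its distance from w, so they pass to the
  -- limit.
  obtain ⟨g, hg, hlim⟩ := exists_limit hT hcl hrH hw
  have hge : ∀ n : ℕ, ∀ᶠ k in (Filter.hyperfilter ℕ : Filter ℕ), n ≤ k := fun n =>
    Nat.hyperfilter_le_atTop (Filter.eventually_ge_atTop n)
  refine ⟨g, hg, ?_, ?_, ?_, ?_, fun x n1 n2 n3 => ?_, fun x => ?_⟩
  · obtain ⟨n, hn⟩ := (hlim w).exists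
    rw [← hn, hw]
  · obtain ⟨n, hn⟩ := (hlim z₁).exists
    rw [← hn, e1]
  · obtain ⟨n, hn⟩ := (hlim z₂).exists
    rw [← hn, e2]
  · obtain ⟨n, hn⟩ := (hlim z₃).exists
    rw [← hn, e3]
  · obtain ⟨n, hn, hn'⟩ := ((hlim x).and (hge (T.dist x w))).exists
    rw [← hn, hfix n x hn' n1 n2 n3]
  · obtain ⟨n, ⟨⟨hn1, hn2⟩, hn3⟩, hn'⟩ :=
      ((((hlim x).and (hlim (g x))).and (hlim (g (g x)))).and (hge (T.dist x w))).exists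
    rw [← hn3, ← hn2, ← hn1, hcube n x hn']

end IsLocallyAlternating

end TreeAut

/-! ### Frames of rigid 3-cycles. -/

namespace TreeAut

set_option linter.unusedSectionVars false

variable {V : Type*} {T : SimpleGraph V} [T.LocallyFinite] [DecidableEq V] {H : Subgroup (T ≃g T)}

/-- A coherent family of rigid `3`-cycles `w ↦ c ↦ a ↦ w` of branches at `v`. -/
structure IsFrame (H : Subgroup (T ≃g T)) (v w c : V) (x : V → T ≃g T) : Prop where
  mem : ∀ a ∈ ch T w v, a ≠ c → x a ∈ H
  fix : ∀ a ∈ ch T w v, a ≠ c → x a v = v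
  map_base : ∀ a ∈ ch T w v, a ≠ c → x a w = c
  map_mid : ∀ a ∈ ch T w v, a ≠ c → x a c = a
  map_self : ∀ a ∈ ch T w v, a ≠ c → x a a = w
  fix_of_lt : ∀ a ∈ ch T w v, a ≠ c → ∀ y, T.dist y v < T.dist y w → T.dist y v < T.dist y c →
    T.dist y v < T.dist y a → x a y = y
  cube : ∀ a ∈ ch T w v, a ≠ c → ∀ y, x a (x a (x a y)) = y
  eq_of_lt : ∀ a ∈ ch T w v, a ≠ c → ∀ b ∈ ch T w v, b ≠ c → ∀ y, T.dist y w < T.dist y v →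
    x a y = x b y

theorem IsLocallyAlternating.exists_frame (hH : IsLocallyAlternating T H)
    (hcl : @IsClosed _ (autTopology T) (H : Set (T ≃g T))) {v w : V} (hw : T.Adj v w) :
    ∃ c ∈ ch T w v, ∃ x, IsFrame H v w c x := by
  have hT := hH.isTree
  have mem : ∀ {u}, u ∈ T.neighborFinset v ↔ T.Adj v u := fun {u} => T.mem_neighborFinset v u
  have hcard := hH.card v
  obtain ⟨c, hc, hc'⟩ := exists_not_mem_of_card_lt (X := T.neighborFinset v) {w}
    (by rw [Finset.card_singleton]; omega)
  obtain ⟨b, hb, hb'⟩ := exists_not_mem_of_card_lt (X := T.neighborFinset v) {w, c}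
    (lt_of_le_of_lt Finset.card_le_two (by omega))
  simp only [Finset.mem_insert, Finset.mem_singleton, not_or] at hc' hb'
  rw [mem] at hc hb
  -- The whole frame consists of conjugates of the single cycle b ↦ w ↦ c ↦ b.
  obtain ⟨r, hr, rv, r1, r2, r3, rfix, rcube⟩ :=
    hH.exists_three_cycle hcl hb hw hc hb'.1 hb'.2 (Ne.symm hc')
  -- The conjugators carry b to a but fix the branches at w and c pointwise, so all conjugates agree
  -- with `r` on the branch at w.
  have ht : ∀ a, ∃ t : T ≃g T, a ∈ ch T w v → a ≠ c → t ∈ H ∧ t v = v ∧ t b = a ∧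
      (∀ y, T.dist y w < T.dist y v → t y = y) ∧ ∀ y, T.dist y c < T.dist y v → t y = y := by
    intro a
    by_cases hab : a = b
    · exact ⟨1, fun _ _ => ⟨one_mem _, rfl, hab.symm, fun _ _ => rfl, fun _ _ => rfl⟩⟩
    by_cases ha : a ∈ ch T w v ∧ a ≠ c
    swap
    · exact ⟨1, fun h h' => absurd ⟨h, h'⟩ ha⟩
    obtain ⟨ha, hac⟩ := ha
    rw [mem_ch] at ha
    obtain ⟨b', hb'', hb'''⟩ := exists_not_mem_of_card_lt (X := T.neighborFinset v) {w, c, a, b}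
      (lt_of_le_of_lt Finset.card_le_four (by omega))
    simp only [Finset.mem_insert, Finset.mem_singleton, not_or] at hb'''
    rw [mem] at hb''
    obtain ⟨t, htH, tv, t1, t2, t3, tfix, -⟩ :=
      hH.exists_three_cycle hcl hb ha.2 hb'' (Ne.symm hab) (Ne.symm hb'''.2.2.2)
        (Ne.symm hb'''.2.2.1)
    refine ⟨t, fun _ _ => ⟨htH, tv, t1, fun y hy => ?_, fun y hy => ?_⟩⟩
    · exact tfix y (lt_of_branch_ne hT hw.symm hb.symm (Ne.symm hb'.1) hy)
        (lt_of_branch_ne hT hw.symm ha.2.symm (Ne.symm ha.1) hy)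
        (lt_of_branch_ne hT hw.symm hb''.symm (Ne.symm hb'''.1) hy)
    · exact tfix y (lt_of_branch_ne hT hc.symm hb.symm (Ne.symm hb'.2) hy)
        (lt_of_branch_ne hT hc.symm ha.2.symm (Ne.symm hac) hy)
        (lt_of_branch_ne hT hc.symm hb''.symm (Ne.symm hb'''.2.1) hy)
  choose t ht using ht
  have self_lt : ∀ {z}, T.Adj v z → T.dist z z < T.dist z v := fun {z} hz => by
    rw [SimpleGraph.dist_self, dist_of_adj hz.symm]; exact Nat.zero_lt_one
  refine ⟨c, mem_ch.mpr ⟨hc', hc⟩, fun a => t a * r * (t a)⁻¹, ?_⟩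
  have hbase : ∀ a ∈ ch T w v, a ≠ c → ∀ y, T.dist y w < T.dist y v →
      (t a * r * (t a)⁻¹) y = r y := by
    intro a ha hac y hy
    obtain ⟨htH, tv, tb, tw, tc⟩ := ht a ha hac
    have h1 : T.dist (r y) c < T.dist (r y) v := by
      have e1 := dist_map hT r y w
      have e2 := dist_map hT r y v
      rw [r2] at e1
      rw [rv] at e2
      omega
    rw [RelIso.mul_apply, RelIso.mul_apply, inv_fix (tw y hy), tc _ h1]
  constructor
  · intro a ha hac
    exact mul_mem (mul_mem (ht a ha hac).1 hr) (inv_mem (ht a ha hac).1)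
  · intro a ha hac
    obtain ⟨htH, tv, tb, tw, tc⟩ := ht a ha hac
    rw [RelIso.mul_apply, RelIso.mul_apply, inv_fix tv, rv, tv]
  · intro a ha hac
    rw [hbase a ha hac w (self_lt hw), r2]
  · intro a ha hac
    obtain ⟨htH, tv, tb, tw, tc⟩ := ht a ha hac
    rw [RelIso.mul_apply, RelIso.mul_apply, inv_fix (tc c (self_lt hc)), r3, tb]
  · intro a ha hac
    obtain ⟨htH, tv, tb, tw, tc⟩ := ht a ha hac
    have := RelIso.inv_apply_self (t a) b
    rw [tb] at this
    rw [RelIso.mul_apply, RelIso.mul_apply, this, r1, tw w (self_lt hw)]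
  · intro a ha hac y hyw hyc hya
    obtain ⟨htH, tv, tb, tw, tc⟩ := ht a ha hac
    have key : ∀ z, T.dist ((t a)⁻¹ y) z = T.dist y (t a z) := fun z => by
      rw [← dist_map hT (t a), RelIso.apply_inv_self]
    rw [RelIso.mul_apply, RelIso.mul_apply, rfix ((t a)⁻¹ y), RelIso.apply_inv_self]
    · rwa [key, key, tv, tb]
    · rwa [key, key, tv, tw w (self_lt hw)]
    · rwa [key, key, tv, tc c (self_lt hc)]
  · intro a ha hac y
    simp only [RelIso.mul_apply, RelIso.inv_apply_self]
    rw [rcube, RelIso.apply_inv_self]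
  · intro a ha hac b hb hbc y hy
    rw [hbase a ha hac y hy, hbase b hb hbc y hy]

end TreeAut

/-! ### A legal coloring adapted to prescribed maps of half-trees. -/

namespace TreeAut

set_option linter.unusedSectionVars false

/-- When k ≠ 1, a third color allows a 3-cycle in place of the odd transposition of 1 and k. The map
is defined on all of ℕ so that it composes with colors. -/
theorem exists_even_perm {n k : ℕ} (hn : 3 ≤ n) (hk : k ∈ Set.Icc 1 n) :
    ∃ κ : ℕ → ℕ, κ 1 = k ∧ Set.BijOn κ (Set.Icc 1 n) (Set.Icc 1 n) ∧
      ∀ π : Equiv.Perm (Set.Icc 1 n), (∀ a, (π a : ℕ) = κ a) → Equiv.Perm.sign π = 1 := by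
  by_cases hk1 : k = 1
  · refine ⟨id, hk1.symm, Set.bijOn_id _, fun π hπ => ?_⟩
    have : π = 1 := by
      ext a
      exact hπ a
    rw [this, map_one]
  obtain ⟨j, hj, hj1, hjk⟩ : ∃ j ∈ Set.Icc 1 n, j ≠ 1 ∧ j ≠ k := by
    by_cases h : k = 2
    · exact ⟨3, ⟨by omega, hn⟩, by omega, by omega⟩
    · exact ⟨2, ⟨by omega, by omega⟩, by omega, fun h' => h h'.symm⟩
  have h1 : (1 : ℕ) ∈ Set.Icc 1 n := ⟨le_rfl, by omega⟩
  let e₁ : Set.Icc 1 n := ⟨1, h1⟩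
  let e₂ : Set.Icc 1 n := ⟨k, hk⟩
  let e₃ : Set.Icc 1 n := ⟨j, hj⟩
  have h12 : e₁ ≠ e₂ := fun h => hk1 (congrArg Subtype.val h).symm
  have h13 : e₁ ≠ e₃ := fun h => hj1 (congrArg Subtype.val h).symm
  have h23 : e₂ ≠ e₃ := fun h => hjk (congrArg Subtype.val h).symm
  let ρ : Equiv.Perm (Set.Icc 1 n) := cyc e₁ e₂ e₃
  let κ : ℕ → ℕ := fun a => if h : a ∈ Set.Icc 1 n then ρ ⟨a, h⟩ else a
  have hκ : ∀ a (h : a ∈ Set.Icc 1 n), κ a = ρ ⟨a, h⟩ := fun a h => dif_pos h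
  refine ⟨κ, ?_, ⟨fun a ha => ?_, fun a ha b hb hab => ?_, fun a ha => ?_⟩, fun π hπ => ?_⟩
  · rw [hκ 1 h1]
    exact congrArg Subtype.val (cyc_left h12 h13)
  · rw [hκ a ha]
    exact (ρ _).2
  · rw [hκ a ha, hκ b hb] at hab
    exact congrArg Subtype.val (ρ.injective (Subtype.ext hab))
  · refine ⟨(ρ⁻¹ ⟨a, ha⟩ : Set.Icc 1 n), Subtype.property _, ?_⟩
    rw [hκ _ (Subtype.property _)]
    exact congrArg Subtype.val (perm_apply_inv_self ρ ⟨a, ha⟩)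
  · have : π = ρ := by
      ext a
      rw [hπ a, hκ a a.2]
    rw [this]
    exact (Equiv.Perm.mem_alternatingGroup).mp (cyc_mem_alternatingGroup h12 h23)

theorem exists_rec {α β : Type*} (μ : α → ℕ) (φ : α → α) (F : α → β → β) (c : β) (S : Set α)
    (h : ∀ u, u ∉ S → μ (φ u) < μ u) :
    ∃ f : α → β, (∀ u ∈ S, f u = c) ∧ ∀ u, u ∉ S → f u = F u (f (φ u)) := by
  classical
  have wf : WellFounded (fun a b : α => μ a < μ b) := (measure μ).wf
  let G : (u : α) → ((y : α) → μ y < μ u → β) → β := fun u r =>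
    if hu : u ∈ S then c else F u (r (φ u) (h u hu))
  refine ⟨wf.fix G, fun u hu => ?_, fun u hu => ?_⟩
  · rw [wf.fix_eq]
    exact dif_pos hu
  · rw [wf.fix_eq]
    exact dif_neg hu

theorem eq_of_ne_of_ne {a b c : Fin 2} (h : a ≠ b) (h' : c ≠ b) : a = c := by omega

theorem eq_one_sub_of_ne {a b : Fin 2} (h : a ≠ b) : a = 1 - b := by
  revert a b
  decide

variable {V : Type*} {T : SimpleGraph V} {τ : V → Fin 2} {d : Fin 2 → ℕ}

theorem LegalColoring.sign_sigma_congr (i : LegalColoring T τ d) (hT : IsSemiregularTree T τ d)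
    {g h : T ≃g T} {v : V} (hn : ∀ u, T.Adj v u → g u = h u) :
    Equiv.Perm.sign (i.sigma hT g v) = Equiv.Perm.sign (i.sigma hT h v) := by
  congr 1
  ext a
  change i.color (g ((i.sphereEquiv v).symm a)) = i.color (h ((i.sphereEquiv v).symm a))
  rw [hn _ ((i.sphereEquiv v).symm a).2]

theorem LegalColoring.sigma_apply (i : LegalColoring T τ d) (hT : IsSemiregularTree T τ d)
    (g : T ≃g T) {v u : V} (h : T.Adj v u) (a : Set.Icc 1 (d (τ v))) (ha : (a : ℕ) = i.color u) :
    (i.sigma hT g v a : ℕ) = i.color (g u) := by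
  have : a = i.sphereEquiv v ⟨u, h⟩ := Subtype.ext ha
  change i.color (g ((i.sphereEquiv v).symm a)) = _
  rw [this, Equiv.symm_apply_apply]

theorem LegalColoring.exists_color_eq (i : LegalColoring T τ d) (v : V)
    (a : Set.Icc 1 (d (τ v))) : ∃ u, T.Adj v u ∧ (a : ℕ) = i.color u := by
  obtain ⟨u, hu, h⟩ := (i.bijOn v).surjOn a.2
  exact ⟨u, hu, h.symm⟩

/-- The two orientations of the edge `{v, w}`. -/
def IsBase (v w p q : V) : Prop := (p = v ∧ q = w) ∨ (p = w ∧ q = v)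

variable [T.LocallyFinite] [DecidableEq V]

theorem IsBase.adj {v w p q : V} (hvw : T.Adj v w) (h : IsBase v w p q) : T.Adj p q := by
  rcases h with ⟨rfl, rfl⟩ | ⟨rfl, rfl⟩
  exacts [hvw, hvw.symm]

theorem IsBase.unique (hT : T.IsTree) {v w p q p' q' u z z' : V} (hvw : T.Adj v w)
    (h : IsBase v w p q) (h' : IsBase v w p' q') (hz : z ∈ ch T q p) (hz' : z' ∈ ch T q' p')
    (hu : T.dist u z < T.dist u p) (hu' : T.dist u z' < T.dist u p') : p' = p ∧ q' = q := by
  have h1 := lt_of_branch_ne hT (mem_ch.mp hz).2.symm (h.adj hvw).symm (mem_ch.mp hz).1 hu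
  have h2 := lt_of_branch_ne hT (mem_ch.mp hz').2.symm (h'.adj hvw).symm (mem_ch.mp hz').1 hu'
  rcases h with ⟨rfl, rfl⟩ | ⟨rfl, rfl⟩ <;> rcases h' with ⟨rfl, rfl⟩ | ⟨rfl, rfl⟩
  · exact ⟨rfl, rfl⟩
  · omega
  · omega
  · exact ⟨rfl, rfl⟩

theorem dist_self_lt {v z : V} (h : T.Adj v z) : T.dist z z < T.dist z v := by
  rw [SimpleGraph.dist_self, dist_of_adj h.symm]
  exact Nat.zero_lt_one

/-- A legal coloring that is compatible with automorphisms `P z` moving a half-tree of the edge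
`{v, w}` to the other branches at `v` and `w`. -/
theorem exists_coloring (hT : IsSemiregularTree T τ d) {v w : V} (hvw : T.Adj v w)
    (hd : ∀ t, 3 ≤ d t) (P : V → T ≃g T) (hτ : ∀ p q, IsBase v w p q → ∀ z ∈ ch T q p, P z ∈ autPlus T τ)
    (hP : ∀ p q, IsBase v w p q → ∀ z ∈ ch T q p, P z p = p ∧ P z q = z) :
    ∃ i : LegalColoring T τ d, ∀ p q, IsBase v w p q → ∀ z ∈ ch T q p, ∀ y,
      T.dist y q < T.dist y p → Equiv.Perm.sign (i.sigma hT (P z) y) = 1 := by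
  have hTr := hT.isTree
  have hadj : ∀ {p q}, IsBase v w p q → T.Adj p q := fun hb => hb.adj hvw
  have hch : ∀ {p q z}, z ∈ ch T q p → T.Adj p z := fun h => (mem_ch.mp h).2
  have hside : ∀ {p q z u}, IsBase v w p q → z ∈ ch T q p → T.dist u z < T.dist u p →
      T.dist u p < T.dist u q := fun {p q z u} hb hz hu =>
    lt_of_branch_ne hTr (hch hz).symm (hadj hb).symm (mem_ch.mp hz).1 hu
  -- the neighbours of each vertex can be numbered
  have hcol : ∀ p q, T.Adj p q → ∃ c : V → ℕ, c q = 1 ∧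
      Set.BijOn c (T.neighborSet p) (Set.Icc 1 (d (τ p))) := by
    intro p q hpq
    have h1 : (T.neighborSet p).encard = (Set.Icc 1 (d (τ p))).encard := by
      rw [hT.degree, Set.encard_eq_coe_toFinset_card, Set.toFinset_Icc, Nat.card_Icc,
        Nat.add_sub_cancel]
    have hfin : (T.neighborSet p).Finite := Set.toFinite _
    obtain ⟨c, hc⟩ := hfin.exists_bijOn_of_encard_eq h1
    have h1mem : (1 : ℕ) ∈ Set.Icc 1 (d (τ p)) := ⟨le_rfl, by have := hd (τ p); omega⟩
    refine ⟨fun u => Equiv.swap (c q) 1 (c u), Equiv.swap_apply_left _ _, ?_⟩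
    refine Set.BijOn.comp (g := Equiv.swap (c q) 1) (t := Set.Icc 1 (d (τ p))) ?_ hc
    have hswap : ∀ a ∈ Set.Icc 1 (d (τ p)), Equiv.swap (c q) 1 a ∈ Set.Icc 1 (d (τ p)) := by
      intro a ha
      rw [Equiv.swap_apply_def]
      split_ifs
      exacts [h1mem, hc.mapsTo hpq, ha]
    exact ⟨hswap, (Equiv.injective _).injOn, fun a ha =>
      ⟨_, hswap a ha, Equiv.swap_apply_self _ _ _⟩⟩
  have hκ : ∀ p q, IsBase v w p q → ∃ c : V → ℕ, c q = 1 ∧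
      Set.BijOn c (T.neighborSet p) (Set.Icc 1 (d (τ p))) := fun p q h => hcol p q (hadj h)
  choose! c hcq hc using hκ
  -- An even recoloring that takes the color 1 of q to the color prescribed for z among the
  -- neighbors of p.
  have hκ : ∀ z, ∃ κ : ℕ → ℕ, ∀ p q, IsBase v w p q → z ∈ ch T q p → κ 1 = c p q z ∧
      Set.BijOn κ (Set.Icc 1 (d (τ p))) (Set.Icc 1 (d (τ p))) ∧
      ∀ π : Equiv.Perm (Set.Icc 1 (d (τ p))), (∀ a, (π a : ℕ) = κ a) →
        Equiv.Perm.sign π = 1 := by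
    intro z
    by_cases h : ∃ p q, IsBase v w p q ∧ z ∈ ch T q p
    · obtain ⟨p, q, hb, hz⟩ := h
      obtain ⟨κ, h1, h2, h3⟩ := exists_even_perm (hd (τ p)) ((hc p q hb).mapsTo (hch hz))
      refine ⟨κ, fun p' q' hb' hz' => ?_⟩
      obtain ⟨rfl, rfl⟩ := hb.unique hTr hvw hb' hz hz' (dist_self_lt (hch hz))
        (dist_self_lt (hch hz'))
      exact ⟨h1, h2, h3⟩
    · exact ⟨id, fun p q hb hz => absurd ⟨p, q, hb, hz⟩ h⟩
  choose κ hκ using hκ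
  -- every vertex outside the edge lies in one of the branches
  have hbr : ∀ u, ∃ z, u ∉ ({v, w} : Set V) → ∃ p q, IsBase v w p q ∧ z ∈ ch T q p ∧
      T.dist u z < T.dist u p := by
    intro u
    by_cases hu : u ∈ ({v, w} : Set V)
    · exact ⟨u, fun h => absurd hu h⟩
    rw [Set.mem_insert_iff, Set.mem_singleton_iff, not_or] at hu
    obtain ⟨p, q, hb, hup, hlt⟩ : ∃ p q, IsBase v w p q ∧ u ≠ p ∧ T.dist u p < T.dist u q := by
      rcases dist_lt_or_lt hTr hvw u with h | h
      · exact ⟨v, w, Or.inl ⟨rfl, rfl⟩, hu.1, h⟩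
      · exact ⟨w, v, Or.inr ⟨rfl, rfl⟩, hu.2, h⟩
    obtain ⟨z, hz, hz'⟩ := exists_closer hTr hup
    refine ⟨z, fun _ => ⟨p, q, hb, mem_ch.mpr ⟨?_, hz.symm⟩, by omega⟩⟩
    rintro rfl
    omega
  choose br hbr using hbr
  have hbr_eq : ∀ {p q z u}, IsBase v w p q → z ∈ ch T q p → T.dist u z < T.dist u p →
      u ∉ ({v, w} : Set V) ∧ br u = z := by
    intro p q z u hb hz hu
    have hs := hside hb hz hu
    have hu' : u ∉ ({v, w} : Set V) := by
      rw [Set.mem_insert_iff, Set.mem_singleton_iff, not_or]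
      have h1 : u ≠ p := by
        rintro rfl
        rw [SimpleGraph.dist_self] at hu
        omega
      have h2 : u ≠ q := by
        rintro rfl
        rw [SimpleGraph.dist_self] at hs
        omega
      rcases hb with ⟨rfl, rfl⟩ | ⟨rfl, rfl⟩
      exacts [⟨h1, h2⟩, ⟨h2, h1⟩]
    refine ⟨hu', ?_⟩
    obtain ⟨p', q', hb', hz', hu''⟩ := hbr u hu'
    obtain ⟨rfl, rfl⟩ := hb.unique hTr hvw hb' hz hz' hu hu''
    exact closer_unique hTr (hch hz').symm (hch hz).symm (dist_eq_of_lt hTr (hch hz').symm hu'')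
      (dist_eq_of_lt hTr (hch hz).symm hu)
  -- the retraction of a branch decreases the distance to the edge
  let μ : V → ℕ := fun u => min (T.dist u v) (T.dist u w)
  have hμ : ∀ {p q z u}, IsBase v w p q → z ∈ ch T q p → T.dist u z < T.dist u p →
      μ ((P z)⁻¹ u) < μ u := by
    intro p q z u hb hz hu
    have hs := hside hb hz hu
    have h1 := dist_eq_of_lt hTr (hch hz).symm hu
    have h2 : T.dist ((P z)⁻¹ u) q = T.dist u z := by
      rw [← dist_map hTr (P z), RelIso.apply_inv_self, (hP p q hb z hz).2]
    rcases hb with ⟨rfl, rfl⟩ | ⟨rfl, rfl⟩ <;> simp only [μ] <;> omega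
  -- The color is pulled back from the opposite half-tree by the map attached to the branch, and
  -- twisted only on vertices of the type of the root of the branch. Both ends of the base edge get
  -- color 1.
  obtain ⟨f, hf1, hf⟩ := exists_rec μ (fun u => (P (br u))⁻¹ u)
    (fun u a => if τ u = τ (br u) then κ (br u) a else a) 1 {v, w} (by
      intro u hu
      obtain ⟨p, q, hb, hz, hu'⟩ := hbr u hu
      exact hμ hb hz hu')
  have hbase : ∀ {p q}, IsBase v w p q → f p = 1 ∧ f q = 1 := by
    rintro p q (⟨rfl, rfl⟩ | ⟨rfl, rfl⟩)
    exacts [⟨hf1 _ (Or.inl rfl), hf1 _ (Or.inr rfl)⟩, ⟨hf1 _ (Or.inr rfl), hf1 _ (Or.inl rfl)⟩]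
  -- The case y = p is needed because p is a neighbor of q, so it enters the local action at q. It
  -- has the other type than z, so no twist is applied.
  have hstep : ∀ {p q z y}, IsBase v w p q → z ∈ ch T q p → T.dist y q < T.dist y p ∨ y = p →
      f (P z y) = if τ y = τ z then κ z (f y) else f y := by
    intro p q z y hb hz hy
    obtain ⟨e1, e2⟩ := hP p q hb z hz
    rcases hy with hy | rfl
    · have hy' : T.dist (P z y) z < T.dist (P z y) p := by
        have h1 := dist_map hTr (P z) y p
        have h2 := dist_map hTr (P z) y q
        rw [e1] at h1
        rw [e2] at h2
        omega
      obtain ⟨h1, h2⟩ := hbr_eq hb hz hy'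
      rw [hf _ h1, h2, RelIso.inv_apply_self, hτ p q hb z hz y]
    · rw [if_neg (hT.type_ne (hch hz)), e1]
  have hnbr : ∀ {p q y u}, IsBase v w p q → T.dist y q < T.dist y p → T.Adj y u →
      T.dist u q < T.dist u p ∨ u = p := by
    intro p q y u hb hy hu
    rcases dist_lt_or_lt hTr (hadj hb) u with h | h
    · exact Or.inr (eq_of_adj_of_lt hTr (hadj hb) hu.symm h hy).1
    · exact Or.inl h
  have hbij : ∀ n y, μ y = n → Set.BijOn f (T.neighborSet y) (Set.Icc 1 (d (τ y))) := by
    intro n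
    induction n using Nat.strong_induction_on with
    | _ n ih =>
      intro y hy
      by_cases hyvw : y ∈ ({v, w} : Set V)
      · obtain ⟨q, hb⟩ : ∃ q, IsBase v w y q := by
          rcases hyvw with rfl | rfl
          · exact ⟨w, Or.inl ⟨rfl, rfl⟩⟩
          · exact ⟨v, Or.inr ⟨rfl, rfl⟩⟩
        refine (hc y q hb).congr fun u hu => ?_
        by_cases huq : u = q
        · rw [huq, hcq y q hb, (hbase hb).2]
        · have hz : u ∈ ch T q y := mem_ch.mpr ⟨huq, hu⟩
          have h := hstep hb hz (y := q) (Or.inl (dist_self_lt (hadj hb)))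
          rw [(hP y q hb u hz).2, if_pos (eq_of_ne_of_ne (hT.type_ne (hadj hb).symm)
            (hT.type_ne (SimpleGraph.Adj.symm hu))), (hbase hb).2, (hκ u y q hb hz).1] at h
          exact h.symm
      · obtain ⟨p, q, hb, hz, hu⟩ := hbr y hyvw
        generalize br y = z at hz hu
        obtain ⟨e1, e2⟩ := hP p q hb z hz
        have hy' := ih _ (hy ▸ hμ hb hz hu) ((P z)⁻¹ y) rfl
        obtain ⟨y', rfl⟩ : ∃ y', y = P z y' := ⟨(P z)⁻¹ y, (RelIso.apply_inv_self _ _).symm⟩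
        rw [RelIso.inv_apply_self] at hy'
        have hlt : T.dist y' q < T.dist y' p := by
          have h1 := dist_map hTr (P z) y' p
          have h2 := dist_map hTr (P z) y' q
          rw [e1] at h1
          rw [e2] at h2
          omega
        have hcomp : Set.BijOn (fun u => f (P z u)) (T.neighborSet y') (Set.Icc 1 (d (τ y'))) := by
          by_cases hyz : τ y' = τ z
          · refine hy'.congr fun u hu => ?_
            rw [hstep hb hz (hnbr hb hlt hu), if_neg]
            rw [← hyz]
            exact (hT.type_ne hu).symm
          · have hyp : τ y' = τ p := eq_of_ne_of_ne hyz (hT.type_ne (hch hz))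
            have h2 := (hκ z p q hb hz).2.1
            rw [← hyp] at h2
            refine (h2.comp hy').congr fun u hu => ?_
            rw [hstep hb hz (hnbr hb hlt hu), if_pos]
            · rfl
            · exact eq_of_ne_of_ne (hT.type_ne hu).symm (Ne.symm hyz)
        rw [hτ p q hb z hz y']
        refine ⟨fun u hu => ?_, fun u hu u' hu' he => ?_, fun a ha => ?_⟩
        · obtain ⟨u, rfl⟩ : ∃ u', u = P z u' := ⟨(P z)⁻¹ u, (RelIso.apply_inv_self _ _).symm⟩
          exact hcomp.mapsTo ((P z).map_adj_iff.mp hu)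
        · obtain ⟨u, rfl⟩ : ∃ u', u = P z u' := ⟨(P z)⁻¹ u, (RelIso.apply_inv_self _ _).symm⟩
          obtain ⟨u', rfl⟩ : ∃ u'', u' = P z u'' := ⟨(P z)⁻¹ u', (RelIso.apply_inv_self _ _).symm⟩
          rw [hcomp.injOn ((P z).map_adj_iff.mp hu) ((P z).map_adj_iff.mp hu') he]
        · obtain ⟨u, hu, rfl⟩ := hcomp.surjOn ha
          exact ⟨P z u, (P z).map_adj_iff.mpr hu, rfl⟩
  refine ⟨⟨f, fun y => ?_, fun y => hbij _ y rfl⟩, fun p q hb z hz y hy => ?_⟩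
  · obtain ⟨u, hu⟩ : ∃ u, T.Adj y u := by
      by_cases h : y = v
      · exact ⟨w, h ▸ hvw⟩
      · obtain ⟨u, hu, -⟩ := exists_closer hTr (Ne.symm h)
        exact ⟨u, hu.symm⟩
    rw [← eq_one_sub_of_ne (hT.type_ne hu.symm)]
    exact (hbij _ u rfl).mapsTo hu.symm
  · generalize hi : (⟨f, _, _⟩ : LegalColoring T τ d) = i
    have hcolor : ∀ u, i.color u = f u := fun u => by rw [← hi]
    have hσ : ∀ a : Set.Icc 1 (d (τ y)), ∃ u, T.Adj y u ∧ (a : ℕ) = f u ∧ (i.sigma hT (P z) y a : ℕ) =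
        if τ u = τ z then κ z (f u) else f u := by
      intro a
      obtain ⟨u, hu, ha⟩ := i.exists_color_eq y a
      refine ⟨u, hu, by rw [ha, hcolor], ?_⟩
      rw [i.sigma_apply hT (P z) hu a ha, hcolor, hstep hb hz (hnbr hb hy hu)]
    generalize i.sigma hT (P z) y = π at hσ
    -- The neighbors of y all have the other type, so the local action at y is either the identity
    -- or the even permutation κ z.
    by_cases hyz : τ y = τ z
    · have : π = 1 := by
        ext a
        obtain ⟨u, hu, ha, e⟩ := hσ a
        rw [e, if_neg (by rw [← hyz]; exact (hT.type_ne hu).symm), ← ha]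
        rfl
      rw [this, map_one]
    · have hyp : τ y = τ p := eq_of_ne_of_ne hyz (hT.type_ne (hch hz))
      have h3 := (hκ z p q hb hz).2.2
      rw [← hyp] at h3
      refine h3 π fun a => ?_
      obtain ⟨u, hu, ha, e⟩ := hσ a
      rw [e, if_pos (eq_of_ne_of_ne (hT.type_ne hu).symm (Ne.symm hyz)), ha]

end TreeAut

/-! ### Frames with even local actions. -/

namespace TreeAut

set_option linter.unusedSectionVars false

variable {V : Type*} {T : SimpleGraph V} {τ : V → Fin 2} {d : Fin 2 → ℕ}
variable [T.LocallyFinite] [DecidableEq V] {H : Subgroup (T ≃g T)}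

/-- If `g` is a rigid `3`-cycle of the branches `q`, `c`, `a` at `p`, and `g` and `g²` have even local
actions on the branch `q`, then `g` has even local actions everywhere. -/
theorem LegalColoring.sign_sigma_eq_one_of_cycle (i : LegalColoring T τ d)
    (hT : IsSemiregularTree T τ d) {p q c a : V} {g : T ≃g T} (gp : g p = p) (gq : g q = c)
    (gc : g c = a) (hq : T.Adj q p) (hc : T.Adj c p) (ha : T.Adj a p)
    (hfix : ∀ y, T.dist y p < T.dist y q → T.dist y p < T.dist y c → T.dist y p < T.dist y a →
      g y = y) (hcube : ∀ y, g (g (g y)) = y)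
    (h1 : ∀ y, T.dist y q < T.dist y p → Equiv.Perm.sign (i.sigma hT g y) = 1)
    (h2 : ∀ y, T.dist y q < T.dist y p → Equiv.Perm.sign (i.sigma hT (g * g) y) = 1) (y : V) :
    Equiv.Perm.sign (i.sigma hT g y) = 1 := by
  have hTr := hT.isTree
  have hg3 : g * (g * g) = 1 := RelIso.ext hcube
  have back : ∀ {s : V} y, T.dist (g y) (g s) < T.dist (g y) p → T.dist y s < T.dist y p := by
    intro s y h
    have e := dist_map hTr g y p
    rw [gp] at e
    rwa [dist_map hTr, e] at h
  rcases dist_lt_or_lt hTr hq y with hy | hy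
  · exact h1 y hy
  rcases dist_lt_or_lt hTr hc y with hy' | hy'
  -- On the branches c and a the sign follows from the cocycle identity for g · g and for g · g² =
  -- 1, read on the branch q.
  · obtain ⟨y, rfl⟩ : ∃ z, y = g z := ⟨g⁻¹ y, (RelIso.apply_inv_self _ _).symm⟩
    rw [← gq] at hy'
    have h := back y hy'
    have e := i.sign_sigma_mul hT g g y
    rw [h2 y h, h1 y h, mul_one] at e
    exact e.symm
  rcases dist_lt_or_lt hTr ha y with hy'' | hy''
  · obtain ⟨y, rfl⟩ : ∃ z, y = g z := ⟨g⁻¹ y, (RelIso.apply_inv_self _ _).symm⟩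
    obtain ⟨y, rfl⟩ : ∃ z, y = g z := ⟨g⁻¹ y, (RelIso.apply_inv_self _ _).symm⟩
    rw [← gc] at hy''
    have h := back _ hy''
    rw [← gq] at h
    have h := back _ h
    have e := i.sign_sigma_mul hT g (g * g) y
    rw [hg3, i.sigma_one, map_one, h2 y h, mul_one] at e
    exact e.symm
  -- At a fixed vertex the cube of the sign is 1, hence the sign is 1.
  · have hy3 := hfix y hy hy' hy''
    have e := i.sign_sigma_mul hT g (g * g) y
    have e' := i.sign_sigma_mul hT g g y
    rw [hy3] at e'
    rw [hg3, i.sigma_one, map_one, e', RelIso.mul_apply, hy3, hy3, Int.units_mul_self,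
      mul_one] at e
    exact e.symm

/-- There is a legal coloring such that `H ∩ Alt_(i)(T)⁺` contains frames at both ends of an edge. -/
theorem IsLocallyAlternating.exists_coloring_frame (hH : IsLocallyAlternating T H)
    (hcl : @IsClosed _ (autTopology T) (H : Set (T ≃g T))) (hT : IsSemiregularTree T τ d)
    (hd : ∀ t, 3 ≤ d t) (hτ : H ≤ autPlus T τ) {v w : V} (hvw : T.Adj v w) :
    ∃ i : LegalColoring T τ d, ∀ p q, IsBase v w p q →
      ∃ c ∈ ch T q p, ∃ x, IsFrame (H ⊓ i.altPlus hT) p q c x := by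
  have hTr := hT.isTree
  have hfr : ∀ p q, IsBase v w p q → ∃ c, c ∈ ch T q p ∧ ∃ x, IsFrame H p q c x :=
    fun p q hb => hH.exists_frame hcl (hb.adj hvw)
  choose! c hc x hx using hfr
  -- The half-tree of q is carried to the branch c by any element of the frame, as all agree there,
  -- and to another branch z by the square of `x p q z`. The coloring thus controls g and g² on that
  -- half-tree.
  have hP : ∀ z, ∃ P : T ≃g T, ∀ p q, IsBase v w p q → z ∈ ch T q p → P ∈ H ∧ P p = p ∧ P q = z ∧
      (z = c p q → ∃ a ∈ ch T q p, a ≠ c p q ∧ P = x p q a) ∧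
      (z ≠ c p q → P = x p q z * x p q z) := by
    intro z
    by_cases h : ∃ p q, IsBase v w p q ∧ z ∈ ch T q p
    swap
    · exact ⟨1, fun p q hb hz => absurd ⟨p, q, hb, hz⟩ h⟩
    obtain ⟨p, q, hb, hz⟩ := h
    obtain ⟨P, hP⟩ : ∃ P : T ≃g T, P ∈ H ∧ P p = p ∧ P q = z ∧
        (z = c p q → ∃ a ∈ ch T q p, a ≠ c p q ∧ P = x p q a) ∧
        (z ≠ c p q → P = x p q z * x p q z) := by
      have hF := hx p q hb
      by_cases hzc : z = c p q
      · obtain ⟨a, ha, hac⟩ := exists_not_mem_of_card_lt (X := T.neighborFinset p) {q, c p q}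
          (lt_of_le_of_lt Finset.card_le_two (by have := hH.card p; omega))
        simp only [Finset.mem_insert, Finset.mem_singleton, not_or] at hac
        have ha' : a ∈ ch T q p := mem_ch.mpr ⟨hac.1, (T.mem_neighborFinset p a).mp ha⟩
        exact ⟨x p q a, hF.mem a ha' hac.2, hF.fix a ha' hac.2,
          (hF.map_base a ha' hac.2).trans hzc.symm, fun _ => ⟨a, ha', hac.2, rfl⟩,
          fun h => absurd hzc h⟩
      · refine ⟨x p q z * x p q z, mul_mem (hF.mem z hz hzc) (hF.mem z hz hzc), ?_, ?_,
          fun h => absurd h hzc, fun _ => rfl⟩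
        · rw [RelIso.mul_apply, hF.fix z hz hzc, hF.fix z hz hzc]
        · rw [RelIso.mul_apply, hF.map_base z hz hzc, hF.map_mid z hz hzc]
    refine ⟨P, fun p' q' hb' hz' => ?_⟩
    obtain ⟨rfl, rfl⟩ := hb.unique hTr hvw hb' hz hz' (dist_self_lt (mem_ch.mp hz).2)
      (dist_self_lt (mem_ch.mp hz').2)
    exact hP
  choose P hP using hP
  obtain ⟨i, hi⟩ := exists_coloring hT hvw hd P (fun p q hb z hz => hτ (hP z p q hb hz).1)
    (fun p q hb z hz => ⟨(hP z p q hb hz).2.1, (hP z p q hb hz).2.2.1⟩)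
  refine ⟨i, fun p q hb => ⟨c p q, hc p q hb, x p q, ?_⟩⟩
  have hF := hx p q hb
  refine ⟨fun a ha hac => ⟨hF.mem a ha hac, hτ (hF.mem a ha hac), ?_⟩, hF.fix, hF.map_base,
    hF.map_mid, hF.map_self, hF.fix_of_lt, hF.cube, hF.eq_of_lt⟩
  refine i.sign_sigma_eq_one_of_cycle hT (hF.fix a ha hac) (hF.map_base a ha hac)
    (hF.map_mid a ha hac) (hb.adj hvw).symm (mem_ch.mp (hc p q hb)).2.symm (mem_ch.mp ha).2.symm
    (hF.fix_of_lt a ha hac) (hF.cube a ha hac) (fun y hy => ?_) (fun y hy => ?_)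
  · obtain ⟨a', ha', hac', e⟩ := (hP (c p q) p q hb (hc p q hb)).2.2.2.1 rfl
    rw [← hi p q hb _ (hc p q hb) y hy, e]
    refine i.sign_sigma_congr hT fun u hu => ?_
    rcases dist_lt_or_lt hTr (hb.adj hvw) u with h | h
    · rw [(eq_of_adj_of_lt hTr (hb.adj hvw) hu.symm h hy).1, hF.fix a ha hac, hF.fix a' ha' hac']
    · exact hF.eq_of_lt a ha hac a' ha' hac' u h
  · rw [← (hP a p q hb ha).2.2.2.2 hac]
    exact hi p q hb a ha y hy

end TreeAut

/-! ### Density of the group with even frames in the alternating group of the coloring. -/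

namespace TreeAut

set_option linter.unusedSectionVars false

variable {V : Type*} {T : SimpleGraph V} [T.LocallyFinite] [DecidableEq V]

theorem IsFrame.full {M : Subgroup (T ≃g T)} {v w c : V} {x : V → T ≃g T} (hT : T.IsTree)
    (hvw : T.Adj v w) (hc : c ∈ ch T w v) (h : IsFrame M v w c x) :
    Full (fixing M {v}) (T.neighborFinset v) := by
  have mem : ∀ {u}, u ∈ T.neighborFinset v ↔ T.Adj v u := fun {u} => T.mem_neighborFinset v u
  rw [mem_ch] at hc
  refine full_of_cyc_two (mem.mpr hvw) (mem.mpr hc.2) (Ne.symm hc.1) fun a ha haw hac => ?_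
  rw [mem] at ha
  have ha' : a ∈ ch T w v := mem_ch.mpr ⟨haw, ha⟩
  refine ⟨x a, ⟨h.mem a ha' hac, ?_⟩, h.map_base a ha' hac, h.map_mid a ha' hac,
    h.map_self a ha' hac, fun y hy hyw hyc hya => ?_⟩
  · rintro _ rfl
    exact h.fix a ha' hac
  · rw [mem] at hy
    have hyv := dist_self_lt hy
    exact h.fix_of_lt a ha' hac y (lt_of_branch_ne hT hy.symm hvw.symm hyw hyv)
      (lt_of_branch_ne hT hy.symm hc.2.symm hyc hyv) (lt_of_branch_ne hT hy.symm ha.symm hya hyv)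

/-- Elements of the frame agree on the branch w, so the quotient of two of them is trivial on that
whole half-tree, while it induces the 3-cycle c ↦ b ↦ a ↦ c at v. -/
theorem IsFrame.full_branch {M : Subgroup (T ≃g T)} {v w c : V} {x : V → T ≃g T} (hT : T.IsTree)
    (hvw : T.Adj v w) (hc : c ∈ ch T w v) (h : IsFrame M v w c x) :
    Full (fixing M {u | T.dist u w < T.dist u v}) (ch T w v) := by
  refine full_of_cyc hc fun b hb a ha hbc hac hba => ?_
  have key : ∀ {u}, u ∈ ch T w v → u ≠ c → ∀ y ∈ ch T w v, y ≠ c → y ≠ u → x u y = y := by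
    intro u hu huc y hy hyc hyu
    have hyv := dist_self_lt (mem_ch.mp hy).2
    exact h.fix_of_lt u hu huc y
      (lt_of_branch_ne hT (mem_ch.mp hy).2.symm hvw.symm (mem_ch.mp hy).1 hyv)
      (lt_of_branch_ne hT (mem_ch.mp hy).2.symm (mem_ch.mp hc).2.symm hyc hyv)
      (lt_of_branch_ne hT (mem_ch.mp hy).2.symm (mem_ch.mp hu).2.symm hyu hyv)
  refine ⟨(x a)⁻¹ * x b, ⟨mul_mem (inv_mem (h.mem a ha hac)) (h.mem b hb hbc), fun y hy => ?_⟩,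
    ?_, ?_, ?_, fun y hy hyc hyb hya => ?_⟩
  · rw [RelIso.mul_apply, h.eq_of_lt b hb hbc a ha hac y hy, RelIso.inv_apply_self]
  · rw [RelIso.mul_apply, h.map_mid b hb hbc, inv_fix (key ha hac b hb hbc hba)]
  · rw [RelIso.mul_apply, h.map_self b hb hbc]
    nth_rewrite 1 [← h.map_self a ha hac]
    rw [RelIso.inv_apply_self]
  · rw [RelIso.mul_apply, key hb hbc a ha hac (Ne.symm hba)]
    nth_rewrite 2 [← h.map_mid a ha hac]
    rw [RelIso.inv_apply_self]
  · rw [RelIso.mul_apply, key hb hbc y hy hyc hyb, inv_fix (key ha hac y hy hyc hya)]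

section Frames

variable {M : Subgroup (T ≃g T)} {v w : V}

theorem exists_map_edge_of_frame (hT : T.IsTree) (hcard : ∀ v, 6 ≤ (T.neighborFinset v).card)
    (hvw : T.Adj v w) (hM : ∀ p q, IsBase v w p q → ∃ c ∈ ch T q p, ∃ x, IsFrame M p q c x)
    {a b : V} (hab : T.Adj a b) : ∃ m ∈ M, (m v = a ∧ m w = b) ∨ (m v = b ∧ m w = a) := by
  have key : ∀ p q, IsBase v w p q → ∀ u, T.Adj p u → ∃ m ∈ M, m p = p ∧ m q = u := by
    intro p q hb u hu
    obtain ⟨c, hc, x, hx⟩ := hM p q hb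
    have hpq := hb.adj hvw
    obtain ⟨m, hm, e⟩ := (hx.full hT hpq hc).exists_apply_eq (by have := hcard p; omega)
      ((T.mem_neighborFinset p q).mpr hpq) ((T.mem_neighborFinset p u).mpr hu)
    exact ⟨m, hm.1, hm.2 p rfl, e⟩
  exact exists_map_edge hT (key v w (Or.inl ⟨rfl, rfl⟩)) (key w v (Or.inr ⟨rfl, rfl⟩)) hab

theorem full_branch_of_frame (hT : T.IsTree) (hcard : ∀ v, 6 ≤ (T.neighborFinset v).card)
    (hvw : T.Adj v w) (hM : ∀ p q, IsBase v w p q → ∃ c ∈ ch T q p, ∃ x, IsFrame M p q c x)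
    {p y : V} (hpy : T.Adj p y) :
    Full (fixing M {u | T.dist u p < T.dist u y}) (ch T p y) := by
  -- An element that carries the base edge to {p, y}, in whichever orientation, transports the frame
  -- at the matching end.
  obtain ⟨a, b, hb, m, hm, rfl, rfl⟩ : ∃ a b, IsBase v w b a ∧ ∃ m ∈ M, m a = p ∧ m b = y := by
    obtain ⟨m, hm, ⟨h1, h2⟩ | ⟨h1, h2⟩⟩ := exists_map_edge_of_frame hT hcard hvw hM hpy
    · exact ⟨v, w, Or.inr ⟨rfl, rfl⟩, m, hm, h1, h2⟩
    · exact ⟨w, v, Or.inl ⟨rfl, rfl⟩, m, hm, h2, h1⟩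
  obtain ⟨c, hc, x, hx⟩ := hM b a hb
  refine (hx.full_branch hT (hb.adj hvw) hc).conj (m := m) (fun u hu => ?_) fun g hg => ?_
  · have := map_mem_ch m⁻¹ hu
    rwa [RelIso.inv_apply_self, RelIso.inv_apply_self] at this
  · refine ⟨mul_mem (mul_mem hm hg.1) (inv_mem hm), fun u hu => ?_⟩
    obtain ⟨u, rfl⟩ : ∃ u', u = m u' := ⟨m⁻¹ u, (RelIso.apply_inv_self _ _).symm⟩
    rw [Set.mem_ofPred_eq, dist_map hT, dist_map hT] at hu
    rw [RelIso.mul_apply, RelIso.mul_apply, RelIso.inv_apply_self, hg.2 u hu]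

end Frames

variable {τ : V → Fin 2} {d : Fin 2 → ℕ}

/-- Extending a permutation by fixed points does not change its sign. So the evenness of the local
action gives evenness on the moved neighbors, which is what a full group can realize. -/
theorem LegalColoring.sign_eq_sign_sigma (i : LegalColoring T τ d) (hT : IsSemiregularTree T τ d)
    {g : T ≃g T} {v : V} {X : Finset V} (hX : ∀ u ∈ X, T.Adj v u)
    (hfix : ∀ u, T.Adj v u → u ∉ X → g u = u) {π : Equiv.Perm X} (hπ : ∀ x : X, g x = π x) :
    Equiv.Perm.sign π = Equiv.Perm.sign (i.sigma hT g v) := by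
  classical
  let p : Set.Icc 1 (d (τ v)) → Prop := fun a => ∃ u ∈ X, (a : ℕ) = i.color u
  let f : X ≃ Subtype p := Equiv.ofBijective
    (fun u => ⟨i.sphereEquiv v ⟨u, hX u u.2⟩, u, u.2, rfl⟩) (by
      refine ⟨fun u u' h => ?_, fun a => ?_⟩
      · have := congrArg (fun z : Subtype p => z.1) h
        exact Subtype.ext (Subtype.mk.inj ((i.sphereEquiv v).injective this))
      · obtain ⟨u, hu, h⟩ := a.2
        exact ⟨⟨u, hu⟩, Subtype.ext (Subtype.ext h.symm)⟩)
  have hf : ∀ u : X, ((f u : Set.Icc 1 (d (τ v))) : ℕ) = i.color u := fun _ => rfl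
  rw [← Equiv.Perm.sign_extendDomain π f]
  congr 1
  ext a
  obtain ⟨u, hu, ha⟩ := i.exists_color_eq v a
  rw [i.sigma_apply hT g hu a ha]
  by_cases huX : u ∈ X
  · have : a = f ⟨u, huX⟩ := Subtype.ext ha
    rw [this, Equiv.Perm.extendDomain_apply_image, hf, ← hπ]
  · rw [Equiv.Perm.extendDomain_apply_not_subtype, ha, hfix u hu huX]
    rintro ⟨u', hu', h⟩
    have : u = u' := (i.bijOn v).injOn hu (hX u' hu') (ha.symm.trans h)
    exact huX (this ▸ hu')

/-- A group with frames at the ends of an edge that is contained in `Alt_(i)(T)⁺` is dense in it. -/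
theorem LegalColoring.altPlus_le_of_frame (i : LegalColoring T τ d) (hT : IsSemiregularTree T τ d)
    (hcard : ∀ v, 6 ≤ (T.neighborFinset v).card) {H : Subgroup (T ≃g T)}
    (hcl : @IsClosed _ (autTopology T) (H : Set (T ≃g T))) {v w : V} (hvw : T.Adj v w)
    (hM : ∀ p q, IsBase v w p q → ∃ c ∈ ch T q p, ∃ x, IsFrame (H ⊓ i.altPlus hT) p q c x) :
    i.altPlus hT ≤ H := by
  have hTr := hT.isTree
  intro g hg
  -- even local actions are realized by full groups
  have real : ∀ {G : Subgroup (T ≃g T)} {k : T ≃g T} {y : V} {X : Finset V}, k ∈ i.altPlus hT →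
      Full G X → (∀ u ∈ X, T.Adj y u) → (∀ u ∈ X, k u ∈ X) → (∀ u, T.Adj y u → u ∉ X → k u = u) →
      ∃ m ∈ G, ∀ u ∈ X, m u = k u := by
    intro G k y X hk hG hX hkX hfix
    obtain ⟨π, hπ⟩ := exists_perm_eq hkX
    obtain ⟨m, hm, e⟩ := hG (x := π) (by
      rw [Equiv.Perm.mem_alternatingGroup, i.sign_eq_sign_sigma hT hX hfix hπ]
      exact hk.2 y)
    exact ⟨m, hm, fun u hu => by rw [hπ ⟨u, hu⟩, ← e ⟨u, hu⟩]⟩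
  -- Successive approximation: the error m⁻¹g fixes a ball, and its action on the next sphere is
  -- corrected independently over each boundary vertex y, by elements fixing the half-tree on the
  -- near side of y.
  have key : ∀ n, ∃ m ∈ H ⊓ i.altPlus hT, ∀ x, T.dist v x ≤ n + 1 → m x = g x := by
    intro n
    induction n with
    | zero =>
      obtain ⟨m, hm, h⟩ := exists_map_edge_of_frame hTr hcard hvw hM (g.map_adj_iff.mpr hvw)
      have hmv : m v = g v := by
        rcases h with h | h
        · exact h.1
        · exfalso
          have h1 := hm.2.1 v
          rw [h.1, hg.1 w] at h1
          exact hT.type_ne hvw h1.symm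
      have hk : m⁻¹ * g ∈ i.altPlus hT := mul_mem (inv_mem hm.2) hg
      have hkv : (m⁻¹ * g) v = v := by rw [RelIso.mul_apply, ← hmv, RelIso.inv_apply_self]
      obtain ⟨c, hc, x, hx⟩ := hM v w (Or.inl ⟨rfl, rfl⟩)
      obtain ⟨m', hm', e⟩ := real (y := v) hk (hx.full hTr hvw hc)
        (fun u hu => (T.mem_neighborFinset v u).mp hu) (fun u hu => by
          rw [SimpleGraph.mem_neighborFinset] at hu ⊢
          have := (m⁻¹ * g).map_adj_iff.mpr hu
          rwa [hkv] at this) (fun u hu hu' => absurd ((T.mem_neighborFinset v u).mpr hu) hu')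
      refine ⟨m * m', mul_mem hm hm'.1, fun y hy => ?_⟩
      have e' : m' y = (m⁻¹ * g) y := by
        rcases Nat.le_one_iff_eq_zero_or_eq_one.mp hy with h0 | h1
        · rw [← hTr.connected.dist_eq_zero_iff.mp h0, hkv, hm'.2 v rfl]
        · exact e y ((T.mem_neighborFinset v y).mpr (SimpleGraph.dist_eq_one_iff_adj.mp h1))
      rw [RelIso.mul_apply, e', RelIso.mul_apply, RelIso.apply_inv_self]
    | succ n ih =>
      obtain ⟨m, hm, h⟩ := ih
      have hk : m⁻¹ * g ∈ i.altPlus hT := mul_mem (inv_mem hm.2) hg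
      have hkfix : ∀ x, T.dist v x ≤ n + 1 → (m⁻¹ * g) x = x := fun x hx => by
        rw [RelIso.mul_apply, ← h x hx, RelIso.inv_apply_self]
      generalize hkg : m⁻¹ * g = k at hk hkfix
      let Y : Finset V := (finite_ball hTr v (n + 1)).toFinset.filter fun y => T.dist v y = n + 1
      have hY : ∀ {y}, y ∈ Y ↔ T.dist v y = n + 1 := fun {y} => by
        simp only [Y, Finset.mem_filter, Set.Finite.mem_toFinset, Set.mem_ofPred_eq]
        omega
      let X : V → Set V := fun y => {u | T.Adj y u ∧ T.dist v u = n + 2}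
      obtain ⟨m', hm', hD, hX⟩ := exists_patch (M := H ⊓ i.altPlus hT)
        (D := {x | T.dist v x ≤ n + 1}) Y X (fun _ => k) (fun y hy u hu => by
          refine ⟨?_, ?_⟩
          · have := k.map_adj_iff.mpr hu.1
            rwa [hkfix y (hY.mp hy).le] at this
          · have := dist_map hTr k v u
            rw [hkfix v (by rw [SimpleGraph.dist_self]; omega)] at this
            exact this.trans hu.2) (fun y hy => by
          have hyv := hY.mp hy
          obtain ⟨p, hpy, hp⟩ := exists_closer hTr (x := v) (y := y) (by
            rintro rfl; rw [SimpleGraph.dist_self] at hyv; omega)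
          have hvp : T.dist v p < T.dist v y := by omega
          have hside : ∀ x, T.dist v x ≤ n + 1 → x ≠ y → T.dist x p < T.dist x y := by
            intro x hx hxy
            rcases dist_lt_or_lt hTr hpy x with h | h
            · exact h
            · have := dist_eq_add hTr hpy hvp h
              exact absurd (hTr.connected.dist_eq_zero_iff.mp (by omega : T.dist y x = 0)).symm hxy
          have hky := hkfix y hyv.le
          have hkp := hkfix p (by omega)
          obtain ⟨m', hm', e⟩ := real (y := y) hk (full_branch_of_frame hTr hcard hvw hM hpy)
            (fun u hu => (mem_ch.mp hu).2) (fun u hu => map_mem_ch_of_fix hkp hky hu)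
            (fun u hu hu' => by
              rw [mem_ch, not_and, not_imp_not] at hu'
              rw [hu' hu, hkp])
          refine ⟨m', hm'.1, fun u hu => e u (mem_ch_of_dist hu.1 hvp (by rw [hu.2, hyv])),
            fun x hx => ?_, fun y' hy' hne u hu => hm'.2 u ?_⟩
          -- The image of y is a neighbor of p. If it were not y, it would lie in the half-tree of p
          -- and be fixed, against injectivity.
          · by_cases hxy : x = y
            · subst hxy
              have hp' : m' p = p := hm'.2 p (by
                rw [Set.mem_ofPred_eq, SimpleGraph.dist_self, dist_of_adj hpy]
                exact Nat.zero_lt_one)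
              have hadj : T.Adj p (m' x) := by
                have := m'.map_adj_iff.mpr hpy
                rwa [hp'] at this
              by_contra hne
              exact hne (m'.injective (hm'.2 _ (lt_of_branch_ne hTr hadj.symm hpy.symm hne
                (dist_self_lt hadj))))
            · exact hm'.2 x (hside x hx hxy)
          · have h1 := hside y' (hY.mp hy').le hne
            rcases dist_lt_or_lt hTr hpy u with h2 | h2
            · exact h2
            · obtain ⟨-, rfl⟩ := eq_of_adj_of_lt hTr hpy hu.1 h1 h2
              exact absurd hu.2 (by omega))
      refine ⟨m * m', mul_mem hm hm', fun x hx => ?_⟩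
      have e' : m' x = k x := by
        by_cases hx' : T.dist v x ≤ n + 1
        · rw [hD x hx', hkfix x hx']
        · have hxn : T.dist v x = n + 2 := by omega
          obtain ⟨y, hy, hyx⟩ := exists_closer hTr (x := v) (y := x) (by
            rintro rfl; rw [SimpleGraph.dist_self] at hx'; omega)
          exact hX y (hY.mpr (by omega)) x ⟨hy, hxn⟩
      rw [RelIso.mul_apply, e', ← hkg, RelIso.mul_apply, RelIso.apply_inv_self]
  choose m hm hmg using key
  refine mem_of_forall_eventually hcl (l := Filter.atTop) (fun n => (hm n).1) fun x => ?_
  filter_upwards [Filter.eventually_ge_atTop (T.dist v x)] with n hn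
  exact hmg n x (by omega)

end TreeAut

/-! ### The hypotheses on the local actions, and the conclusion. -/

namespace TreeAut

set_option linter.unusedSectionVars false

variable {V : Type*} {T : SimpleGraph V} [T.LocallyFinite] [DecidableEq V]

/-- Edges at v correspond to neighbors of v, and signs are invariant under relabeling. So the even
permutations of the neighbors correspond to those in `F`. -/
theorem full_of_permIsomorphic {H : Subgroup (T ≃g T)} {v : V} {n : ℕ}
    {F : Subgroup (Equiv.Perm (Fin n))} (hF : alternatingGroup (Fin n) ≤ F)
    (h : PermIsomorphic (localAction H v) F) : Full (fixing H {v}) (T.neighborFinset v) := by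
  obtain ⟨e, he⟩ := h
  let f : T.neighborFinset v ≃ T.incidenceSet v :=
    (Equiv.subtypeEquivRight fun u => T.mem_neighborFinset v u).trans
      (T.incidenceSetEquivNeighborSet v).symm
  have hf : ∀ u, (f u : Sym2 V) = s(v, u) := fun _ => rfl
  intro π hπ
  have hmem : (f.trans e).permCongr π ∈ (localAction H v).map
      (e.permCongrHom : Equiv.Perm (T.incidenceSet v) →* Equiv.Perm (Fin n)) := by
    rw [he]
    refine hF ?_
    rw [Equiv.Perm.mem_alternatingGroup, Equiv.Perm.sign_permCongr]
    exact hπ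
  obtain ⟨ρ, ⟨g, hg, rfl⟩, hρ⟩ := hmem
  have hgv : g.1 v = v := g.2
  refine ⟨g.1, ⟨hg, ?_⟩, fun u => ?_⟩
  · rintro _ rfl
    exact hgv
  · have h1 := congrArg (fun k => e.symm (k (e (f u)))) hρ
    have h2 : edgeAction T v g (f u) = f (π u) := by
      simpa [Equiv.permCongrHom, Equiv.permCongr_apply] using h1
    have h3 := congrArg Subtype.val h2
    rw [hf] at h3
    change Sym2.map g.1 (f u : Sym2 V) = _ at h3
    rw [hf, Sym2.map_mk, hgv] at h3
    exact Sym2.congr_right.mp h3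

theorem IsSemiregularTree.isLocallyAlternating {τ : V → Fin 2} {d : Fin 2 → ℕ}
    (hd : ∀ t, 6 ≤ d t) (hT : IsSemiregularTree T τ d) {H : Subgroup (T ≃g T)}
    (h2 : MulAction.IsMultiplyPretransitive H (Ends T) 2) (hτ : H ≤ autPlus T τ)
    (hfull : ∀ v, Full (fixing H {v}) (T.neighborFinset v)) : IsLocallyAlternating T H := by
  have hcard : ∀ v, 6 ≤ (T.neighborFinset v).card := by
    intro v
    have h1 : (T.neighborSet v).encard = (T.neighborFinset v).card := by
      rw [← Set.encard_coe_eq_coe_finsetCard, SimpleGraph.coe_neighborFinset]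
    rw [hT.degree] at h1
    have := hd (τ v)
    have h3 : d (τ v) = (T.neighborFinset v).card := by exact_mod_cast h1
    omega
  refine ⟨hT.isTree, hcard, hfull, fun hu hu' e e' => exists_fix_fix_map_eq hT.isTree
    hT.type_ne (fun h hh => hτ hh) (fun a b hab => ?_) h2 (fun v a b ha hb => ?_) hu hu' e e'⟩
  · obtain ⟨c, hc, hca⟩ := exists_not_mem_of_card_lt (X := T.neighborFinset b) {a}
      (by rw [Finset.card_singleton]; have := hcard b; omega)
    rw [SimpleGraph.mem_neighborFinset] at hc
    exact ⟨c, hc, fun h => hca (Finset.mem_singleton.mpr h.symm)⟩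
  · obtain ⟨g, hg, e⟩ := (hfull v).exists_apply_eq (by have := hcard v; omega)
      ((T.mem_neighborFinset v a).mpr ha) ((T.mem_neighborFinset v b).mpr hb)
    exact ⟨g, hg.1, hg.2 v rfl, e⟩

end TreeAut

theorem theoremG {V : Type*} (T : SimpleGraph V) (τ : V → Fin 2) (d : Fin 2 → ℕ)
    (hd : ∀ t, 6 ≤ d t) (hT : TreeAut.IsSemiregularTree T τ d)
    (H : Subgroup (T ≃g T)) (hH : H ∈ TreeAut.HPlus T τ)
    (F : (t : Fin 2) → Subgroup (Equiv.Perm (Fin (d t))))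
    (hF : ∀ t, alternatingGroup (Fin (d t)) ≤ F t)
    (hlocal : ∀ v, TreeAut.PermIsomorphic (TreeAut.localAction H v) (F (τ v))) :
    ∃ i : TreeAut.LegalColoring T τ d, i.altPlus hT ≤ H := by
  classical
  have : T.LocallyFinite := fun v => by
    have : Finite (T.neighborSet v) := Set.finite_coe_iff.mpr
      (Set.encard_lt_top_iff.mp (by rw [hT.degree]; exact ENat.natCast_lt_top _))
    exact Fintype.ofFinite _
  obtain ⟨hcl, h2, hτ⟩ := hH
  have hloc := hT.isLocallyAlternating hd h2 hτ fun v =>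
    TreeAut.full_of_permIsomorphic (hF (τ v)) (hlocal v)
  obtain ⟨v⟩ := hT.isTree.connected.nonempty
  obtain ⟨w, hw, -⟩ := TreeAut.exists_not_mem_of_card_lt (X := T.neighborFinset v) ∅
    (by rw [Finset.card_empty]; have := hloc.card v; omega)
  rw [SimpleGraph.mem_neighborFinset] at hw
  obtain ⟨i, hi⟩ := hloc.exists_coloring_frame hcl hT (fun t => by have := hd t; omega) hτ hw
  exact ⟨i, i.altPlus_le_of_frame hT hloc.card hcl hw hi⟩
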